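/- Let $G$ be a non-trivial finitely generated group with an agrarian embedding, i.e. an injective ring homomorphism $\alpha\colon \mathbb{Z}G\hookrightarrow D$ into a skew field $D$. Let $H$ be the free part of the abelianisation of $G$ (the abelianisation modulo torsion), $\mathrm{pr}\colon G\to H$ the projection, and $s\colon H\to G$ a set-theoretic section of $\mathrm{pr}$. Let $DH$ be the twisted group ring of finite sums $\sum_h u_h\ast h$ with $u_h \in D$ and multiplication $$(u\ast h)(v\ast h')=u\,\alpha(s(h))\,v\,\alpha(s(h))^{-1}\,\alpha\big(s(h)s(h')s(hh')^{-1}\big)\ast hh',$$ let $D_r=\mathrm{Ore}(DH)$ be its Ore field of fractions, and let $\alpha_r\colon\mathbb{Z}G\to D_r$, $g\mapsto \alpha\big(g\,s(\mathrm{pr}(g))^{-1}\big)\ast \mathrm{pr}(g)$, be the rationalisation of $\alpha$. View $D_r$ as a right $\mathbb{Z}G$-module via $\alpha_r$. Let $X$ be a finite free $G$-CW-complex with cellular $\mathbb{Z}G$-chain complex $C_*=C_*(X)$, $C_n(X)=H_n(X_n,X_{n-1})$, and suppose that $X$ is $D_r$-acyclic, i.e. $H_n(D_r\otimes_{\mathbb{Z}G}C_*)=0$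 for all $n$. Let $\varphi\colon G\to\mathbb{Z}$ be a homomorphism. *Agrarian polytope.* Choose finite ordered $\mathbb{Z}G$-bases of the modules $C_p$, $0\le p\le m$ (where $C_p=0$ for $p>m$), all of whose elements are classes of oriented cells of $X$. Let $A_p$ be the matrix of the differential $C_{p+1}\to C_p$, whose rows are the coordinates of the images of the basis elements of $C_{p+1}$. Choose subsets $\gamma_p$ of the bases with $\gamma_0=\emptyset$ such that for $0\le p<m$ the submatrix $S_p$ of $A_p$ with rows in $\gamma_{p+1}$ and columns not in $\gamma_p$ is square and becomes invertible over $D_r$. The torsion is $\rho(X)=\sum_{p=0}^{m-1}(-1)^p\det_{D_r}(S_p)\in (D_r^\times)_{\mathrm{ab}}/\{\pm1\}$ (written additively), where $\det_{D_r}$ is the Dieudonné determinant. Let $\mathcal{P}(H)$ be the Grothendieck group of the monoid of integral polytopes in $\mathbb{R}\otimes_{\mathbb{Z}}H$ under Minkowski sum and $\mathcal{P}_T(H)=\mathcal{P}(H)/H$ its quotient by translations. For $0\ne p\in DH$ let $P(p)$ be the convex hull of the support of $p$, and let $P\colon (D_r^\times)_{\mathrm{ab}}/\{\pm1\}\to\mathcal{P}(H)$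 be the homomorphism with $P(q^{-1}p)=P(p)-P(q)$. The agrarian polytope $P^{D_r}(X)\in\mathcal{P}_T(H)$ is the class of $P(-\rho(X))$. *Thickness.* Let $\bar\varphi\colon\mathbb{R}\otimes_{\mathbb{Z}}H\to\mathbb{R}$ be the linear map induced by $\varphi$, and let $\mathrm{th}_\varphi\colon\mathcal{P}_T(H)\to\mathbb{R}$ be the homomorphism with $\mathrm{th}_\varphi(Q)=\max\{\bar\varphi(x)-\bar\varphi(y)\mid x,y\in Q\}$ for every integral polytope $Q$. *Twisted Euler characteristic.* Let $\varphi^*\mathbb{Z}[t,t^{-1}]$ be the $\mathbb{Z}G$-module $\mathbb{Z}[t,t^{-1}]$ on which $g\in G$ acts by multiplication with $t^{\varphi(g)}$, and put $b_p(X;\varphi)=\dim_{D_r}H_p\big(D_r\otimes_{\mathbb{Z}G}(C_*\otimes_{\mathbb{Z}}\varphi^*\mathbb{Z}[t,t^{-1}])\big)$, with the diagonal $G$-action on $C_*\otimes_{\mathbb{Z}}\varphi^*\mathbb{Z}[t,t^{-1}]$. **Theorem.** $\sum_{p\ge0}b_p(X;\varphi)<\infty$, so that the $\varphi$-twisted $D_r$-agrarian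 Euler characteristic $\chi^{D_r}(X;\varphi)=\sum_{p\ge0}(-1)^pb_p(X;\varphi)\in\mathbb{Z}$ is defined, and for every choice made above $$\mathrm{th}_\varphi\big(P^{D_r}(X)\big)=-\chi^{D_r}(X;\varphi).$$ -/

import Mathlib

open scoped Pointwise TensorProduct nonZeroDivisors

noncomputable section

/-- Structure functions `c : Γ → Aut R` and `τ : Γ × Γ → Rˣ` of a twisted group ring:
`c g ∘ c g' = c_{τ(g,g')} ∘ c (g g')` (with `c_r` conjugation by `r`) and
`τ(g,g') τ(gg',g'') = c(g)(τ(g',g'')) τ(g,g'g'')`. -/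
structure StructureFunctions (R Γ : Type*) [Ring R] [Group Γ] where
  c : Γ → R ≃+* R
  τ : Γ → Γ → Rˣ
  c_comp : ∀ (g g' : Γ) (r : R),
    c g (c g' r) = (τ g g' : R) * c (g * g') r * ((τ g g')⁻¹ : Rˣ)
  cocycle : ∀ g g' g'' : Γ,
    (τ g g' : R) * τ (g * g') g'' = c g (τ g' g'') * τ g (g' * g'')

/-- The twisted group ring `RΓ`: the free left `R`-module on `Γ`, i.e. finite sums `∑ u_g ∗ g`, with
the multiplication `(u ∗ g) (v ∗ g') = u c(g)(v) τ(g,g') ∗ gg'` (defined below). -/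
def TwistedGroupRing {R Γ : Type*} [Ring R] [Group Γ] (_S : StructureFunctions R Γ) : Type _ :=
  Γ →₀ R

namespace TwistedGroupRing

variable {R Γ : Type*} [Ring R] [Group Γ] {S : StructureFunctions R Γ}

instance : AddCommGroup (TwistedGroupRing S) := inferInstanceAs (AddCommGroup (Γ →₀ R))

/-- The coefficient function of an element. -/
def coeff (x : TwistedGroupRing S) : Γ →₀ R := x

/-- The element `u ∗ g`. -/
def single (S : StructureFunctions R Γ) (g : Γ) (u : R) : TwistedGroupRing S := Finsupp.single g u

instance : Mul (TwistedGroupRing S) where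
  mul x y := x.coeff.sum fun a u => y.coeff.sum fun b v =>
    single S (a * b) (u * S.c a v * S.τ a b)

instance : One (TwistedGroupRing S) where
  one := single S 1 ((S.τ 1 1)⁻¹ : Rˣ)

theorem mul_def (x y : TwistedGroupRing S) : x * y =
    x.coeff.sum fun a u => y.coeff.sum fun b v => single S (a * b) (u * S.c a v * S.τ a b) := rfl

theorem one_def : (1 : TwistedGroupRing S) = single S 1 ((S.τ 1 1)⁻¹ : Rˣ) := rfl

theorem single_zero (g : Γ) : single S g 0 = 0 := Finsupp.single_zero g

theorem single_add (g : Γ) (u v : R) : single S g (u + v) = single S g u + single S g v :=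
  Finsupp.single_add g u v

theorem single_mul_single (a b : Γ) (u v : R) :
    single S a u * single S b v = single S (a * b) (u * S.c a v * S.τ a b) := by
  rw [mul_def]
  refine (Finsupp.sum_single_index ?_).trans (Finsupp.sum_single_index ?_)
  · simp [single_zero]
  · simp [single_zero]

protected theorem add_mul (x y z : TwistedGroupRing S) : (x + y) * z = x * z + y * z := by
  simp only [mul_def]
  refine Finsupp.sum_add_index' (fun a => ?_) (fun a u v => ?_)
  · simp [single_zero]
  · simp [_root_.add_mul, single_add, Finsupp.sum_add]

protected theorem mul_add (x y z : TwistedGroupRing S) : x * (y + z) = x * y + x * z := by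
  simp only [mul_def]
  rw [← Finsupp.sum_add]
  refine Finsupp.sum_congr fun a _ => ?_
  refine Finsupp.sum_add_index' (fun b => ?_) (fun b u v => ?_)
  · simp [single_zero]
  · simp [_root_.add_mul, _root_.mul_add, single_add]

protected theorem zero_mul (x : TwistedGroupRing S) : 0 * x = 0 := Finsupp.sum_zero_index

protected theorem mul_zero (x : TwistedGroupRing S) : x * 0 = 0 := by
  have := TwistedGroupRing.mul_add x 0 0
  simpa using this

@[elab_as_elim]
theorem induction {p : TwistedGroupRing S → Prop} (x : TwistedGroupRing S) (h0 : p 0)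
    (ha : ∀ x y, p x → p y → p (x + y)) (hs : ∀ g u, p (single S g u)) : p x :=
  Finsupp.induction_linear (motive := p) x h0 ha hs

theorem c_one (r : R) : S.c 1 r = (S.τ 1 1 : R) * r * ((S.τ 1 1)⁻¹ : Rˣ) := by
  obtain ⟨r, rfl⟩ := (S.c 1).surjective r
  simpa using S.c_comp 1 1 r

theorem τ_one_left (b : Γ) : S.τ 1 b = S.τ 1 1 := by
  have h := S.cocycle 1 1 b
  rw [c_one, one_mul, one_mul] at h
  have h2 : S.τ 1 1 * S.τ 1 b = S.τ 1 1 * S.τ 1 b * (S.τ 1 1)⁻¹ * S.τ 1 b := by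
    ext; simpa using h
  rw [mul_assoc (S.τ 1 1 * S.τ 1 b)] at h2
  have h3 := (mul_eq_left.mp h2.symm)
  exact (inv_mul_eq_one.mp h3).symm

theorem τ_one_right (a : Γ) : (S.τ a 1 : R) = S.c a (S.τ 1 1) := by
  have h := S.cocycle a 1 1
  simpa using h

protected theorem one_mul (x : TwistedGroupRing S) : 1 * x = x := by
  induction x using induction with
  | h0 => exact TwistedGroupRing.mul_zero _
  | ha x y hx hy => rw [TwistedGroupRing.mul_add, hx, hy]
  | hs g u =>
    rw [one_def, single_mul_single, c_one, τ_one_left g]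
    simp [mul_assoc]

protected theorem mul_one (x : TwistedGroupRing S) : x * 1 = x := by
  induction x using induction with
  | h0 => exact TwistedGroupRing.zero_mul _
  | ha x y hx hy => rw [TwistedGroupRing.add_mul, hx, hy]
  | hs g u =>
    rw [one_def, single_mul_single, τ_one_right, mul_assoc, ← map_mul]
    simp

protected theorem mul_assoc (x y z : TwistedGroupRing S) : x * y * z = x * (y * z) := by
  induction x using induction with
  | h0 => simp only [TwistedGroupRing.zero_mul]
  | ha x x' hx hx' => simp only [TwistedGroupRing.add_mul, hx, hx']
  | hs a u =>
  induction y using induction with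
  | h0 => simp only [TwistedGroupRing.zero_mul, TwistedGroupRing.mul_zero]
  | ha x x' hx hx' => simp only [TwistedGroupRing.add_mul, TwistedGroupRing.mul_add, hx, hx']
  | hs b v =>
  induction z using induction with
  | h0 => simp only [TwistedGroupRing.mul_zero]
  | ha x x' hx hx' => simp only [TwistedGroupRing.mul_add, hx, hx']
  | hs d w =>
    simp only [single_mul_single, mul_assoc, map_mul]
    congr 1
    rw [← S.cocycle, S.c_comp]
    simp [mul_assoc]

instance : Ring (TwistedGroupRing S) :=
  { (inferInstance : AddCommGroup (TwistedGroupRing S)) with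
    mul := (· * ·)
    one := 1
    left_distrib := TwistedGroupRing.mul_add
    right_distrib := TwistedGroupRing.add_mul
    zero_mul := TwistedGroupRing.zero_mul
    mul_zero := TwistedGroupRing.mul_zero
    mul_assoc := TwistedGroupRing.mul_assoc
    one_mul := TwistedGroupRing.one_mul
    mul_one := TwistedGroupRing.mul_one }

theorem coeff_zero : (0 : TwistedGroupRing S).coeff = 0 := rfl
theorem coeff_add (x y : TwistedGroupRing S) : (x + y).coeff = x.coeff + y.coeff := rfl
theorem coeff_sub (x y : TwistedGroupRing S) : (x - y).coeff = x.coeff - y.coeff := rfl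
theorem coeff_eq_zero {x : TwistedGroupRing S} : x.coeff = 0 ↔ x = 0 := Iff.rfl
theorem coeff_single (g : Γ) (u : R) : (single S g u).coeff = Finsupp.single g u := rfl

/-- The coefficients of a product. -/
theorem coeff_mul (x y : TwistedGroupRing S) (g : Γ) : (x * y).coeff g =
    x.coeff.sum fun a u => u * S.c a (y.coeff (a⁻¹ * g)) * S.τ a (a⁻¹ * g) := by
  classical
  induction x using induction with
  | h0 => rw [zero_mul]; rfl
  | ha x x' hx hx' =>
    rw [add_mul, coeff_add, Finsupp.add_apply, hx, hx', coeff_add, Finsupp.sum_add_index']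
    · simp
    · simp [add_mul]
  | hs a u =>
    rw [coeff_single, Finsupp.sum_single_index (by simp)]
    induction y using induction with
    | h0 => rw [mul_zero]; simp [coeff_zero]
    | ha y y' hy hy' =>
      rw [mul_add, coeff_add, Finsupp.add_apply, hy, hy', coeff_add]
      simp [mul_add, add_mul]
    | hs b v =>
      rw [single_mul_single, coeff_single, coeff_single, Finsupp.single_apply, Finsupp.single_apply]
      by_cases h : a * b = g
      · subst h; simp
      · have : b ≠ a⁻¹ * g := by rintro rfl; simp at h
        simp [h, this]

theorem support_mul [DecidableEq Γ] (x y : TwistedGroupRing S) :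
    (x * y).coeff.support ⊆ x.coeff.support * y.coeff.support := by
  intro g hg
  rw [Finsupp.mem_support_iff, coeff_mul] at hg
  obtain ⟨a, ha, h⟩ := Finset.exists_ne_zero_of_sum_ne_zero hg
  refine Finset.mem_mul.mpr ⟨a, ha, a⁻¹ * g, ?_, by simp⟩
  rw [Finsupp.mem_support_iff]
  intro h0
  simp [h0] at h

theorem coeff_mul_of_uniqueMul [NoZeroDivisors R] [Nontrivial R] (x y : TwistedGroupRing S)
    {a b : Γ} (ha : a ∈ x.coeff.support) (hb : b ∈ y.coeff.support)
    (h : UniqueMul x.coeff.support y.coeff.support a b) : (x * y).coeff (a * b) ≠ 0 := by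
  rw [coeff_mul, Finsupp.sum, Finset.sum_eq_single a]
  · rw [Finsupp.mem_support_iff] at ha hb
    simp [ha, hb]
  · intro a' ha' hne
    by_cases hb' : a'⁻¹ * (a * b) ∈ y.coeff.support
    · exact absurd (h ha' hb' (by simp)).1 hne
    · rw [Finsupp.notMem_support_iff] at hb'
      simp [hb']
  · intro h'; exact absurd ha h'

instance [Nontrivial R] : Nontrivial (TwistedGroupRing S) :=
  inferInstanceAs (Nontrivial (Γ →₀ R))

instance [Nontrivial R] [NoZeroDivisors R] [UniqueProds Γ] : NoZeroDivisors (TwistedGroupRing S) where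
  eq_zero_or_eq_zero_of_mul_eq_zero {x y} hxy := by
    by_contra! hcon
    obtain ⟨a, ha, b, hb, h⟩ := UniqueProds.uniqueMul_of_nonempty
        (Finsupp.support_nonempty_iff.mpr (mt coeff_eq_zero.mp hcon.1))
        (Finsupp.support_nonempty_iff.mpr (mt coeff_eq_zero.mp hcon.2))
    exact coeff_mul_of_uniqueMul x y ha hb h (by rw [hxy]; rfl)

end TwistedGroupRing

section Ore

/-- Finite subsets of an abelian group have Følner sets (by polynomial growth). -/
theorem exists_finset_card_mul_lt {Γ : Type*} [CommGroup Γ] [DecidableEq Γ] (F : Finset Γ)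
    (hF : F.Nonempty) : ∃ B : Finset Γ, B.Nonempty ∧ (B * F).card < 2 * B.card := by
  by_contra! hcon
  have hlow : ∀ n : ℕ, 2 ^ n ≤ (F ^ n).card := by
    intro n
    induction n with
    | zero => simp
    | succ n ih =>
      have := hcon (F ^ n) hF.pow
      rw [← pow_succ] at this
      rw [pow_succ]; omega
  have hup : ∀ n : ℕ, (F ^ n).card ≤ (n + 1) ^ F.card := by
    intro n
    have hsub : F ^ n ⊆ (Fintype.piFinset fun _ : F => Finset.range (n + 1)).image
        fun k => ∏ f : F, (f : Γ) ^ k f := by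
      induction n with
      | zero =>
        intro x hx
        simp only [pow_zero, Finset.mem_one] at hx
        exact Finset.mem_image.mpr ⟨fun _ => 0, by simp, by simp [hx]⟩
      | succ n ih =>
        intro x hx
        rw [pow_succ] at hx
        obtain ⟨y, hy, f, hf, rfl⟩ := Finset.mem_mul.mp hx
        obtain ⟨k, hk, rfl⟩ := Finset.mem_image.mp (ih hy)
        refine Finset.mem_image.mpr ⟨fun g => k g + if g = ⟨f, hf⟩ then 1 else 0, ?_, ?_⟩
        · simp only [Fintype.mem_piFinset, Finset.mem_range] at hk ⊢
          intro g
          have := hk g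
          split_ifs <;> omega
        · simp only [pow_add, Finset.prod_mul_distrib, pow_ite, pow_one, pow_zero]
          rw [Finset.prod_ite_eq' Finset.univ (⟨f, hf⟩ : F), if_pos (Finset.mem_univ _)]
    refine (Finset.card_le_card hsub).trans (Finset.card_image_le.trans ?_)
    simp
  have hlim := tendsto_pow_const_div_const_pow_of_one_lt F.card (one_lt_two : (1 : ℝ) < 2)
  have hlim' := (Filter.tendsto_add_atTop_iff_nat 1).mpr hlim
  obtain ⟨n, hn⟩ := (hlim'.eventually (gt_mem_nhds (by norm_num : (0 : ℝ) < 1 / 2))).exists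
  have h1 := (hlow n).trans (hup n)
  have h2 : (2 : ℝ) ^ n ≤ ((n : ℝ) + 1) ^ F.card := by exact_mod_cast h1
  rw [div_lt_iff₀ (by positivity), pow_succ] at hn
  push_cast at hn
  linarith

namespace TwistedGroupRing

variable {D Γ : Type*} [DivisionRing D] [CommGroup Γ] [UniqueProds Γ] {S : StructureFunctions D Γ}

/-- The Ore condition for the twisted group ring of an abelian group over a skew field. -/
theorem ore_condition (p q : TwistedGroupRing S) (hq : q ≠ 0) :
    ∃ r s : TwistedGroupRing S, s ≠ 0 ∧ s * p = r * q := by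
  classical
  by_cases hp : p = 0
  · exact ⟨0, 1, one_ne_zero, by simp [hp]⟩
  obtain ⟨B, hB, hcard⟩ := exists_finset_card_mul_lt (p.coeff.support ∪ q.coeff.support)
    ((Finsupp.support_nonempty_iff.mpr (mt coeff_eq_zero.mp hq)).inr)
  set F := p.coeff.support ∪ q.coeff.support with hF
  let e : (B → D) → TwistedGroupRing S := fun x => ∑ b : B, single S b (x b)
  have he_add : ∀ x y, e (x + y) = e x + e y := fun x y => by
    simp [e, single_add, Finset.sum_add_distrib]
  have hsm : ∀ (u : D) (x : B → D) (z : TwistedGroupRing S) (g : Γ),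
      (e (u • x) * z).coeff g = u * (e x * z).coeff g := by
    intro u x z g
    have hc : ∀ x' : B → D, (e x' * z).coeff g =
        ∑ b : B, x' b * S.c b (z.coeff ((b : Γ)⁻¹ * g)) * S.τ b ((b : Γ)⁻¹ * g) := by
      intro x'
      have h1 : e x' * z = ∑ b : B, single S b (x' b) * z := Finset.sum_mul _ _ _
      have h2 : ∀ (s : Finset B) (f : B → TwistedGroupRing S),
          (∑ b ∈ s, f b).coeff g = ∑ b ∈ s, (f b).coeff g :=
        fun s f => Finsupp.finsetSum_apply s f g
      rw [h1, h2]
      refine Finset.sum_congr rfl fun b _ => ?_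
      rw [coeff_mul, coeff_single, Finsupp.sum_single_index (by simp)]
    rw [hc, hc, Finset.mul_sum]
    simp [mul_assoc]
  have hecoeff : ∀ (x : B → D) (b : B), (e x).coeff b = x b := by
    intro x b
    have h2 : (e x).coeff b = ∑ b' : B, (single S b' (x b')).coeff b :=
      Finsupp.finsetSum_apply _ _ _
    rw [h2, Finset.sum_eq_single b]
    · simp [coeff_single]
    · intro b' _ hne
      rw [coeff_single, Finsupp.single_apply, if_neg fun h => hne (Subtype.ext h)]
    · simp
  have hesupp : ∀ x, (e x).coeff.support ⊆ B := by
    intro x g hg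
    by_contra hgB
    rw [Finsupp.mem_support_iff] at hg
    apply hg
    have h2 : (e x).coeff g = ∑ b' : B, (single S b' (x b')).coeff g :=
      Finsupp.finsetSum_apply _ _ _
    rw [h2]
    refine Finset.sum_eq_zero fun b _ => ?_
    rw [coeff_single, Finsupp.single_apply, if_neg]
    rintro rfl; exact hgB b.2
  let L : ((B → D) × (B → D)) →ₗ[D] ((B * F : Finset Γ) → D) :=
    { toFun := fun x k => (e x.1 * p).coeff k - (e x.2 * q).coeff k
      map_add' := fun x y => by
        ext k
        simp only [Prod.fst_add, Prod.snd_add, he_add, add_mul, coeff_add, Finsupp.add_apply,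
          Pi.add_apply]
        abel
      map_smul' := fun u x => by
        ext k
        simp only [Prod.smul_fst, Prod.smul_snd, hsm, Pi.smul_apply, smul_eq_mul, mul_sub,
          RingHom.id_apply] }
  have hker : LinearMap.ker L ≠ ⊥ := by
    apply LinearMap.ker_ne_bot_of_finrank_lt
    simpa [Module.finrank_prod, two_mul] using hcard
  obtain ⟨⟨x, y⟩, hxy, hne⟩ := (Submodule.ne_bot_iff _).mp hker
  have hEq : e x * p = e y * q := by
    rw [← sub_eq_zero, ← coeff_eq_zero]
    ext g
    rw [coeff_sub, Finsupp.sub_apply, Finsupp.zero_apply]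
    by_cases hg : g ∈ B * F
    · exact congrFun (LinearMap.mem_ker.mp hxy) ⟨g, hg⟩
    · have h1 : (e x * p).coeff g = 0 := by
        by_contra h
        exact hg (Finset.mul_subset_mul (hesupp x) Finset.subset_union_left
          (support_mul _ _ (Finsupp.mem_support_iff.mpr h)))
      have h2 : (e y * q).coeff g = 0 := by
        by_contra h
        exact hg (Finset.mul_subset_mul (hesupp y) Finset.subset_union_right
          (support_mul _ _ (Finsupp.mem_support_iff.mpr h)))
      rw [h1, h2, sub_zero]
  have hinj : ∀ x, e x = 0 → x = 0 := fun x hx => by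
    ext b; rw [← hecoeff x b, hx]; rfl
  refine ⟨e y, e x, fun hx => hne ?_, hEq⟩
  have hx0 := hinj x hx
  rw [hx, zero_mul, eq_comm, mul_eq_zero] at hEq
  have hy0 := hinj y (hEq.resolve_right hq)
  simp [hx0, hy0]

instance : OreLocalization.OreSet (TwistedGroupRing S)⁰ :=
  Classical.choice <| OreLocalization.nonempty_oreSet_iff_of_noZeroDivisors.mpr fun p q => by
    obtain ⟨r, s, hs, h⟩ := ore_condition p q.1 (nonZeroDivisors.ne_zero q.2)
    exact ⟨r, ⟨s, mem_nonZeroDivisors_of_ne_zero hs⟩, h⟩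

/-- The Ore field of fractions `Ore(DΓ)`, whose elements are the fractions `q⁻¹ p` with `q ≠ 0`.
It is a skew field by Mathlib's `OreLocalization` instances. -/
abbrev OreField (S : StructureFunctions D Γ) : Type _ :=
  OreLocalization (TwistedGroupRing S)⁰ (TwistedGroupRing S)

end TwistedGroupRing

end Ore

section Polytope

open Algebra

/-- The real vector space `ℝ ⊗ H`. -/
abbrev RealSpan (H : Type*) [CommGroup H] : Type _ := ℝ ⊗[ℤ] Additive H

/-- The lattice point of `ℝ ⊗ H` given by an element of `H`. -/
def latticePoint {H : Type*} [CommGroup H] (h : H) : RealSpan H := (1 : ℝ) ⊗ₜ[ℤ] Additive.ofMul h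

theorem latticePoint_mul {H : Type*} [CommGroup H] (g h : H) :
    latticePoint (g * h) = latticePoint g + latticePoint h := by
  simp [latticePoint, TensorProduct.tmul_add]

theorem latticePoint_one {H : Type*} [CommGroup H] : latticePoint (1 : H) = 0 := by
  simp [latticePoint]

theorem latticePoint_injective {H : Type*} [CommGroup H] [IsMulTorsionFree H] :
    Function.Injective (latticePoint : H → RealSpan H) := by
  have : Module.IsTorsionFree ℤ (Additive H) := inferInstance
  have : Module.Flat ℤ (Additive H) := inferInstance
  have h := Module.Flat.rTensor_preserves_injective_linearMap (M := Additive H)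
    (Algebra.linearMap ℤ ℝ) (by exact Int.cast_injective)
  intro a b hab
  have h2 := h (a₁ := (1 : ℤ) ⊗ₜ Additive.ofMul a) (a₂ := (1 : ℤ) ⊗ₜ Additive.ofMul b)
    (by simpa [latticePoint] using hab)
  have h3 := congrArg (TensorProduct.lid ℤ (Additive H)) h2
  simpa using h3

/-- The monoid of integral polytopes in `ℝ ⊗ H` under Minkowski sum: the convex hulls of nonempty
finite sets of lattice points. -/
def integralPolytopes (H : Type*) [CommGroup H] : AddSubmonoid (Set (RealSpan H)) where
  carrier := {P | ∃ A : Finset H, A.Nonempty ∧ P = convexHull ℝ (latticePoint '' (A : Set H))}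
  zero_mem' := ⟨{1}, by simp, by simp [latticePoint_one, Set.singleton_zero]⟩
  add_mem' := by
    classical
    rintro _ _ ⟨A, hA, rfl⟩ ⟨B, hB, rfl⟩
    refine ⟨A * B, hA.mul hB, ?_⟩
    rw [← convexHull_add, Finset.coe_mul, ← Set.image2_mul, ← Set.image2_add,
      Set.image_image2_distrib latticePoint_mul]

/-- The polytope group `𝒫(H)`: the Grothendieck group of the monoid of integral polytopes. -/
abbrev PolytopeGroup (H : Type*) [CommGroup H] : Type _ :=
  GrothendieckAddGroup (integralPolytopes H)

/-- The convex hull of a nonempty finite subset of `H`. -/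
def latticePolytope {H : Type*} [CommGroup H] (A : Finset H) (hA : A.Nonempty) :
    integralPolytopes H :=
  ⟨convexHull ℝ (latticePoint '' (A : Set H)), A, hA, rfl⟩

/-- The embedding `H → 𝒫(H)`, `h ↦ {h}`. -/
def pointPolytope (H : Type*) [CommGroup H] : Additive H →+ PolytopeGroup H where
  toFun h := GrothendieckAddGroup.of (latticePolytope {h.toMul} (Finset.singleton_nonempty _))
  map_zero' := by
    have : latticePolytope {(0 : Additive H).toMul} (Finset.singleton_nonempty _) = 0 := by
      ext1; simp [latticePolytope, latticePoint_one, Set.singleton_zero]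
    rw [this, map_zero]
  map_add' g h := by
    rw [← map_add]
    congr 1
    ext1; simp [latticePolytope, latticePoint_mul]

/-- The translation-invariant polytope group `𝒫_T(H) = 𝒫(H) / H`. -/
abbrev TranslationPolytopeGroup (H : Type*) [CommGroup H] : Type _ :=
  PolytopeGroup H ⧸ (pointPolytope H).range

theorem mem_extremePoints_convexHull_of_notMem {E : Type*} [AddCommGroup E] [Module ℝ E]
    {T : Set E} {c : E} (hc : c ∉ convexHull ℝ T) {x y : E}
    (hx : x ∈ convexHull ℝ (insert c T)) (hy : y ∈ convexHull ℝ (insert c T))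
    (hxy : x + y = c + c) : x = c ∧ y = c := by
  rcases T.eq_empty_or_nonempty with rfl | hT
  · simp at hx hy; exact ⟨hx, hy⟩
  simp only [convexHull_insert hT, mem_convexJoin, Set.mem_singleton_iff, exists_eq_left] at hx hy
  obtain ⟨x', hx', a, s, ha, hs, has, rfl⟩ := hx
  obtain ⟨y', hy', b, t, hb, ht, hbt, rfl⟩ := hy
  by_cases h0 : s + t = 0
  · have hs0 : s = 0 := by linarith
    have ht0 : t = 0 := by linarith
    subst hs0 ht0
    simp at has hbt
    simp [has, hbt]
  · exfalso
    apply hc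
    have hpos : 0 < s + t := lt_of_le_of_ne (add_nonneg hs ht) (Ne.symm h0)
    have hEq : (s + t) • c = s • x' + t • y' := by
      have h1 : a = 1 - s := by linarith
      have h2 : b = 1 - t := by linarith
      subst h1 h2
      have h3 : ((1 - s) • c + s • x' + ((1 - t) • c + t • y')) - (c + c) = 0 :=
        sub_eq_zero.mpr hxy
      rw [← sub_eq_zero, ← neg_eq_zero, ← h3]
      module
    have : c = (s / (s + t)) • x' + (t / (s + t)) • y' := by
      rw [div_eq_inv_mul, div_eq_inv_mul, mul_smul, mul_smul, ← smul_add, ← hEq, smul_smul,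
        inv_mul_cancel₀ h0, one_smul]
    rw [this]
    exact convex_convexHull ℝ T hx' hy' (by positivity) (by positivity)
      (by rw [← add_div, div_self h0])

/-- A finite set contains a minimal subset with the same convex hull. -/
theorem exists_minimal_convexHull {E : Type*} [AddCommGroup E] [Module ℝ E] (T : Finset E) :
    ∃ T' ⊆ T, convexHull ℝ (T' : Set E) = convexHull ℝ (T : Set E) ∧
      ∀ c ∈ T', c ∉ convexHull ℝ ((T' : Set E) \ {c}) := by
  classical
  let P : Finset (Finset E) := T.powerset.filter fun U =>
    convexHull ℝ (U : Set E) = convexHull ℝ (T : Set E)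
  have hP : P.Nonempty := ⟨T, by simp [P]⟩
  obtain ⟨T', hT'⟩ := P.exists_minimal hP
  have hm := hT'.1
  simp only [P, Finset.mem_filter, Finset.mem_powerset] at hm
  refine ⟨T', hm.1, hm.2, fun c hc hmem => ?_⟩
  have hE : T'.erase c ∈ P := by
    simp only [P, Finset.mem_filter, Finset.mem_powerset]
    refine ⟨(Finset.erase_subset _ _).trans hm.1, ?_⟩
    rw [← hm.2, Finset.coe_erase]
    apply (convexHull_mono Set.sdiff_subset).antisymm
    refine convexHull_min (fun x hx => ?_) (convex_convexHull ℝ _)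
    by_cases hxc : x = c
    · rwa [hxc]
    · exact subset_convexHull ℝ _ ⟨hx, hxc⟩
  have := hT'.2 hE (Finset.erase_subset _ _)
  exact Finset.notMem_erase c T' (this hc)

namespace TwistedGroupRing

variable {D H : Type*} [DivisionRing D] [CommGroup H] {S : StructureFunctions D H}

/-- The Newton polytope of a nonzero element: the convex hull of its support. -/
def newtonPolytope (x : TwistedGroupRing S) (hx : x ≠ 0) : integralPolytopes H :=
  latticePolytope x.coeff.support (Finsupp.support_nonempty_iff.mpr (mt coeff_eq_zero.mp hx))

theorem newtonPolytope_mul [IsMulTorsionFree H] (x y : TwistedGroupRing S) (hx : x ≠ 0)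
    (hy : y ≠ 0) (hxy : x * y ≠ 0) :
    newtonPolytope (x * y) hxy = newtonPolytope x hx + newtonPolytope y hy := by
  classical
  ext1
  change convexHull ℝ (latticePoint '' ((x * y).coeff.support : Set H)) =
    convexHull ℝ (latticePoint '' (x.coeff.support : Set H)) +
      convexHull ℝ (latticePoint '' (y.coeff.support : Set H))
  rw [← convexHull_add, ← Set.image2_add, ← Set.image_image2_distrib latticePoint_mul,
    Set.image2_mul, ← Finset.coe_mul]
  apply (convexHull_mono (Set.image_mono (by exact_mod_cast support_mul x y))).antisymm
  obtain ⟨T', hsub, hhull, hmin⟩ :=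
    exists_minimal_convexHull ((x.coeff.support * y.coeff.support).image latticePoint)
  rw [Finset.coe_image] at hhull
  rw [← hhull]
  refine convexHull_mono fun c hc => ?_
  obtain ⟨h, hh, rfl⟩ := Finset.mem_image.mp (hsub hc)
  obtain ⟨a, ha, b, hb, rfl⟩ := Finset.mem_mul.mp hh
  refine ⟨a * b, ?_, rfl⟩
  rw [Finset.mem_coe, Finsupp.mem_support_iff]
  refine coeff_mul_of_uniqueMul x y ha hb fun a' b' ha' hb' hab => ?_
  have hin : ∀ u ∈ x.coeff.support, ∀ v ∈ y.coeff.support,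
      latticePoint (u * v) ∈ convexHull ℝ (insert (latticePoint (a * b))
        ((T' : Set (RealSpan H)) \ {latticePoint (a * b)})) := by
    intro u hu v hv
    rw [Set.insert_sdiff_singleton, Set.insert_eq_of_mem (by exact_mod_cast hc), hhull]
    exact subset_convexHull ℝ _ ⟨u * v, by exact_mod_cast Finset.mul_mem_mul hu hv, rfl⟩
  have key := mem_extremePoints_convexHull_of_notMem (hmin _ hc) (hin a' ha' b hb)
    (hin a ha b' hb') (by
      rw [← latticePoint_mul, ← latticePoint_mul]
      congr 1
      calc a' * b * (a * b') = (a' * b') * (a * b) := by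
            simp only [mul_comm, mul_left_comm]
        _ = _ := by rw [hab])
  have h1 := latticePoint_injective key.1
  have h2 := latticePoint_injective key.2
  exact ⟨mul_right_cancel h1, mul_left_cancel h2⟩

theorem newtonPolytope_one [IsMulTorsionFree H] :
    GrothendieckAddGroup.of (newtonPolytope (1 : TwistedGroupRing S) one_ne_zero) = 0 := by
  have h := newtonPolytope_mul (1 : TwistedGroupRing S) 1 one_ne_zero one_ne_zero
    (by rw [mul_one]; exact one_ne_zero)
  have h' := congrArg GrothendieckAddGroup.of h
  rw [map_add] at h'
  simp only [mul_one] at h'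
  simpa using h'

end TwistedGroupRing
end Polytope

section PolytopeHom

open Algebra

/-- `D^×_ab / {±1}`, written multiplicatively. -/
abbrev ReducedAbelianization (D : Type*) [DivisionRing D] : Type _ :=
  Abelianization Dˣ ⧸ Subgroup.zpowers (Abelianization.of (-1 : Dˣ))

namespace TwistedGroupRing

variable {D H : Type*} [DivisionRing D] [CommGroup H] [IsMulTorsionFree H] [UniqueProds H]
  {S : StructureFunctions D H}

open Classical in
/-- The multiplicative map `p ↦ P(p)` on `DH`, with an extra value for `p = 0`. -/
def newtonHom (S : StructureFunctions D H) :
    TwistedGroupRing S →* WithZero (Multiplicative (PolytopeGroup H)) where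
  toFun x := if hx : x = 0 then 0 else
    ((Multiplicative.ofAdd (GrothendieckAddGroup.of (newtonPolytope x hx)) :
      Multiplicative (PolytopeGroup H)) : WithZero (Multiplicative (PolytopeGroup H)))
  map_one' := by
    rw [dif_neg one_ne_zero, newtonPolytope_one]
    rfl
  map_mul' x y := by
    by_cases hx : x = 0
    · simp [hx]
    by_cases hy : y = 0
    · simp [hy]
    have hxy : x * y ≠ 0 := mul_ne_zero hx hy
    rw [dif_neg hx, dif_neg hy, dif_neg hxy, newtonPolytope_mul x y hx hy hxy, map_add, ofAdd_add,
      WithZero.coe_mul]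

theorem newtonHom_of_ne_zero (x : TwistedGroupRing S) (hx : x ≠ 0) :
    newtonHom S x = ((Multiplicative.ofAdd (GrothendieckAddGroup.of (newtonPolytope x hx)) :
      Multiplicative (PolytopeGroup H)) : WithZero (Multiplicative (PolytopeGroup H))) :=
  dif_neg hx

/-- `newtonHom` restricted to the denominators of `Ore(DH)`. -/
def newtonUnitHom (S : StructureFunctions D H) :
    (TwistedGroupRing S)⁰ →* (WithZero (Multiplicative (PolytopeGroup H)))ˣ :=
  Units.liftRight ((newtonHom S).comp (TwistedGroupRing S)⁰.subtype)
    (fun q => Units.mk0 (newtonHom S q) (by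
      rw [newtonHom_of_ne_zero _ (nonZeroDivisors.ne_zero q.2)]
      exact WithZero.coe_ne_zero))
    (fun _ => rfl)

theorem newtonUnitHom_coe (S : StructureFunctions D H) (q : (TwistedGroupRing S)⁰) :
    newtonHom S q = newtonUnitHom S q := rfl

/-- The polytope homomorphism `Ore(DH)^× → 𝒫(H)`, `q⁻¹ p ↦ P(p) - P(q)`;
see `polytopeHom_apply`. -/
def polytopeHom (S : StructureFunctions D H) :
    (OreField S)ˣ →* Multiplicative (PolytopeGroup H) :=
  (WithZero.unitsWithZeroEquiv (α := Multiplicative (PolytopeGroup H))).toMonoidHom.comp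
    (Units.map (OreLocalization.universalMulHom (newtonHom S) (newtonUnitHom S)
      (newtonUnitHom_coe S)))

theorem polytopeHom_apply (x : (OreField S)ˣ) (p : TwistedGroupRing S) (hp : p ≠ 0)
    (q : (TwistedGroupRing S)⁰) (hx : (x : OreField S) = p /ₒ q) :
    polytopeHom S x = Multiplicative.ofAdd (GrothendieckAddGroup.of (newtonPolytope p hp) -
      GrothendieckAddGroup.of (newtonPolytope q.1 (nonZeroDivisors.ne_zero q.2))) := by
  apply WithZero.coe_injective
  have h1 : ((polytopeHom S x : Multiplicative (PolytopeGroup H)) :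
      WithZero (Multiplicative (PolytopeGroup H))) =
      OreLocalization.universalMulHom (newtonHom S) (newtonUnitHom S) (newtonUnitHom_coe S)
        (x : OreField S) := WithZero.coe_unitsWithZeroEquiv_eq_units_val _
  rw [h1, hx, OreLocalization.universalMulHom_apply, newtonHom_of_ne_zero p hp]
  have h2 : ((newtonUnitHom S q : (WithZero (Multiplicative (PolytopeGroup H)))ˣ) :
      WithZero (Multiplicative (PolytopeGroup H))) = _ :=
    newtonHom_of_ne_zero q.1 (nonZeroDivisors.ne_zero q.2)
  rw [Units.val_inv_eq_inv_val, h2, sub_eq_neg_add, ofAdd_add, ofAdd_neg, WithZero.coe_mul,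
    WithZero.coe_inv]

theorem polytopeHom_neg_one : polytopeHom S (-1) = 1 := by
  have hx : ((-1 : (OreField S)ˣ) : OreField S) = (-1 : TwistedGroupRing S) /ₒ 1 := by
    rw [Units.val_neg, Units.val_one, OreLocalization.one_def, OreLocalization.neg_def]
  rw [polytopeHom_apply (S := S) (-1) (-1) (neg_ne_zero.mpr one_ne_zero) 1 hx]
  have : newtonPolytope (-1 : TwistedGroupRing S) (neg_ne_zero.mpr one_ne_zero) =
      newtonPolytope ((1 : (TwistedGroupRing S)⁰) : TwistedGroupRing S)
        (nonZeroDivisors.ne_zero (1 : (TwistedGroupRing S)⁰).2) := by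
    have hs : (-1 : TwistedGroupRing S).coeff.support = (1 : TwistedGroupRing S).coeff.support :=
      Finsupp.support_neg (1 : TwistedGroupRing S).coeff
    ext1
    simp [newtonPolytope, latticePolytope, hs]
  rw [this, sub_self]
  rfl

/-- The polytope homomorphism on `Ore(DH)^×_ab / {±1}`. -/
def reducedPolytopeHom (S : StructureFunctions D H) :
    ReducedAbelianization (OreField S) →* Multiplicative (PolytopeGroup H) :=
  QuotientGroup.lift _ (Abelianization.lift (polytopeHom S)) (by
    change Subgroup.zpowers _ ≤ MonoidHom.ker _
    rw [Subgroup.zpowers_le, MonoidHom.mem_ker, Abelianization.lift_apply_of,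
      polytopeHom_neg_one])

end TwistedGroupRing

end PolytopeHom

section Thickness

open Algebra

/-- The free part of the abelianisation: `G_ab` modulo its torsion subgroup. -/
abbrev FreeAb (G : Type*) [Group G] : Type _ :=
  Abelianization G ⧸ CommGroup.torsion (Abelianization G)

/-- The projection of `G` onto the free part of its abelianisation. -/
def FreeAb.mk (G : Type*) [Group G] : G →* FreeAb G :=
  (QuotientGroup.mk' _).comp Abelianization.of

instance FreeAb.fg (G : Type*) [Group G] [Group.FG G] : Monoid.FG (FreeAb G) :=
  Group.fg_iff_monoid_fg.mp
    (Group.fg_of_surjective (f := FreeAb.mk G)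
      ((QuotientGroup.mk'_surjective _).comp (QuotientGroup.mk'_surjective _)))

/-- The homomorphism induced by `φ : G → ℤ` on the free part of the abelianisation. -/
def FreeAb.lift {G : Type*} [Group G] (φ : G →* Multiplicative ℤ) :
    FreeAb G →* Multiplicative ℤ :=
  QuotientGroup.lift _ (Abelianization.lift φ) fun _ hx =>
    (isOfFinOrder_iff_eq_one _).mp (MonoidHom.isOfFinOrder _ hx)

/-- The `ℝ`-linear extension `ℝ ⊗ H → ℝ` of a homomorphism `H → ℤ`. -/
def realExtension {H : Type*} [CommGroup H] (ψ : H →* Multiplicative ℤ) : RealSpan H →ₗ[ℝ] ℝ :=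
  LinearMap.liftBaseChange ℝ
    ((Int.castAddHom ℝ).comp (MonoidHom.toAdditiveLeft ψ)).toIntLinearMap

theorem realExtension_latticePoint {H : Type*} [CommGroup H] (ψ : H →* Multiplicative ℤ) (h : H) :
    realExtension ψ (latticePoint h) = ((ψ h).toAdd : ℝ) := by
  simp [realExtension, latticePoint]

/-- `max {f x - f y | x, y ∈ P}` (the supremum is attained when `P` is a polytope). -/
def width {E : Type*} [AddCommGroup E] [Module ℝ E] (f : E →ₗ[ℝ] ℝ) (P : Set E) : ℝ :=
  sSup (Set.image2 (fun x y => f x - f y) P P)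

theorem width_bddAbove {H : Type*} [CommGroup H] (f : RealSpan H →ₗ[ℝ] ℝ)
    (P : integralPolytopes H) :
    BddAbove (Set.image2 (fun x y => f x - f y) (P : Set (RealSpan H)) P) := by
  obtain ⟨_, A, hA, rfl⟩ := P
  have key : ∀ g : RealSpan H →ₗ[ℝ] ℝ, ∃ M, ∀ x ∈ convexHull ℝ (latticePoint '' (A : Set H)),
      g x ≤ M := by
    intro g
    obtain ⟨M, hM⟩ := ((A.finite_toSet.image latticePoint).image g).bddAbove
    refine ⟨M, fun x hx => ?_⟩
    have : convexHull ℝ (latticePoint '' (A : Set H)) ⊆ {x | g x ≤ M} :=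
      convexHull_min (fun y hy => hM ⟨y, hy, rfl⟩) (convex_halfSpace_le g.isLinear M)
    exact this hx
  obtain ⟨M, hM⟩ := key f
  obtain ⟨N, hN⟩ := key (-f)
  refine ⟨M + N, ?_⟩
  rintro _ ⟨x, hx, y, hy, rfl⟩
  have h1 := hM x hx
  have h2 := hN y hy
  simp only [LinearMap.neg_apply] at h2
  change f x - f y ≤ _
  linarith

theorem integralPolytope_nonempty {H : Type*} [CommGroup H] (P : integralPolytopes H) :
    (P : Set (RealSpan H)).Nonempty := by
  obtain ⟨_, A, hA, rfl⟩ := P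
  obtain ⟨a, ha⟩ := hA
  exact ⟨latticePoint a, subset_convexHull ℝ _ ⟨a, ha, rfl⟩⟩

/-- `width` is additive under Minkowski sum. -/
def widthHom {H : Type*} [CommGroup H] (f : RealSpan H →ₗ[ℝ] ℝ) : integralPolytopes H →+ ℝ where
  toFun P := width f P
  map_zero' := by simp [width, ← Set.singleton_zero]
  map_add' P Q := by
    have hne := fun P : integralPolytopes H =>
      (integralPolytope_nonempty P).image2 (f := fun x y => f x - f y) (integralPolytope_nonempty P)
    rw [width, width, width, ← csSup_add (hne P) (width_bddAbove f P) (hne Q) (width_bddAbove f Q)]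
    congr 1
    ext r
    simp only [AddSubmonoid.coe_add, Set.mem_image2, Set.mem_add]
    constructor
    · rintro ⟨_, ⟨x, hx, y, hy, rfl⟩, _, ⟨x', hx', y', hy', rfl⟩, rfl⟩
      exact ⟨_, ⟨x, hx, x', hx', rfl⟩, _, ⟨y, hy, y', hy', rfl⟩, by simp only [map_add]; ring⟩
    · rintro ⟨_, ⟨x, hx, x', hx', rfl⟩, _, ⟨y, hy, y', hy', rfl⟩, rfl⟩
      exact ⟨_, ⟨x, hx, y, hy, rfl⟩, _, ⟨x', hx', y', hy', rfl⟩, by simp only [map_add]; ring⟩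

/-- The thickness along `φ`, extended from single polytopes to a homomorphism on `𝒫_T(H)`. -/
def thickness {G : Type*} [Group G] (φ : G →* Multiplicative ℤ) :
    TranslationPolytopeGroup (FreeAb G) →+ ℝ :=
  QuotientAddGroup.lift _
    (GrothendieckAddGroup.lift (widthHom (realExtension (FreeAb.lift φ)))) (by
      rintro _ ⟨h, rfl⟩
      rw [AddMonoidHom.mem_ker]
      have : (GrothendieckAddGroup.lift (widthHom (realExtension (FreeAb.lift φ))))
          (GrothendieckAddGroup.of (latticePolytope {h.toMul} (Finset.singleton_nonempty _))) =
          widthHom (realExtension (FreeAb.lift φ)) _ :=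
        DFunLike.congr_fun (GrothendieckAddGroup.lift.symm_apply_apply _) _
      refine this.trans ?_
      simp [widthHom, width, latticePolytope])

end Thickness

section Rationalisation

variable {G D H : Type*} [Group G] [DivisionRing D] [CommGroup H]

/-- The homomorphism `G → Dˣ` given by a ring homomorphism `ℤG → D`. -/
def groupUnit (α : MonoidAlgebra ℤ G →+* D) : G →* Dˣ :=
  (Units.map ((α : MonoidAlgebra ℤ G →* D).comp (MonoidAlgebra.of ℤ G))).comp
    toUnits.toMonoidHom

theorem groupUnit_coe (α : MonoidAlgebra ℤ G →+* D) (g : G) :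
    (groupUnit α g : D) = α (MonoidAlgebra.single g 1) := rfl

/-- Conjugation by a unit. -/
def conjEquiv (u : Dˣ) : D ≃+* D where
  toFun x := u * x * (u⁻¹ : Dˣ)
  invFun x := (u⁻¹ : Dˣ) * x * u
  left_inv x := by simp [mul_assoc]
  right_inv x := by simp [mul_assoc]
  map_mul' x y := by simp [mul_assoc]
  map_add' x y := by simp [mul_add, add_mul]

/-- The structure functions given by a section `s`: `c(h)` is conjugation by `s(h)` and
`τ(h,h') = s(h) s(h') s(hh')⁻¹`, both transported to `D` by `α`. -/
def sectionStructure (α : MonoidAlgebra ℤ G →+* D) (s : H → G) : StructureFunctions D H where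
  c h := conjEquiv (groupUnit α (s h))
  τ h h' := groupUnit α (s h * s h' * (s (h * h'))⁻¹)
  c_comp g g' r := by
    have : ∀ u : Dˣ, ∀ x : D, conjEquiv u x = u * x * (u⁻¹ : Dˣ) := fun _ _ => rfl
    simp only [this]
    simp [mul_assoc]
  cocycle g g' g'' := by
    have : ∀ u : Dˣ, ∀ x : D, conjEquiv u x = u * x * (u⁻¹ : Dˣ) := fun _ _ => rfl
    simp only [this, ← Units.val_mul, ← map_mul, ← map_inv]
    congr 2
    simp only [mul_assoc, inv_mul_cancel_left]

/-- The ring homomorphism `ℤG ≅ (ℤK)H → DH`, `g ↦ g s(pr g)⁻¹ ∗ pr g`. -/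
def toTwistedGroupRing (α : MonoidAlgebra ℤ G →+* D) (pr : G →* H) (s : H → G) :
    MonoidAlgebra ℤ G →+* TwistedGroupRing (sectionStructure α s) :=
  (MonoidAlgebra.lift ℤ (TwistedGroupRing (sectionStructure α s)) G
    { toFun := fun g => TwistedGroupRing.single _ (pr g) (groupUnit α (g * (s (pr g))⁻¹) : D)
      map_one' := by
        rw [TwistedGroupRing.one_def]
        simp [sectionStructure]
      map_mul' := fun g g' => by
        have : ∀ u : Dˣ, ∀ x : D, conjEquiv u x = u * x * (u⁻¹ : Dˣ) := fun _ _ => rfl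
        rw [TwistedGroupRing.single_mul_single, map_mul]
        congr 1
        simp only [sectionStructure, this, ← Units.val_mul, ← map_mul, ← map_inv]
        congr 2
        simp [mul_assoc] } : _ →ₐ[ℤ] _).toRingHom

/-- The skew field `D_r = Ore(DH)`, with `H` the free part of the abelianisation of `G`. -/
abbrev RationalField [Group.FG G] (α : MonoidAlgebra ℤ G →+* D) (s : FreeAb G → G) : Type _ :=
  TwistedGroupRing.OreField (sectionStructure α s)

/-- The rationalisation `α_r : ℤG → D_r` of `α` (for the section `s` of the projection `G → H`). -/
def rationalisation [Group.FG G] (α : MonoidAlgebra ℤ G →+* D) (s : FreeAb G → G) :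
    MonoidAlgebra ℤ G →+* RationalField α s :=
  OreLocalization.numeratorRingHom.comp (toTwistedGroupRing α (FreeAb.mk G) s)

end Rationalisation

section Torsion

/-- Products of elementary matrices. -/
def elementaryMatrices (D : Type*) [Ring D] (n : ℕ) : Submonoid (Matrix (Fin n) (Fin n) D) :=
  Submonoid.closure {E | ∃ (i j : Fin n) (a : D), i ≠ j ∧ E = 1 + Matrix.single i j a}

/-- `x` is the Dieudonné determinant of `A`: `A` arises from a diagonal matrix `diag(d₁, …, dₙ)` by
elementary row operations, and `x` is the class of `d₁ ⋯ dₙ`. For invertible `A` there is exactly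
one such `x`. -/
def IsDieudonneDet {D : Type*} [DivisionRing D] {n : ℕ} (A : Matrix (Fin n) (Fin n) D)
    (x : Abelianization Dˣ) : Prop :=
  ∃ E ∈ elementaryMatrices D n, ∃ d : Fin n → Dˣ,
    A = E * Matrix.diagonal (fun i => (d i : D)) ∧ x = ∏ i, Abelianization.of (d i)

open Classical in
/-- The Dieudonné determinant of an invertible matrix over a skew field (`1` if there is none). -/
def dieudonneDet {D : Type*} [DivisionRing D] {n : ℕ} (A : Matrix (Fin n) (Fin n) D) :
    Abelianization Dˣ :=
  if h : ∃ x, IsDieudonneDet A x then h.choose else 1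

variable {R : Type*} [Ring R]

/-- The structure of a finite based free chain complex on `C`: a degree bound `dim` and finite ordered
`R`-bases of all chain modules, which are empty above degree `dim`. -/
structure FiniteBasing (C : ChainComplex (ModuleCat R) ℕ) where
  dim : ℕ
  rank : ℕ → ℕ
  rank_eq_zero : ∀ n, dim < n → rank n = 0
  basis : ∀ n, Module.Basis (Fin (rank n)) R (C.X n)

namespace FiniteBasing

variable {C : ChainComplex (ModuleCat R) ℕ} (b : FiniteBasing C)

/-- The matrix `A_p` of the differential `C_{p+1} → C_p`, whose `j`-th row consists of the coordinates
of the image of the `j`-th basis element. -/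
def matrix (p : ℕ) : Matrix (Fin (b.rank (p + 1))) (Fin (b.rank p)) R :=
  Matrix.of fun j k => (b.basis p).repr (C.d (p + 1) p (b.basis (p + 1) j)) k

/-- A `τ`-chain: subsets `γ_p` of the preferred bases with `γ_0 = ∅` for which the submatrices `S_p` of
`A_p` are square. -/
structure TauChain where
  γ : ∀ p, Finset (Fin (b.rank p))
  γ_zero : γ 0 = ∅
  card_eq : ∀ p, p < b.dim → (γ p)ᶜ.card = (γ (p + 1)).card

/-- The square submatrix `S_p` of `A_p` with rows in `γ_{p+1}` and columns outside `γ_p`. -/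
def TauChain.S {b : FiniteBasing C} (t : b.TauChain) (p : Fin b.dim) :
    Matrix (Fin (t.γ (p + 1)).card) (Fin (t.γ (p + 1)).card) R :=
  (b.matrix p).submatrix ((t.γ (p + 1)).orderEmbOfFin rfl)
    ((t.γ p)ᶜ.orderEmbOfFin (t.card_eq p p.2))

variable {D : Type*} [DivisionRing D] (α : R →+* D)

/-- All the matrices `S_p` become invertible over `D`. -/
def TauChain.IsNondegenerate {b : FiniteBasing C} (t : b.TauChain) : Prop :=
  ∀ p, IsUnit ((t.S p).map α)

/-- `∑ (-1)^p det_D(S_p)`, written multiplicatively. -/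
def TauChain.torsion {b : FiniteBasing C} (t : b.TauChain) : ReducedAbelianization D :=
  ∏ p : Fin b.dim, (dieudonneDet ((t.S p).map α) : ReducedAbelianization D) ^ ((-1 : ℤ) ^ (p : ℕ))

open Classical in
/-- The agrarian torsion, computed from any non-degenerate `τ`-chain (written multiplicatively). -/
def torsion : ReducedAbelianization D :=
  if h : ∃ t : b.TauChain, t.IsNondegenerate α then h.choose.torsion α else 1

end FiniteBasing
end Torsion

section Betti

open CategoryTheory

universe u v w

variable {R : Type u} [Ring R] {D : Type v} [DivisionRing D] (α : R →+* D)

/-- The relations `d α(r) ⊗ m = d ⊗ r m` defining `D ⊗_R M` as a quotient of `D ⊗_ℤ M`. -/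
def balancedRelations (M : Type w) [AddCommGroup M] [Module R M] : Submodule D (D ⊗[ℤ] M) :=
  Submodule.span D {x | ∃ (d : D) (r : R) (m : M), x = (d * α r) ⊗ₜ[ℤ] m - d ⊗ₜ[ℤ] (r • m)}

/-- The left `D`-module `D ⊗_R M`, where `D` is a right `R`-module via `α`
(Mathlib's tensor product needs a commutative base ring). -/
abbrev BaseChange (M : Type w) [AddCommGroup M] [Module R M] : Type (max v w) :=
  (D ⊗[ℤ] M) ⧸ balancedRelations α M

/-- Functoriality of `D ⊗_R M`. -/
def BaseChange.map {M N : Type w} [AddCommGroup M] [Module R M] [AddCommGroup N] [Module R N]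
    (f : M →ₗ[R] N) : BaseChange α M →ₗ[D] BaseChange α N :=
  Submodule.mapQ _ _ (LinearMap.baseChange D (f.restrictScalars ℤ)) (by
    rw [balancedRelations, Submodule.span_le]
    rintro _ ⟨d, r, m, rfl⟩
    refine Submodule.subset_span ⟨d, r, f m, ?_⟩
    simp)

theorem BaseChange.map_mk {M N : Type w} [AddCommGroup M] [Module R M] [AddCommGroup N]
    [Module R N] (f : M →ₗ[R] N) (x : D ⊗[ℤ] M) :
    BaseChange.map α f (Submodule.Quotient.mk x) =
      Submodule.Quotient.mk (LinearMap.baseChange D (f.restrictScalars ℤ) x) := rfl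

theorem BaseChange.map_id (M : Type w) [AddCommGroup M] [Module R M] :
    BaseChange.map α (LinearMap.id : M →ₗ[R] M) = LinearMap.id := by
  refine LinearMap.ext fun x => ?_
  obtain ⟨x, rfl⟩ := Submodule.Quotient.mk_surjective _ x
  rw [BaseChange.map_mk]
  exact congrArg _ (LinearMap.congr_fun (LinearMap.baseChange_id (R := ℤ) (A := D) (M := M)) x)

theorem BaseChange.map_comp {M N P : Type w} [AddCommGroup M] [Module R M] [AddCommGroup N]
    [Module R N] [AddCommGroup P] [Module R P] (f : M →ₗ[R] N) (g : N →ₗ[R] P) :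
    BaseChange.map α (g ∘ₗ f) = BaseChange.map α g ∘ₗ BaseChange.map α f := by
  refine LinearMap.ext fun x => ?_
  obtain ⟨x, rfl⟩ := Submodule.Quotient.mk_surjective _ x
  rw [LinearMap.comp_apply, BaseChange.map_mk, BaseChange.map_mk, BaseChange.map_mk]
  exact congrArg _ (LinearMap.congr_fun (LinearMap.baseChange_comp (A := D)
    (f.restrictScalars ℤ) (g.restrictScalars ℤ)) x)

theorem BaseChange.map_add {M N : Type w} [AddCommGroup M] [Module R M] [AddCommGroup N]
    [Module R N] (f g : M →ₗ[R] N) :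
    BaseChange.map α (f + g) = BaseChange.map α f + BaseChange.map α g := by
  refine LinearMap.ext fun x => ?_
  obtain ⟨x, rfl⟩ := Submodule.Quotient.mk_surjective _ x
  rw [LinearMap.add_apply, BaseChange.map_mk, BaseChange.map_mk, BaseChange.map_mk]
  exact congrArg _ (LinearMap.congr_fun (LinearMap.baseChange_add (A := D)
    (f.restrictScalars ℤ) (g.restrictScalars ℤ)) x)

/-- The functor `D ⊗_R -`. -/
def baseChangeFunctor : ModuleCat.{w} R ⥤ ModuleCat.{max v w} D where
  obj M := ModuleCat.of D (BaseChange α M)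
  map f := ModuleCat.ofHom (BaseChange.map α f.hom)
  map_id M := ModuleCat.hom_ext (BaseChange.map_id α M)
  map_comp f g := ModuleCat.hom_ext (BaseChange.map_comp α f.hom g.hom)

instance : (baseChangeFunctor.{u, v, w} α).Additive where
  map_add {_ _ f g} := ModuleCat.hom_ext (BaseChange.map_add α f.hom g.hom)

/-- The `D`-Betti numbers `dim_D H_n(D ⊗_R C)`. -/
def agrarianBetti (C : ChainComplex (ModuleCat.{w} R) ℕ) (n : ℕ) : ℕ∞ :=
  Cardinal.toENat (Module.rank D
    ((((baseChangeFunctor α).mapHomologicalComplex _).obj C).homology n))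

/-- `C` is `D`-acyclic. -/
def IsAcyclicOver (C : ChainComplex (ModuleCat.{w} R) ℕ) : Prop :=
  ∀ n, agrarianBetti α C n = 0

end Betti

section Twist

open CategoryTheory LaurentPolynomial

universe u v w

variable {G : Type u} [Group G]

/-- The representation of `G` underlying a `ℤG`-module. -/
def moduleRep (M : Type w) [AddCommGroup M] [Module (MonoidAlgebra ℤ G) M] :
    Representation ℤ G M where
  toFun g := (Module.toAddMonoidEnd (MonoidAlgebra ℤ G) M (MonoidAlgebra.of ℤ G g)).toIntLinearMap
  map_one' := by
    rw [map_one, map_one]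
    rfl
  map_mul' g h := by
    rw [map_mul, map_mul]
    rfl

theorem moduleRep_apply (M : Type w) [AddCommGroup M] [Module (MonoidAlgebra ℤ G) M] (g : G)
    (m : M) : moduleRep M g m = MonoidAlgebra.of ℤ G g • m := rfl

/-- The `ℤG`-module `φ^* ℤ[t,t⁻¹]`: `g` acts by multiplication with `t^{φ(g)}`. -/
def laurentRep (φ : G →* Multiplicative ℤ) : Representation ℤ G ℤ[T;T⁻¹] where
  toFun g := LinearMap.mulLeft ℤ (T (φ g).toAdd)
  map_one' := by ext; simp
  map_mul' g h := by
    refine LinearMap.ext fun x => ?_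
    rw [map_mul, toAdd_mul, T_add]
    exact mul_assoc _ _ _

/-- `M ⊗_ℤ φ^* ℤ[t,t⁻¹]` with the diagonal `G`-action, as a `ℤG`-module. -/
abbrev TwistedModule (φ : G →* Multiplicative ℤ) (M : Type w) [AddCommGroup M]
    [Module (MonoidAlgebra ℤ G) M] : Type w :=
  ((moduleRep M).tprod (laurentRep φ)).asModule

/-- An equivariant additive map as a `ℤG`-linear map. -/
def linearMapOfEquivariant {V W : Type*} [AddCommGroup V] [AddCommGroup W]
    (ρ : Representation ℤ G V) (σ : Representation ℤ G W) (f : V →ₗ[ℤ] W)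
    (hf : ∀ g v, f (ρ g v) = σ g (f v)) : ρ.asModule →ₗ[MonoidAlgebra ℤ G] σ.asModule where
  toFun v := σ.asModuleEquiv.symm (f (ρ.asModuleEquiv v))
  map_add' := by simp
  map_smul' r v := by
    induction r using MonoidAlgebra.induction_linear with
    | zero => simp
    | add r s hr hs => simp only [add_smul, map_add, hr, hs, RingHom.id_apply]
    | single g n =>
      have h1 : ρ.asModuleEquiv (MonoidAlgebra.single g n • v) = n • ρ g (ρ.asModuleEquiv v) :=
        Representation.single_smul ρ n g v
      rw [h1, map_zsmul, hf]
      exact (Representation.single_smul σ n g (σ.asModuleEquiv.symm (f (ρ.asModuleEquiv v)))).symm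

theorem twist_equivariant (φ : G →* Multiplicative ℤ) {M N : Type w} [AddCommGroup M]
    [Module (MonoidAlgebra ℤ G) M] [AddCommGroup N] [Module (MonoidAlgebra ℤ G) N]
    (f : M →ₗ[MonoidAlgebra ℤ G] N) (g : G) (v : M ⊗[ℤ] ℤ[T;T⁻¹]) :
    (f.restrictScalars ℤ).rTensor ℤ[T;T⁻¹] (((moduleRep M).tprod (laurentRep φ)) g v) =
      ((moduleRep N).tprod (laurentRep φ)) g ((f.restrictScalars ℤ).rTensor ℤ[T;T⁻¹] v) := by
  induction v using TensorProduct.induction_on with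
  | zero => rw [map_zero, map_zero, map_zero]
  | tmul m x =>
    rw [Representation.tprod_apply, Representation.tprod_apply, TensorProduct.map_tmul,
      LinearMap.rTensor_tmul, LinearMap.rTensor_tmul, TensorProduct.map_tmul]
    congr 1
    exact f.map_smul _ _
  | add x y hx hy => rw [map_add, map_add, map_add, map_add, hx, hy]

/-- Functoriality of `M ⊗_ℤ φ^* ℤ[t,t⁻¹]`. -/
def TwistedModule.map (φ : G →* Multiplicative ℤ) {M N : Type w} [AddCommGroup M]
    [Module (MonoidAlgebra ℤ G) M] [AddCommGroup N] [Module (MonoidAlgebra ℤ G) N]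
    (f : M →ₗ[MonoidAlgebra ℤ G] N) :
    TwistedModule φ M →ₗ[MonoidAlgebra ℤ G] TwistedModule φ N :=
  linearMapOfEquivariant _ _ ((f.restrictScalars ℤ).rTensor ℤ[T;T⁻¹]) (twist_equivariant φ f)

/-- The functor `M ↦ M ⊗_ℤ φ^* ℤ[t,t⁻¹]`. -/
def twistFunctor (φ : G →* Multiplicative ℤ) :
    ModuleCat.{w} (MonoidAlgebra ℤ G) ⥤ ModuleCat.{w} (MonoidAlgebra ℤ G) where
  obj M := ModuleCat.of _ (TwistedModule φ M)
  map f := ModuleCat.ofHom (TwistedModule.map φ f.hom)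
  map_id M := ModuleCat.hom_ext <| LinearMap.ext fun x =>
    LinearMap.congr_fun (LinearMap.rTensor_id (R := ℤ) ℤ[T;T⁻¹] M) x
  map_comp f g := ModuleCat.hom_ext <| LinearMap.ext fun x =>
    LinearMap.congr_fun (LinearMap.rTensor_comp ℤ[T;T⁻¹]
      (g.hom.restrictScalars ℤ) (f.hom.restrictScalars ℤ)) x

instance (φ : G →* Multiplicative ℤ) : (twistFunctor.{u, w} φ).Additive where
  map_add {_ _ f g} := ModuleCat.hom_ext <| LinearMap.ext fun x =>
    LinearMap.congr_fun (LinearMap.rTensor_add ℤ[T;T⁻¹]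
      (f.hom.restrictScalars ℤ) (g.hom.restrictScalars ℤ)) x

variable {D : Type v} [DivisionRing D] (α : MonoidAlgebra ℤ G →+* D)

/-- The `φ`-twisted Betti numbers: the `D`-Betti numbers of `C ⊗_ℤ φ^* ℤ[t,t⁻¹]`. -/
def twistedBetti (φ : G →* Multiplicative ℤ) (C : ChainComplex (ModuleCat.{w} (MonoidAlgebra ℤ G)) ℕ)
    (n : ℕ) : ℕ∞ :=
  agrarianBetti α (((twistFunctor φ).mapHomologicalComplex _).obj C) n

/-- The sum of all `φ`-twisted Betti numbers, in `ℕ ∪ {∞}`. -/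
def totalTwistedBetti (φ : G →* Multiplicative ℤ)
    (C : ChainComplex (ModuleCat.{w} (MonoidAlgebra ℤ G)) ℕ) : ℕ∞ :=
  ⨆ N : ℕ, ∑ p ∈ Finset.range N, twistedBetti α φ C p

/-- The `φ`-twisted Euler characteristic (meaningful if the sum of the twisted Betti numbers is
finite). -/
def twistedEulerChar (φ : G →* Multiplicative ℤ)
    (C : ChainComplex (ModuleCat.{w} (MonoidAlgebra ℤ G)) ℕ) : ℤ :=
  ∑ᶠ p : ℕ, (-1) ^ p * ((twistedBetti α φ C p).toNat : ℤ)

end Twist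

section Cellular

open CategoryTheory Topology

universe u w

/-- Singular `n`-simplices of `X`. -/
abbrev SingularSimplex (X : Type w) [TopologicalSpace X] (n : ℕ) : Type w :=
  C(stdSimplex ℝ (Fin (n + 1)), X)

/-- The `i`-th face of a singular simplex. -/
def SingularSimplex.face {X : Type w} [TopologicalSpace X] {n : ℕ} (i : Fin (n + 2))
    (σ : SingularSimplex X (n + 1)) : SingularSimplex X n :=
  σ.comp ⟨stdSimplex.map i.succAbove, stdSimplex.continuous_map _⟩

theorem SingularSimplex.face_face {X : Type w} [TopologicalSpace X] {n : ℕ} (i : Fin (n + 3))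
    (j : Fin (n + 2)) (σ : SingularSimplex X (n + 2)) :
    (σ.face (i.succAbove j)).face (j.predAbove i) = (σ.face i).face j := by
  ext t
  change σ (stdSimplex.map _ (stdSimplex.map _ t)) = σ (stdSimplex.map _ (stdSimplex.map _ t))
  rw [stdSimplex.map_comp_apply, stdSimplex.map_comp_apply]
  congr 2
  funext k
  exact Fin.succAbove_succAbove_succAbove_predAbove i j k

variable (G : Type u) [Group G] (X : Type w) [TopologicalSpace X] [MulAction G X]
  [ContinuousConstSMul G X]

/-- The action of `G` on singular chains. -/
def singularRep (n : ℕ) : Representation ℤ G (SingularSimplex X n →₀ ℤ) where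
  toFun g := Finsupp.lmapDomain ℤ ℤ (g • ·)
  map_one' := by
    simp only [one_smul]
    exact Finsupp.lmapDomain_id ℤ ℤ
  map_mul' g h := by
    simp only [mul_smul]
    exact Finsupp.lmapDomain_comp ℤ ℤ (fun σ : SingularSimplex X n => h • σ) (g • ·)

/-- The `ℤG`-module of singular `n`-chains of the `G`-space `X`. -/
abbrev SingularChain (n : ℕ) : Type w := (singularRep G X n).asModule

/-- The chain `k · σ`. -/
def SingularChain.single {n : ℕ} (σ : SingularSimplex X n) (k : ℤ) : SingularChain G X n :=
  (singularRep G X n).asModuleEquiv.symm (Finsupp.single σ k)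

/-- The singular boundary `∑ (-1)^i d_i`, as an additive map. -/
def singularBoundaryInt (n : ℕ) : (SingularSimplex X (n + 1) →₀ ℤ) →ₗ[ℤ] (SingularSimplex X n →₀ ℤ) :=
  ∑ i : Fin (n + 2), (-1 : ℤ) ^ (i : ℕ) • Finsupp.lmapDomain ℤ ℤ (SingularSimplex.face i)

variable {X} in
theorem singularBoundaryInt_single {n : ℕ} (σ : SingularSimplex X (n + 1)) (k : ℤ) :
    singularBoundaryInt X n (Finsupp.single σ k) =
      ∑ i : Fin (n + 2), (-1 : ℤ) ^ (i : ℕ) • Finsupp.single (σ.face i) k := by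
  simp [singularBoundaryInt]

theorem singularBoundaryInt_comp (n : ℕ) (x : SingularSimplex X (n + 2) →₀ ℤ) :
    singularBoundaryInt X n (singularBoundaryInt X (n + 1) x) = 0 := by
  induction x using Finsupp.induction_linear with
  | zero => rw [map_zero, map_zero]
  | add x y hx hy => rw [map_add, map_add, hx, hy, add_zero]
  | single σ k =>
    rw [singularBoundaryInt_single, map_sum]
    simp only [map_zsmul, singularBoundaryInt_single, Finset.smul_sum, smul_smul]
    rw [← Fintype.sum_prod_type' (f := fun (i : Fin (n + 3)) (j : Fin (n + 2)) =>
      ((-1 : ℤ) ^ (i : ℕ) * (-1) ^ (j : ℕ)) • Finsupp.single ((σ.face i).face j) k)]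
    refine Finset.sum_involution (fun p _ => (p.1.succAbove p.2, p.2.predAbove p.1)) ?_ ?_ ?_ ?_
    · rintro ⟨i, j⟩ _
      simp only [SingularSimplex.face_face, ← pow_add, Fin.neg_one_pow_succAbove_add_predAbove,
        neg_smul, add_neg_cancel]
    · rintro ⟨i, j⟩ _ _ h
      exact Fin.succAbove_ne i j (congrArg Prod.fst h)
    · simp
    · rintro ⟨i, j⟩ _
      simp [Fin.succAbove_succAbove_predAbove, Fin.predAbove_predAbove_succAbove]

theorem singularBoundaryInt_smul (n : ℕ) (g : G) (x : SingularSimplex X (n + 1) →₀ ℤ) :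
    singularBoundaryInt X n (singularRep G X (n + 1) g x) =
      singularRep G X n g (singularBoundaryInt X n x) := by
  induction x using Finsupp.induction_linear with
  | zero => simp only [map_zero]
  | add x y hx hy => simp only [map_add, hx, hy]
  | single σ k =>
    have h : ∀ (m : ℕ) (τ : SingularSimplex X m),
        singularRep G X m g (Finsupp.single τ k) = Finsupp.single (g • τ) k :=
      fun m τ => Finsupp.mapDomain_single
    rw [h, singularBoundaryInt_single, singularBoundaryInt_single, map_sum]
    refine Finset.sum_congr rfl fun i _ => ?_
    rw [map_zsmul, h]
    rfl

/-- The singular boundary, as a `ℤG`-linear map. -/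
def singularBoundary (n : ℕ) : SingularChain G X (n + 1) →ₗ[MonoidAlgebra ℤ G] SingularChain G X n :=
  linearMapOfEquivariant _ _ (singularBoundaryInt X n) (singularBoundaryInt_smul G X n)

theorem singularBoundary_comp (n : ℕ) (x : SingularChain G X (n + 2)) :
    singularBoundary G X n (singularBoundary G X (n + 1) x) = 0 :=
  singularBoundaryInt_comp X n x

variable {X} in
/-- The chains in a `G`-invariant subset `A` of `X`. -/
def chainsIn (A : Set X) (n : ℕ) : Submodule (MonoidAlgebra ℤ G) (SingularChain G X n) :=
  Submodule.span _ {x | ∃ σ : SingularSimplex X n, Set.range σ ⊆ A ∧ x = SingularChain.single G X σ 1}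

variable {X} in
/-- For a filtration `F 0 ⊆ F 1 ⊆ …`, the relative cycles of degree `n` of the pair
`(F (n + 1), F n)`; here `F 0` is to be empty. -/
def relCycles (F : ℕ → Set X) : (n : ℕ) → Submodule (MonoidAlgebra ℤ G) (SingularChain G X n)
  | 0 => chainsIn G (F 1) 0
  | n + 1 => chainsIn G (F (n + 2)) (n + 1) ⊓
      (chainsIn G (F (n + 1)) n).comap (singularBoundary G X n)

variable {X} in
/-- The relative boundaries of degree `n` of the pair `(F (n + 1), F n)`. -/
def relBoundaries (F : ℕ → Set X) (n : ℕ) : Submodule (MonoidAlgebra ℤ G) (SingularChain G X n) :=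
  chainsIn G (F n) n ⊔ (chainsIn G (F (n + 1)) (n + 1)).map (singularBoundary G X n)

variable {X} in
/-- The relative singular homology `H_n(F (n + 1), F n)`. -/
abbrev RelHomology (F : ℕ → Set X) (n : ℕ) : Type w :=
  relCycles G F n ⧸ (relBoundaries G F n).submoduleOf (relCycles G F n)

variable {X} in
theorem singularBoundary_mem_relCycles (F : ℕ → Set X) (n : ℕ) (x : SingularChain G X (n + 1))
    (hx : x ∈ relCycles G F (n + 1)) : singularBoundary G X n x ∈ relCycles G F n := by
  cases n with
  | zero => exact hx.2
  | succ n =>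
    refine ⟨hx.2, ?_⟩
    refine Submodule.mem_comap.mpr ?_
    rw [singularBoundary_comp]
    exact Submodule.zero_mem _

variable {X} in
/-- The connecting homomorphism `H_{n+1}(F (n + 2), F (n + 1)) → H_n(F (n + 1), F n)` of the triple,
induced by the singular boundary. -/
def connecting (F : ℕ → Set X) (n : ℕ) :
    RelHomology G F (n + 1) →ₗ[MonoidAlgebra ℤ G] RelHomology G F n :=
  Submodule.mapQ _ _ ((singularBoundary G X n).restrict (singularBoundary_mem_relCycles G F n)) (by
    rintro ⟨x, hx⟩ hxB
    obtain ⟨y, hy, _, ⟨z, hz, rfl⟩, hyz⟩ := Submodule.mem_sup.mp hxB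
    change singularBoundary G X n x ∈ relBoundaries G F n
    have hxe : x = y + singularBoundary G X (n + 1) z := hyz.symm
    rw [hxe, map_add, singularBoundary_comp, add_zero]
    exact Submodule.mem_sup_right ⟨y, hy, rfl⟩)

variable {X} in
theorem connecting_comp (F : ℕ → Set X) (n : ℕ) :
    connecting G F n ∘ₗ connecting G F (n + 1) = 0 := by
  refine LinearMap.ext fun x => ?_
  obtain ⟨⟨x, hx⟩, rfl⟩ := Submodule.Quotient.mk_surjective _ x
  refine (Submodule.Quotient.mk_eq_zero _).mpr ?_
  change singularBoundary G X n (singularBoundary G X (n + 1) x) ∈ relBoundaries G F n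
  rw [singularBoundary_comp]
  exact Submodule.zero_mem _

/-- The cellular `ℤG`-chain complex of `X`: `C_n(X) = H_n(X_n, X_{n-1})`. Here
`skeletonLT univ k` is the `(k - 1)`-skeleton. -/
def cellularComplex [T2Space X] [CWComplex (Set.univ : Set X)] :
    ChainComplex (ModuleCat.{w} (MonoidAlgebra ℤ G)) ℕ :=
  ChainComplex.of
    (fun n => ModuleCat.of (MonoidAlgebra ℤ G)
      (RelHomology G (fun k => (RelCWComplex.skeletonLT (Set.univ : Set X) k : Set X)) n))
    (fun n => ModuleCat.ofHom (connecting G _ n))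
    (fun n => ModuleCat.hom_ext (connecting_comp G _ n))

/-- The action of `G` makes the CW-complex `X` a finite free `G`-CW-complex: group elements map
`n`-cells to `n`-cells, a cell mapped into itself is fixed pointwise, the action is free, and there
are only finitely many `G`-orbits of cells. -/
structure IsFiniteFreeGCW [T2Space X] [CWComplex (Set.univ : Set X)] : Prop where
  maps_cells : ∀ (g : G) (n : ℕ) (e : RelCWComplex.cell (Set.univ : Set X) n),
    ∃ e' : RelCWComplex.cell (Set.univ : Set X) n,
      g • RelCWComplex.openCell n e = RelCWComplex.openCell n e'
  fixes_cells : ∀ (g : G) (n : ℕ) (e : RelCWComplex.cell (Set.univ : Set X) n),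
    g • RelCWComplex.openCell n e ⊆ RelCWComplex.openCell n e →
      ∀ x ∈ RelCWComplex.openCell n e, g • x = x
  free : ∀ (g : G) (x : X), g • x = x → g = 1
  finite : ∃ I : Finset (Σ n, RelCWComplex.cell (Set.univ : Set X) n),
    ∀ (n : ℕ) (e : RelCWComplex.cell (Set.univ : Set X) n),
      ∃ e₀ : RelCWComplex.cell (Set.univ : Set X) n, ⟨n, e₀⟩ ∈ I ∧
        ∃ g : G, g • RelCWComplex.openCell n e₀ = RelCWComplex.openCell n e

variable {X} in
/-- `x ∈ C_n(X) = H_n(X_n, X_{n-1})` is the class of the cell `e` for one of its two orientations,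
represented by the characteristic map of `e` composed with a homeomorphism of the standard simplex
onto the closed ball. -/
def IsCellClass [T2Space X] [CWComplex (Set.univ : Set X)] {n : ℕ}
    (e : RelCWComplex.cell (Set.univ : Set X) n) (x : (cellularComplex G X).X n) : Prop :=
  ∃ (h : stdSimplex ℝ (Fin (n + 1)) ≃ₜ Metric.closedBall (0 : Fin n → ℝ) 1)
    (σ : SingularSimplex X n) (ε : ℤˣ)
    (z : relCycles G (fun k => (RelCWComplex.skeletonLT (Set.univ : Set X) k : Set X)) n),
    (∀ t, σ t = RelCWComplex.map n e (h t)) ∧ (z : SingularChain G X n) = SingularChain.single G X σ ε ∧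
      x = (Submodule.Quotient.mk z : RelHomology G _ n)

variable {G X} in
/-- The preferred bases consist of (oriented) cells of `X`. Such a basis contains exactly one cell
from each `G`-orbit. -/
def IsCellularBasing [T2Space X] [CWComplex (Set.univ : Set X)]
    (b : FiniteBasing (cellularComplex G X)) : Prop :=
  ∀ n i, ∃ e : RelCWComplex.cell (Set.univ : Set X) n, IsCellClass G e (b.basis n i)

end Cellular

section AgrarianPolytope
variable {G D : Type*} [Group G] [Group.FG G] [DivisionRing D] (α : MonoidAlgebra ℤ G →+* D)
  (s : FreeAb G → G)

open CategoryTheory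

/-- The agrarian polytope `P(-ρ(C)) ∈ 𝒫(H)` of a based complex with torsion `ρ(C)`. -/
def chainAgrarianPolytope {C : ChainComplex (ModuleCat (MonoidAlgebra ℤ G)) ℕ}
    (b : FiniteBasing C) : PolytopeGroup (FreeAb G) :=
  (TwistedGroupRing.reducedPolytopeHom (sectionStructure α s)
    (b.torsion (rationalisation α s))⁻¹).toAdd

/-- Its class in `𝒫_T(H)`; for `C` the cellular complex of `X` with a cellular basis this is the
agrarian polytope of `X`. -/
def agrarianPolytope {C : ChainComplex (ModuleCat (MonoidAlgebra ℤ G)) ℕ}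
    (b : FiniteBasing C) : TranslationPolytopeGroup (FreeAb G) :=
  (chainAgrarianPolytope α s b : PolytopeGroup (FreeAb G))

end AgrarianPolytope

end

/-! Write E for D_r, ψ : H → ℤ for the map induced by φ, and n for the degree bound of the based
complex.

The diagonal action can be untwisted. Let t be central in E[t, t⁻¹] and put β(g) = α_r(g) t^{-φ(g)}.
Sending c ⊗ x to the vector of all β(c_i) x identifies E ⊗ (C_p ⊗ φ^*ℤ[t, t⁻¹]) with a free E[t,
t⁻¹]-module, on which the differential acts by the matrix β(A_p) (`TwistedModule.coords_bijective`,
`TwistedModule.coords_map`). Hence the twisted Betti numbers are the E-dimensions of the homology of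
a complex of Laurent matrices (`FiniteBasing.twistedBetti_eq`).

The blocks β(S_p) are injective on row vectors, with cokernels of finite E-dimension k_p. Counting
lengths of subquotients gives a telescoping relation, whose outcome is that all homology is
finite-dimensional and χ = ∑ (-1)^p k_p (`euler_characteristic_of_blocks`).

It remains to see that k_p is the width of the polytope of det S_p (`HasCodim.of_isDieudonneDet`).
For a 1 × 1 matrix x over DH this is division with remainder: the left ideal of E[t, t⁻¹] generated
by f has codimension equal to the spread of the exponents of f, and the exponents of the image of x
are the values of -ψ on the support of x. Codimension is additive under products, so it yields a
degree for matrix fractions Q⁻¹A. Transvections have degree 0 and diagonal matrices have the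
expected degree; an invertible matrix is a product of transvections with a diagonal matrix, whose
entries give the determinant.

Acyclicity enters twice: it provides a non-degenerate τ-chain, and it forces γ_n to be the whole
basis in degree n. The minus sign in the theorem is the one in P(-ρ). -/

noncomputable section

/-! ### Lengths of subquotients -/

section RelLength

variable {E : Type*} [Ring E] {V W : Type*} [AddCommGroup V] [Module E V]
  [AddCommGroup W] [Module E W]

/-- The length of `Z / (B ∩ Z)`. -/
def relLength (Z B : Submodule E V) : ℕ∞ := Module.length E (Z ⧸ B.submoduleOf Z)

theorem mem_submoduleOf_iff {B Z : Submodule E V} {z : Z} : z ∈ B.submoduleOf Z ↔ (z : V) ∈ B :=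
  Iff.rfl

theorem relLength_eq_of_surjective (Z B : Submodule E V) (f : Z →ₗ[E] W)
    (hf : Function.Surjective f) (hk : ∀ z : Z, f z = 0 ↔ (z : V) ∈ B) :
    relLength Z B = Module.length E W := by
  have h : B.submoduleOf Z = LinearMap.ker f := by
    ext z
    rw [LinearMap.mem_ker, hk, mem_submoduleOf_iff]
  rw [relLength, h]
  exact (f.quotKerEquivOfSurjective hf).length_eq

theorem relLength_top (B : Submodule E V) : relLength ⊤ B = Module.length E (V ⧸ B) :=
  relLength_eq_of_surjective _ _ (B.mkQ ∘ₗ (⊤ : Submodule E V).subtype)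
    (fun x => by
      obtain ⟨x, rfl⟩ := B.mkQ_surjective x
      exact ⟨⟨x, trivial⟩, rfl⟩)
    (fun z => by simp)

/-- Injectivity of g is needed on Z only. This matters for a coordinate projection, which is
injective on cycles but not on all chains. -/
theorem relLength_map (g : V →ₗ[E] W) (Z B : Submodule E V) (hB : B ≤ Z)
    (hg : ∀ z ∈ Z, g z = 0 → z = 0) : relLength (Z.map g) (B.map g) = relLength Z B := by
  symm
  refine relLength_eq_of_surjective Z B
    (((B.map g).submoduleOf (Z.map g)).mkQ ∘ₗ g.restrict fun z hz => ⟨z, hz, rfl⟩) ?_ ?_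
  · refine (Submodule.mkQ_surjective _).comp ?_
    rintro ⟨_, z, hz, rfl⟩
    exact ⟨⟨z, hz⟩, rfl⟩
  · rintro ⟨z, hz⟩
    simp only [LinearMap.comp_apply, Submodule.mkQ_apply, Submodule.Quotient.mk_eq_zero,
      mem_submoduleOf_iff]
    constructor
    · rintro ⟨b, hb, hbz⟩
      have hb' : g b = g z := hbz
      have := hg (b - z) (Z.sub_mem (hB hb) hz) (by rw [map_sub, hb', sub_self])
      rwa [← sub_eq_zero.mp this]
    · exact fun hb => ⟨z, hb, rfl⟩

/-- The sequence 0 → Z/B → Y/B → Y/Z → 0 is exact. Lengths take values in ℕ∞, so no finiteness has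
to be known beforehand. -/
theorem relLength_add {B Z Y : Submodule E V} (hBZ : B ≤ Z) (hZY : Z ≤ Y) :
    relLength Y B = relLength Z B + relLength Y Z := by
  have h1 : B.submoduleOf Z ≤ (B.submoduleOf Y).comap (Submodule.inclusion hZY) := fun _ h => h
  have h2 : B.submoduleOf Y ≤ (Z.submoduleOf Y).comap LinearMap.id := fun _ h => hBZ h
  refine Module.length_eq_add_of_exact (Submodule.mapQ _ _ _ h1) (Submodule.mapQ _ _ _ h2) ?_ ?_ ?_
  · rw [injective_iff_map_eq_zero]
    intro x hx
    obtain ⟨x, rfl⟩ := Submodule.Quotient.mk_surjective _ x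
    rw [Submodule.mapQ_apply, Submodule.Quotient.mk_eq_zero] at hx
    exact (Submodule.Quotient.mk_eq_zero _).mpr hx
  · intro x
    obtain ⟨x, rfl⟩ := Submodule.Quotient.mk_surjective _ x
    exact ⟨Submodule.Quotient.mk x, rfl⟩
  · intro x
    obtain ⟨x, rfl⟩ := Submodule.Quotient.mk_surjective _ x
    rw [Submodule.mapQ_apply, Submodule.Quotient.mk_eq_zero]
    constructor
    · intro hx
      exact ⟨Submodule.Quotient.mk ⟨x, hx⟩, rfl⟩
    · rintro ⟨y, hy⟩
      obtain ⟨y, rfl⟩ := Submodule.Quotient.mk_surjective _ y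
      rw [Submodule.mapQ_apply, Submodule.Quotient.eq] at hy
      have h1 : (y : V) - x ∈ B := hy
      have h2 := Z.sub_mem y.2 (hBZ h1)
      rw [sub_sub_cancel] at h2
      exact h2

theorem relLength_range_map_ker_eq {C : Type*} [AddCommGroup C] [Module E C]
    (f : C →ₗ[E] V) (g : C →ₗ[E] W) :
    relLength (LinearMap.range f) ((LinearMap.ker g).map f) =
      Module.length E (C ⧸ (LinearMap.ker f ⊔ LinearMap.ker g)) := by
  rw [← relLength_top]
  refine (relLength_eq_of_surjective ⊤ _
    ((((LinearMap.ker g).map f).submoduleOf (LinearMap.range f)).mkQ ∘ₗ f.rangeRestrict ∘ₗ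
      (⊤ : Submodule E C).subtype) ?_ ?_).symm
  · refine (Submodule.mkQ_surjective _).comp (f.surjective_rangeRestrict.comp ?_)
    exact fun x => ⟨⟨x, trivial⟩, rfl⟩
  · rintro ⟨z, hz⟩
    -- The preimage under f of f(ker g) is ker g + ker f, an expression symmetric in f and g.
    rw [sup_comm, ← Submodule.comap_map_eq, LinearMap.comp_apply, Submodule.mkQ_apply,
      Submodule.Quotient.mk_eq_zero]
    rfl

/-- Both sides are the length of `C / (ker f + ker g)`. -/
theorem relLength_range_map_ker {C : Type*} [AddCommGroup C] [Module E C]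
    (f : C →ₗ[E] V) (g : C →ₗ[E] W) :
    relLength (LinearMap.range f) ((LinearMap.ker g).map f) =
      relLength (LinearMap.range g) ((LinearMap.ker f).map g) := by
  rw [relLength_range_map_ker_eq, relLength_range_map_ker_eq, sup_comm]

/-- The length of the cokernel of a composite. -/
theorem length_quotient_range_comp {U : Type*} [AddCommGroup U] [Module E U]
    (f : U →ₗ[E] V) (g : V →ₗ[E] W) (hg : Function.Injective g) :
    Module.length E (W ⧸ LinearMap.range (g ∘ₗ f)) =
      Module.length E (V ⧸ LinearMap.range f) + Module.length E (W ⧸ LinearMap.range g) := by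
  have h1 : LinearMap.range (g ∘ₗ f) = (LinearMap.range f).map g := LinearMap.range_comp f g
  rw [← relLength_top, ← relLength_top, ← relLength_top,
    relLength_add (Z := LinearMap.range g) (LinearMap.range_comp_le_range f g) le_top, h1,
    LinearMap.range_eq_map g, relLength_map g ⊤ _ le_top
      (fun z _ hz => hg (by rw [hz, map_zero]))]

end RelLength

/-! ### Euler characteristic from square blocks of the differentials -/

section EulerCharacteristic

variable {E : Type*} [Ring E] {C V U : ℕ → Type*}
  [∀ p, AddCommGroup (C p)] [∀ p, Module E (C p)] [∀ p, AddCommGroup (V p)] [∀ p, Module E (V p)]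
  [∀ p, AddCommGroup (U p)] [∀ p, Module E (U p)]
  (d : ∀ p, C (p + 1) →ₗ[E] C p) (π : ∀ p, C p →ₗ[E] V p) (j : ∀ p, U p →ₗ[E] C p)

/-- The lengths of the homology modules of the complex given by the differentials `d`. -/
def homologyLength : ℕ → ℕ∞
  | 0 => relLength ⊤ (LinearMap.range (d 0))
  | p + 1 => relLength (LinearMap.ker (d p)) (LinearMap.range (d (p + 1)))

variable {d π j}

/-- A boundary killed by the projection lies in the image of j. Being a cycle, it is also killed by
the preceding block, which is injective on the image of j, so it vanishes. In degree 0 the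
projection itself is injective. -/
theorem ker_proj_comp_le (hd : ∀ p, d p ∘ₗ d (p + 1) = 0) (hπ0 : Function.Injective (π 0))
    (hj : ∀ p, LinearMap.range (j p) = LinearMap.ker (π p)) (p : ℕ)
    (hS : ∀ q, q + 1 = p → Function.Injective (π q ∘ₗ d q ∘ₗ j (q + 1))) :
    LinearMap.ker (π p ∘ₗ d p) = LinearMap.ker (d p) := by
  refine le_antisymm (fun x hx => ?_) (fun x hx => by
    rw [LinearMap.mem_ker] at hx; simp [hx])
  rw [LinearMap.mem_ker, LinearMap.comp_apply] at hx
  rw [LinearMap.mem_ker]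
  cases p with
  | zero => exact hπ0 (by rw [hx, map_zero])
  | succ q =>
    obtain ⟨u, hu⟩ : d (q + 1) x ∈ LinearMap.range (j (q + 1)) := by
      rw [hj]; exact hx
    have h0 : (π q ∘ₗ d q ∘ₗ j (q + 1)) u = 0 := by
      rw [LinearMap.comp_apply, LinearMap.comp_apply, hu]
      have : d q (d (q + 1) x) = 0 := LinearMap.congr_fun (hd q) x
      rw [this, map_zero]
    have hu0 : u = 0 := hS q rfl (by rw [h0, map_zero])
    rw [← hu, hu0, map_zero]

theorem homologyLength_zero (hπ : ∀ p, Function.Surjective (π p))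
    (hπ0 : Function.Injective (π 0)) :
    homologyLength d 0 = relLength ⊤ (LinearMap.range (π 0 ∘ₗ d 0)) := by
  rw [homologyLength, LinearMap.range_comp, ← relLength_map (π 0) ⊤ _ le_top
    (fun z _ hz => hπ0 (by rw [hz, map_zero])), Submodule.map_top,
    LinearMap.range_eq_top.mpr (hπ 0)]

/-- Filter V_{p+1} by π(im d_{p+1}) ⊆ π(ker d_p) ⊆ V_{p+1}. The projection is injective on ker d_p,
so the lower quotient is the homology in degree p + 1. By the symmetry of `relLength_range_map_ker`,
applied to π_p d_p and π_{p+1}, the upper quotient has the length of im(π_p d_p) modulo the image of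
the block. -/
theorem homologyLength_succ (hd : ∀ p, d p ∘ₗ d (p + 1) = 0) (hπ : ∀ p, Function.Surjective (π p))
    (hπ0 : Function.Injective (π 0))
    (hj : ∀ p, LinearMap.range (j p) = LinearMap.ker (π p)) (p : ℕ)
    (hS : ∀ q ≤ p, Function.Injective (π q ∘ₗ d q ∘ₗ j (q + 1))) :
    relLength ⊤ (LinearMap.range (π (p + 1) ∘ₗ d (p + 1))) = homologyLength d (p + 1) +
      relLength (LinearMap.range (π p ∘ₗ d p)) (LinearMap.range (π p ∘ₗ d p ∘ₗ j (p + 1))) := by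
  have hK : LinearMap.ker (π p ∘ₗ d p) = LinearMap.ker (d p) :=
    ker_proj_comp_le hd hπ0 hj p fun q hq => hS q (by omega)
  have h1 : LinearMap.range (π p ∘ₗ d p ∘ₗ j (p + 1)) =
      (LinearMap.ker (π (p + 1))).map (π p ∘ₗ d p) := by
    rw [← hj, ← LinearMap.range_comp]; rfl
  have hle : LinearMap.range (d (p + 1)) ≤ LinearMap.ker (d p) :=
    LinearMap.range_le_ker_iff.mpr (hd p)
  rw [h1, relLength_range_map_ker, hK, LinearMap.range_eq_top.mpr (hπ (p + 1)),
    relLength_add (Z := (LinearMap.ker (d p)).map (π (p + 1))) _ le_top, LinearMap.range_comp,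
    relLength_map _ _ _ hle]
  · rfl
  · intro z hz hz0
    obtain ⟨u, hu⟩ : z ∈ LinearMap.range (j (p + 1)) := by rw [hj]; exact hz0
    have h0 : (π p ∘ₗ d p ∘ₗ j (p + 1)) u = 0 := by
      rw [LinearMap.comp_apply, LinearMap.comp_apply, hu, LinearMap.mem_ker.mp hz, map_zero]
    have hu0 : u = 0 := hS p le_rfl (by rw [h0, map_zero])
    rw [← hu, hu0, map_zero]
  · rw [LinearMap.range_comp]; exact Submodule.map_mono hle

/-- The Euler characteristic of a complex, computed from the cokernels of injective square blocks
of the differentials. -/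
theorem euler_characteristic_of_blocks (hd : ∀ p, d p ∘ₗ d (p + 1) = 0)
    (hπ : ∀ p, Function.Surjective (π p)) (hπ0 : Function.Injective (π 0))
    (hj : ∀ p, LinearMap.range (j p) = LinearMap.ker (π p)) (m : ℕ)
    (hS : ∀ p < m, Function.Injective (π p ∘ₗ d p ∘ₗ j (p + 1))) (δ : ℕ → ℕ)
    (hδ : ∀ p < m, Module.length E (V p ⧸ LinearMap.range (π p ∘ₗ d p ∘ₗ j (p + 1))) = δ p)
    (hV : Subsingleton (V m)) (hC : ∀ p, m < p → Subsingleton (C p)) :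
    ∃ h : ℕ → ℕ, (∀ p, homologyLength d p = h p) ∧ (∀ p, m < p → h p = 0) ∧
      ∑ p ∈ Finset.range (m + 1), (-1 : ℤ) ^ p * h p =
        ∑ p ∈ Finset.range m, (-1 : ℤ) ^ p * δ p := by
  -- The cokernel of the p-th block, of length δ p, is cut at the image of π_p d_p into an upper
  -- part of length c p and a lower part of length e p. The relations δ p = e p + c p and c (p + 1)
  -- = h (p + 1) + e p, with c 0 = h 0 and c m = 0, make the alternating sum telescope.
  set c : ℕ → ℕ∞ := fun p => relLength ⊤ (LinearMap.range (π p ∘ₗ d p)) with hc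
  set e : ℕ → ℕ∞ := fun p =>
    relLength (LinearMap.range (π p ∘ₗ d p)) (LinearMap.range (π p ∘ₗ d p ∘ₗ j (p + 1))) with he
  have h1 : ∀ p < m, e p + c p = δ p := by
    intro p hp
    rw [← hδ p hp, ← relLength_top]
    refine (relLength_add ?_ le_top).symm
    rw [← LinearMap.comp_assoc]
    exact LinearMap.range_comp_le_range _ _
  have h2 : ∀ p < m, c (p + 1) = homologyLength d (p + 1) + e p := fun p hp =>
    homologyLength_succ hd hπ hπ0 hj p fun q hq => hS q (by omega)
  have h0 : homologyLength d 0 = c 0 := homologyLength_zero hπ hπ0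
  have hcm : c m = 0 := by
    rw [hc]
    simp only [relLength]
    exact Module.length_eq_zero
  have hgt : ∀ p, m < p → homologyLength d p = 0 := by
    intro p hp
    have := hC p hp
    cases p <;> exact Module.length_eq_zero
  have hcf : ∀ p ≤ m, c p ≠ ⊤ := by
    intro p hp
    rcases hp.eq_or_lt with rfl | hp
    · rw [hcm]; simp
    · have h := h1 p hp
      intro htop
      rw [htop] at h
      simp at h
  have hef : ∀ p < m, e p ≠ ⊤ := by
    intro p hp htop
    have h := h1 p hp
    rw [htop] at h
    simp at h
  have hhf : ∀ p, homologyLength d p ≠ ⊤ := by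
    intro p htop
    rcases lt_or_ge m p with hp | hp
    · rw [hgt p hp] at htop; simp at htop
    · cases p with
      | zero => exact hcf 0 hp (h0 ▸ htop)
      | succ p =>
        have h := h2 p hp
        rw [htop, top_add] at h
        exact hcf _ hp h
  refine ⟨fun p => (homologyLength d p).toNat, fun p => (ENat.natCast_toNat (hhf p)).symm,
    fun p hp => by simp [hgt p hp], ?_⟩
  have h1' : ∀ p < m, ((e p).toNat : ℤ) + (c p).toNat = δ p := by
    intro p hp
    have := congrArg ENat.toNat (h1 p hp)
    rw [ENat.toNat_add (hef p hp) (hcf p hp.le), ENat.toNat_natCast] at this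
    exact_mod_cast this
  have h2' : ∀ p < m, ((c (p + 1)).toNat : ℤ) = (homologyLength d (p + 1)).toNat + (e p).toNat := by
    intro p hp
    have := congrArg ENat.toNat (h2 p hp)
    rw [ENat.toNat_add (hhf _) (hef p hp)] at this
    exact_mod_cast this
  -- The truncated identity carries an error term ± c n, which disappears at n = m because V m = 0.
  have key : ∀ n ≤ m, ∑ p ∈ Finset.range (n + 1), (-1 : ℤ) ^ p * (homologyLength d p).toNat =
      ∑ p ∈ Finset.range n, (-1 : ℤ) ^ p * δ p + (-1) ^ n * (c n).toNat := by
    intro n hn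
    induction n with
    | zero => simp [h0]
    | succ n ih =>
      rw [Finset.sum_range_succ, ih (by omega), Finset.sum_range_succ, ← h1' n hn, h2' n hn]
      ring
  rw [key m le_rfl, hcm]
  simp

/-- If the complex is exact and the blocks are bijective below degree `p`, then the next block
map is surjective. -/
theorem proj_comp_surjective (hd : ∀ p, d p ∘ₗ d (p + 1) = 0)
    (hπ : ∀ p, Function.Surjective (π p)) (hπ0 : Function.Injective (π 0))
    (hj : ∀ p, LinearMap.range (j p) = LinearMap.ker (π p))
    (hex : ∀ p, homologyLength d p = 0) (p : ℕ)
    (hS : ∀ q < p, Function.Bijective (π q ∘ₗ d q ∘ₗ j (q + 1))) :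
    Function.Surjective (π p ∘ₗ d p) := by
  have h : relLength ⊤ (LinearMap.range (π p ∘ₗ d p)) = 0 := by
    cases p with
    | zero => rw [← homologyLength_zero hπ hπ0, hex]
    | succ p =>
      -- The homology term vanishes by exactness. The other term vanishes because the preceding
      -- block is already onto.
      rw [homologyLength_succ hd hπ hπ0 hj p fun q hq => (hS q (by omega)).1, hex, zero_add,
        LinearMap.range_eq_top.mpr (hS p (by omega)).2]
      refine Module.length_eq_zero_iff.mpr ?_
      rw [Submodule.Quotient.subsingleton_iff]
      exact Submodule.submoduleOf_eq_top.mpr le_top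
  rw [relLength_top, Module.length_eq_zero_iff, Submodule.Quotient.subsingleton_iff] at h
  exact LinearMap.range_eq_top.mp h

end EulerCharacteristic

/-! ### Twisted group rings as left modules, and the untwisted case -/

namespace TwistedGroupRing

section Module

variable {R Γ : Type*} [Ring R] [Group Γ] {S : StructureFunctions R Γ}

instance : Module R (TwistedGroupRing S) := inferInstanceAs (Module R (Γ →₀ R))

theorem smul_single (u : R) (g : Γ) (v : R) : u • single S g v = single S g (u * v) :=
  Finsupp.smul_single' u g v

instance : IsScalarTower R (TwistedGroupRing S) (TwistedGroupRing S) where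
  smul_assoc u x y := by
    simp only [smul_eq_mul]
    induction x using induction with
    | h0 => rw [smul_zero, zero_mul, smul_zero]
    | ha x x' hx hx' => rw [smul_add, add_mul, add_mul, smul_add, hx, hx']
    | hs a v =>
      induction y using induction with
      | h0 => rw [mul_zero, mul_zero, smul_zero]
      | ha y y' hy hy' => rw [mul_add, mul_add, smul_add, hy, hy']
      | hs b w => simp only [smul_single, single_mul_single, mul_assoc]

/-- The coefficients, as a linear equivalence. -/
def coeffEquiv (S : StructureFunctions R Γ) : TwistedGroupRing S ≃ₗ[R] (Γ →₀ R) :=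
  LinearEquiv.refl R (Γ →₀ R)

theorem eq_sum_single (x : TwistedGroupRing S) :
    x = ∑ g ∈ x.coeff.support, single S g (x.coeff g) :=
  (Finsupp.sum_single x.coeff).symm

theorem coeff_sum {ι : Type*} (s : Finset ι) (f : ι → TwistedGroupRing S) (g : Γ) :
    (∑ i ∈ s, f i).coeff g = ∑ i ∈ s, (f i).coeff g :=
  Finsupp.finsetSum_apply s f g

end Module

/-- The structure functions of the untwisted group ring. -/
def trivialStructure (R Γ : Type*) [Ring R] [Group Γ] : StructureFunctions R Γ where
  c _ := RingEquiv.refl R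
  τ _ _ := 1
  c_comp _ _ _ := by simp
  cocycle _ _ _ := by simp

theorem single_mul_single_trivial {R Γ : Type*} [Ring R] [Group Γ] (a b : Γ) (u v : R) :
    single (trivialStructure R Γ) a u * single (trivialStructure R Γ) b v =
      single (trivialStructure R Γ) (a * b) (u * v) := by
  rw [single_mul_single]
  simp [trivialStructure]

theorem one_def_trivial {R Γ : Type*} [Ring R] [Group Γ] :
    (1 : TwistedGroupRing (trivialStructure R Γ)) = single (trivialStructure R Γ) 1 1 := by
  rw [one_def]
  simp [trivialStructure]

end TwistedGroupRing

/-! ### Laurent polynomials in a central variable over a skew field -/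

/-- The ring `E[t, t⁻¹]` of Laurent polynomials in a central variable. -/
abbrev LaurentRing (E : Type*) [Ring E] : Type _ :=
  TwistedGroupRing (TwistedGroupRing.trivialStructure E (Multiplicative ℤ))

namespace LaurentRing

open TwistedGroupRing

/-- The monomial `u t^k`. -/
def mono {E : Type*} [Ring E] (k : Multiplicative ℤ) (u : E) : LaurentRing E :=
  single (trivialStructure E (Multiplicative ℤ)) k u

section Ring
variable {E : Type*} [Ring E]

theorem mono_mul_mono (a b : Multiplicative ℤ) (u v : E) :
    mono a u * mono b v = mono (a * b) (u * v) := single_mul_single_trivial a b u v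

theorem one_eq_mono : (1 : LaurentRing E) = mono 1 1 := one_def_trivial

theorem smul_mono (u : E) (k : Multiplicative ℤ) (v : E) : u • mono k v = mono k (u * v) :=
  smul_single u k v

theorem mono_zero (k : Multiplicative ℤ) : mono k (0 : E) = 0 := single_zero k

theorem mono_add (k : Multiplicative ℤ) (u v : E) : mono k (u + v) = mono k u + mono k v :=
  single_add k u v

theorem coeff_mono (k l : Multiplicative ℤ) (u : E) :
    (mono k u).coeff l = if k = l then u else 0 := by
  classical
  exact Finsupp.single_apply

theorem mono_mul_comm (k : Multiplicative ℤ) (x : LaurentRing E) :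
    mono k (1 : E) * x = x * mono k 1 := by
  induction x using TwistedGroupRing.induction with
  | h0 => rw [mul_zero, zero_mul]
  | ha x y hx hy => rw [mul_add, add_mul, hx, hy]
  | hs g u =>
    change mono k 1 * mono g u = mono g u * mono k 1
    rw [mono_mul_mono, mono_mul_mono, mul_comm, one_mul, mul_one]

/-- Right multiplication, as a linear map over the coefficients. -/
def mulRight (f : LaurentRing E) : LaurentRing E →ₗ[E] LaurentRing E where
  toFun g := g * f
  map_add' g h := add_mul g h f
  map_smul' u g := smul_mul_assoc u g f

end Ring

variable {E : Type*} [DivisionRing E]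

/-- The Laurent polynomials with exponents in a given set. -/
def supportedIn (E : Type*) [DivisionRing E] (s : Set (Multiplicative ℤ)) :
    Submodule E (LaurentRing E) :=
  (Finsupp.supported E E s).comap
    (coeffEquiv (trivialStructure E (Multiplicative ℤ))).toLinearMap

theorem mem_supportedIn {s : Set (Multiplicative ℤ)} {x : LaurentRing E} :
    x ∈ supportedIn E s ↔ ∀ k, x.coeff k ≠ 0 → k ∈ s := by
  change x.coeff ∈ Finsupp.supported E E s ↔ _
  rw [Finsupp.mem_supported]
  simp [Set.subset_def]

theorem length_supportedIn (s : Set (Multiplicative ℤ)) :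
    Module.length E (supportedIn E s) = ENat.card s := by
  let e : supportedIn E s ≃ₗ[E] (s →₀ E) :=
    ((coeffEquiv (trivialStructure E (Multiplicative ℤ))).ofSubmodule'
      (Finsupp.supported E E s)).trans (Finsupp.supportedEquivFinsupp s)
  rw [e.length_eq, Module.length_finsupp, Module.length_eq_one, mul_one]

section Width

variable {f : LaurentRing E} {a b : Multiplicative ℤ}

/-- Extremal terms cannot cancel without zero divisors. The top exponent of g f is max g + b and the
bottom one is min g + a. If both lie in [a, b), then max g < 0 ≤ min g, which is impossible for g ≠
0. -/
theorem le_of_mul_mem_supportedIn (ha : f.coeff a ≠ 0) (hb : f.coeff b ≠ 0)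
    (hf : f ∈ supportedIn E (Set.Icc a b)) (g : LaurentRing E)
    (hg : g * f ∈ supportedIn E (Set.Ico a b)) : g = 0 := by
  by_contra hne
  have hs : g.coeff.support.Nonempty := Finsupp.support_nonempty_iff.mpr (mt coeff_eq_zero.mp hne)
  rw [mem_supportedIn] at hf hg
  have h1 := hg _ (coeff_mul_of_uniqueMul g f (g.coeff.support.max'_mem hs)
    (Finsupp.mem_support_iff.mpr hb) fun i j hi hj hij =>
      (mul_eq_mul_iff_eq_and_eq (g.coeff.support.le_max' i hi)
        (hf j (Finsupp.mem_support_iff.mp hj)).2).mp hij)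
  have h2 := hg _ (coeff_mul_of_uniqueMul g f (g.coeff.support.min'_mem hs)
    (Finsupp.mem_support_iff.mpr ha) fun i j hi hj hij => by
      have := (mul_eq_mul_iff_eq_and_eq (g.coeff.support.min'_le i hi)
        (hf j (Finsupp.mem_support_iff.mp hj)).1).mp hij.symm
      exact ⟨this.1.symm, this.2.symm⟩)
  have h3 : g.coeff.support.max' hs < 1 := by simpa using h1.2
  have h4 : 1 ≤ g.coeff.support.min' hs := by simpa using h2.1
  exact absurd (h4.trans (g.coeff.support.min'_le_max' hs)) (not_le.mpr h3)

/-- Solve for one term of a multiple of f: multiplying f by u f_c⁻¹ t^k produces u t^{k+c} plus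
terms already known to lie in N. -/
theorem mono_mem_of_forall_ne {N : Submodule E (LaurentRing E)}
    (hN : ∀ g, g * f ∈ N) {c : Multiplicative ℤ} (hc : f.coeff c ≠ 0) (k : Multiplicative ℤ)
    (h : ∀ j, f.coeff j ≠ 0 → j ≠ c → ∀ u : E, mono (k * j) u ∈ N) (u : E) :
    mono (k * c) u ∈ N := by
  classical
  have h1 : mono k (u * (f.coeff c)⁻¹) * f =
      ∑ j ∈ f.coeff.support, mono (k * j) (u * (f.coeff c)⁻¹ * f.coeff j) := by
    have h0 := congrArg (mono k (u * (f.coeff c)⁻¹) * ·) (eq_sum_single f)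
    rw [Finset.mul_sum] at h0
    refine h0.trans ?_
    exact Finset.sum_congr rfl fun j _ => mono_mul_mono _ _ _ _
  rw [← Finset.add_sum_erase _ _ (Finsupp.mem_support_iff.mpr hc)] at h1
  have h2 := N.sub_mem (hN (mono k (u * (f.coeff c)⁻¹)))
    (N.sum_mem (t := f.coeff.support.erase c)
      (f := fun j => mono (k * j) (u * (f.coeff c)⁻¹ * f.coeff j)) fun j hj =>
        h j (Finsupp.mem_support_iff.mp (Finset.mem_of_mem_erase hj)) (Finset.ne_of_mem_erase hj) _)
  rw [h1, add_sub_cancel_right, inv_mul_cancel_right₀ hc] at h2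
  exact h2

/-- Division with remainder by f, at both ends of the exponent range. The remainders are the
polynomials with exponents in [a, b). -/
theorem isCompl_supportedIn (ha : f.coeff a ≠ 0) (hb : f.coeff b ≠ 0)
    (hf : f ∈ supportedIn E (Set.Icc a b)) :
    IsCompl (LinearMap.range (mulRight f)) (supportedIn E (Set.Ico a b)) := by
  constructor
  · rw [Submodule.disjoint_def]
    rintro _ ⟨g, rfl⟩ hg
    rw [le_of_mul_mem_supportedIn ha hb hf g hg, map_zero]
  · rw [codisjoint_iff]
    set N := LinearMap.range (mulRight f) ⊔ supportedIn E (Set.Ico a b) with hNdef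
    have hN : ∀ g, g * f ∈ N := fun g => Submodule.mem_sup_left ⟨g, rfl⟩
    rw [mem_supportedIn] at hf
    -- The interval [a - m, b + m) of known exponents grows by one on each side as m increases.
    have key : ∀ (m : ℕ) (k : Multiplicative ℤ), a.toAdd - m ≤ k.toAdd → k.toAdd < b.toAdd + m →
        ∀ u : E, mono k u ∈ N := by
      intro m
      induction m with
      | zero =>
        intro k h1 h2 u
        refine Submodule.mem_sup_right (mem_supportedIn.mpr fun l hl => ?_)
        rw [coeff_mono] at hl
        split_ifs at hl with hkl
        · subst hkl
          simp only [Nat.cast_zero, sub_zero, add_zero] at h1 h2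
          exact ⟨h1, h2⟩
        · exact absurd rfl hl
      | succ m ih =>
        intro k h1 h2
        have hle : ∀ j, f.coeff j ≠ 0 → a.toAdd ≤ j.toAdd ∧ j.toAdd ≤ b.toAdd := hf
        push_cast at h1 h2
        by_cases hk1 : k.toAdd = b.toAdd + m
        -- The shift by m puts the top exponent b at b + m and keeps all others in the known
        -- interval.
        · have := mono_mem_of_forall_ne hN hb (Multiplicative.ofAdd (m : ℤ)) fun j hj hjb => by
            have h3 := hle j hj
            have h4 : j.toAdd ≠ b.toAdd := fun h => hjb h
            refine ih _ ?_ ?_ <;> rw [toAdd_mul, toAdd_ofAdd] <;> omega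
          have hkb : Multiplicative.ofAdd (m : ℤ) * b = k := by
            apply Multiplicative.toAdd.injective
            rw [toAdd_mul, toAdd_ofAdd, hk1, add_comm]
          rwa [hkb] at this
        by_cases hk2 : k.toAdd = a.toAdd - m - 1
        -- The shift by -m - 1 puts the bottom exponent a at a - m - 1 and keeps all others in the
        -- known interval.
        · have := mono_mem_of_forall_ne hN ha (Multiplicative.ofAdd (-(m : ℤ) - 1))
            fun j hj hjb => by
              have h3 := hle j hj
              have h4 : j.toAdd ≠ a.toAdd := fun h => hjb h
              refine ih _ ?_ ?_ <;> rw [toAdd_mul, toAdd_ofAdd] <;> omega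
          have hka : Multiplicative.ofAdd (-(m : ℤ) - 1) * a = k := by
            apply Multiplicative.toAdd.injective
            rw [toAdd_mul, toAdd_ofAdd, hk2]; ring
          rwa [hka] at this
        · exact ih k (by omega) (by omega)
    rw [eq_top_iff]
    rintro x -
    rw [eq_sum_single x]
    refine N.sum_mem fun k _ => ?_
    -- Any m that is large enough for [a - m, b + m) to contain k will do.
    exact key (a.toAdd.natAbs + b.toAdd.natAbs + k.toAdd.natAbs + 1) k (by omega) (by omega) _

/-- The codimension of the left ideal generated by a Laurent polynomial over a skew field is the
difference of its extremal exponents. -/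
theorem length_quotient_mulRight (ha : f.coeff a ≠ 0) (hb : f.coeff b ≠ 0)
    (hf : f ∈ supportedIn E (Set.Icc a b)) :
    Module.length E (LaurentRing E ⧸ LinearMap.range (mulRight f)) =
      ((b.toAdd - a.toAdd).toNat : ℕ) := by
  rw [(Submodule.quotientEquivOfIsCompl _ _ (isCompl_supportedIn ha hb hf)).length_eq,
    length_supportedIn]
  have h : Nat.card (Set.Ico a b) = (b.toAdd - a.toAdd).toNat := by
    have h1 : Nat.card (Set.Ico a b) = Nat.card (Set.Ico a.toAdd b.toAdd) := rfl
    rw [h1]; simp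
  have hfin : Finite (Set.Ico a b) := inferInstanceAs (Finite (Set.Ico a.toAdd b.toAdd))
  rw [ENat.card_eq_coe_natCard, h]

end Width

end LaurentRing

/-! ### The grading of DH by ψ and the width of the Newton polytope -/

namespace TwistedGroupRing

open LaurentRing Algebra

section Grade

variable {R H E : Type*} [Ring R] [CommGroup H] [Ring E] {S : StructureFunctions R H}
  (ι : TwistedGroupRing S →+* E) (ψ : H →* Multiplicative ℤ)

/-- The additive map `u ∗ h ↦ ι(u ∗ h) t^{-ψ(h)}`. -/
def gradeAddHom : TwistedGroupRing S →+ LaurentRing E :=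
  Finsupp.liftAddHom (M := R) (N := LaurentRing E) fun h =>
    { toFun := fun u => mono (ψ h)⁻¹ (ι (single S h u))
      map_zero' := by rw [single_zero, map_zero, mono_zero]
      map_add' := fun u v => by rw [single_add, map_add, mono_add] }

theorem gradeAddHom_single (h : H) (u : R) :
    gradeAddHom ι ψ (single S h u) = mono (ψ h)⁻¹ (ι (single S h u)) :=
  Finsupp.liftAddHom_apply_single _ _ _

/-- The ring homomorphism `u ∗ h ↦ ι(u ∗ h) t^{-ψ(h)}`. -/
def gradeHom : TwistedGroupRing S →+* LaurentRing E where
  __ := gradeAddHom ι ψ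
  map_one' := by
    change gradeAddHom ι ψ 1 = 1
    rw [one_def, gradeAddHom_single, ← one_def, map_one, map_one, inv_one, one_eq_mono]
  map_mul' x y := by
    change gradeAddHom ι ψ (x * y) = gradeAddHom ι ψ x * gradeAddHom ι ψ y
    induction x using TwistedGroupRing.induction with
    | h0 => rw [zero_mul, map_zero, zero_mul]
    | ha x x' hx hx' => rw [add_mul, map_add, map_add, add_mul, hx, hx']
    | hs a u =>
      induction y using TwistedGroupRing.induction with
      | h0 => rw [mul_zero, map_zero, mul_zero]
      | ha y y' hy hy' => rw [mul_add, map_add, map_add, mul_add, hy, hy']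
      | hs b v =>
        rw [single_mul_single, gradeAddHom_single, gradeAddHom_single, gradeAddHom_single,
          mono_mul_mono, ← single_mul_single, map_mul, map_mul, mul_inv]

theorem gradeHom_single (h : H) (u : R) :
    gradeHom ι ψ (single S h u) = mono (ψ h)⁻¹ (ι (single S h u)) :=
  gradeAddHom_single ι ψ h u

open Classical in
theorem coeff_gradeHom (x : TwistedGroupRing S) (k : Multiplicative ℤ) :
    (gradeHom ι ψ x).coeff k =
      ι (∑ h ∈ x.coeff.support with (ψ h)⁻¹ = k, single S h (x.coeff h)) := by
  have h1 : gradeHom ι ψ x =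
      ∑ h ∈ x.coeff.support, mono (ψ h)⁻¹ (ι (single S h (x.coeff h))) := by
    have h0 := congrArg (gradeHom ι ψ) (eq_sum_single x)
    rw [map_sum] at h0
    exact h0.trans (Finset.sum_congr rfl fun h _ => gradeHom_single ι ψ h _)
  rw [h1, coeff_sum, map_sum, Finset.sum_filter]
  exact Finset.sum_congr rfl fun h _ => coeff_mono _ _ _

/-- The coefficient of t^k is the image under ι of a whole homogeneous component of x, not a sum of
elements of D. Distinct h with equal ψ(h) therefore cannot cancel when ι is injective. -/
theorem coeff_gradeHom_ne_zero_iff (hι : Function.Injective ι) (x : TwistedGroupRing S)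
    (k : Multiplicative ℤ) :
    (gradeHom ι ψ x).coeff k ≠ 0 ↔ ∃ h, x.coeff h ≠ 0 ∧ (ψ h)⁻¹ = k := by
  classical
  rw [coeff_gradeHom, Ne, map_eq_zero_iff ι hι]
  have hc : ∀ g, (∑ h ∈ x.coeff.support with (ψ h)⁻¹ = k, single S h (x.coeff h)).coeff g =
      if (ψ g)⁻¹ = k then x.coeff g else 0 := by
    intro g
    simp only [coeff_sum, coeff_single, Finsupp.single_apply, Finset.sum_ite_eq',
      Finset.mem_filter, Finsupp.mem_support_iff]
    by_cases hg : x.coeff g = 0 <;> simp [hg]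
  constructor
  · intro hne
    by_contra! hcon
    refine hne (Finset.sum_eq_zero fun h hh => ?_)
    rw [Finset.mem_filter, Finsupp.mem_support_iff] at hh
    exact absurd hh.2 (hcon h hh.1)
  · rintro ⟨h, hh, hk⟩ h0
    have := hc h
    rw [h0, if_pos hk] at this
    exact hh this.symm

end Grade

section Width

variable {D H E : Type*} [DivisionRing D] [CommGroup H] [DivisionRing E]
  {S : StructureFunctions D H} (ι : TwistedGroupRing S →+* E) (ψ : H →* Multiplicative ℤ)

/-- A linear functional is bounded on a convex hull by its extreme values on the generators, and
both bounds are attained at lattice points of A. -/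
theorem width_latticePolytope (A : Finset H) (hA : A.Nonempty) {h₁ h₂ : H} (hh₁ : h₁ ∈ A)
    (hh₂ : h₂ ∈ A) (hmax : ∀ h ∈ A, ψ h ≤ ψ h₁) (hmin : ∀ h ∈ A, ψ h₂ ≤ ψ h) :
    widthHom (realExtension ψ) (latticePolytope A hA) = ((ψ h₁).toAdd - (ψ h₂).toAdd : ℤ) := by
  have hmem : ∀ h ∈ A, latticePoint h ∈ convexHull ℝ (latticePoint '' (A : Set H)) := fun h hh =>
    subset_convexHull ℝ _ ⟨h, hh, rfl⟩
  have hle : ∀ x ∈ convexHull ℝ (latticePoint '' (A : Set H)),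
      realExtension ψ x ≤ ((ψ h₁).toAdd : ℝ) := by
    intro x hx
    refine convexHull_min (t := {x | realExtension ψ x ≤ ((ψ h₁).toAdd : ℝ)}) ?_
      (convex_halfSpace_le (realExtension ψ).isLinear _) hx
    rintro _ ⟨h, hh, rfl⟩
    rw [Set.mem_ofPred_eq, realExtension_latticePoint]
    exact Int.cast_le.mpr (hmax h hh)
  have hge : ∀ x ∈ convexHull ℝ (latticePoint '' (A : Set H)),
      ((ψ h₂).toAdd : ℝ) ≤ realExtension ψ x := by
    intro x hx
    refine convexHull_min (t := {x | ((ψ h₂).toAdd : ℝ) ≤ realExtension ψ x}) ?_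
      (convex_halfSpace_ge (realExtension ψ).isLinear _) hx
    rintro _ ⟨h, hh, rfl⟩
    rw [Set.mem_ofPred_eq, realExtension_latticePoint]
    exact Int.cast_le.mpr (hmin h hh)
  refine IsGreatest.csSup_eq ⟨⟨_, hmem h₁ hh₁, _, hmem h₂ hh₂, ?_⟩, ?_⟩
  · simp only [realExtension_latticePoint]
    push_cast; rfl
  · rintro _ ⟨x, hx, y, hy, rfl⟩
    push_cast
    exact sub_le_sub (hle x hx) (hge y hy)

/-- The codimension of the left ideal generated by the image of `x` in `E[t, t⁻¹]` is the width of
the Newton polytope of `x`. -/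
theorem exists_length_eq_width (hι : Function.Injective ι) (x : TwistedGroupRing S) (hx : x ≠ 0) :
    ∃ k : ℕ, Module.length E (LaurentRing E ⧸ LinearMap.range (mulRight (gradeHom ι ψ x))) = k ∧
      widthHom (realExtension ψ) (newtonPolytope x hx) = k := by
  have hs : x.coeff.support.Nonempty := Finsupp.support_nonempty_iff.mpr (mt coeff_eq_zero.mp hx)
  obtain ⟨h₁, hh₁, hmax⟩ := x.coeff.support.exists_max_image ψ hs
  obtain ⟨h₂, hh₂, hmin⟩ := x.coeff.support.exists_min_image ψ hs
  have hc := coeff_gradeHom_ne_zero_iff ι ψ hι x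
  -- The grading uses -ψ, so the maximiser h₁ of ψ gives the lowest exponent and the minimiser h₂
  -- the highest.
  refine ⟨_, length_quotient_mulRight (a := (ψ h₁)⁻¹) (b := (ψ h₂)⁻¹)
    ((hc _).mpr ⟨h₁, Finsupp.mem_support_iff.mp hh₁, rfl⟩)
    ((hc _).mpr ⟨h₂, Finsupp.mem_support_iff.mp hh₂, rfl⟩)
    (mem_supportedIn.mpr fun k hk => ?_), ?_⟩
  · obtain ⟨h, hh, rfl⟩ := (hc _).mp hk
    rw [← Finsupp.mem_support_iff] at hh
    exact ⟨inv_le_inv_iff.mpr (hmax h hh), inv_le_inv_iff.mpr (hmin h hh)⟩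
  · have h12 : (ψ h₂).toAdd ≤ (ψ h₁).toAdd := hmax h₂ hh₂
    rw [newtonPolytope, width_latticePolytope ψ _ _ hh₁ hh₂ hmax hmin]
    have : (((ψ h₂)⁻¹.toAdd - (ψ h₁)⁻¹.toAdd).toNat : ℤ) = (ψ h₁).toAdd - (ψ h₂).toAdd := by
      rw [toAdd_inv, toAdd_inv]; omega
    exact_mod_cast congrArg (Int.cast (R := ℝ)) this.symm

end Width

end TwistedGroupRing

/-! ### Fractions, common denominators and extension of the grading -/

section OreField

open TwistedGroupRing LaurentRing OreLocalization

variable {D H : Type*} [DivisionRing D] [CommGroup H] [UniqueProds H]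
  {S : StructureFunctions D H}

/-- The embedding of a twisted group ring into its Ore field of fractions. -/
abbrev toOreField (S : StructureFunctions D H) : TwistedGroupRing S →+* OreField S :=
  numeratorRingHom

theorem toOreField_injective : Function.Injective (toOreField S) :=
  numeratorHom_inj fun _ h => h.1

theorem toOreField_ne_zero {x : TwistedGroupRing S} (hx : x ≠ 0) : toOreField S x ≠ 0 :=
  (map_ne_zero_iff _ toOreField_injective).mpr hx

theorem exists_mul_eq_toOreField (x : OreField S) :
    ∃ q p : TwistedGroupRing S, q ≠ 0 ∧ toOreField S q * x = toOreField S p := by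
  induction x using OreLocalization.ind with
  | _ r s =>
    refine ⟨s, r, nonZeroDivisors.ne_zero s.2, ?_⟩
    change numeratorHom (s : TwistedGroupRing S) * (r /ₒ s) = numeratorHom r
    rw [numeratorHom_apply, numeratorHom_apply, OreLocalization.mul_cancel]

/-- Denominators stand on the left. A denominator r of q x can be multiplied onto q from the left
without spoiling the elements already cleared by q. -/
theorem exists_common_denominator (s : Finset (OreField S)) :
    ∃ q : TwistedGroupRing S, q ≠ 0 ∧
      ∀ x ∈ s, ∃ p : TwistedGroupRing S, toOreField S q * x = toOreField S p := by
  classical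
  induction s using Finset.induction_on with
  | empty => exact ⟨1, one_ne_zero, by simp⟩
  | insert x s _ ih =>
    obtain ⟨q, hq, h⟩ := ih
    obtain ⟨r, p, hr, hp⟩ := exists_mul_eq_toOreField (toOreField S q * x)
    refine ⟨r * q, mul_ne_zero hr hq, fun y hy => ?_⟩
    rw [map_mul]
    rcases Finset.mem_insert.mp hy with rfl | hy
    · exact ⟨p, by rw [mul_assoc, hp]⟩
    · obtain ⟨p', hp'⟩ := h y hy
      exact ⟨r * p', by rw [mul_assoc, hp', map_mul]⟩

/-- The ring homomorphism `Ore(DH) → Ore(E[t, t⁻¹])` induced by `u ∗ h ↦ ι(u ∗ h) t^{-ψ(h)}`. -/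
theorem exists_gradeHom_extension {E : Type*} [DivisionRing E] (ι : TwistedGroupRing S →+* E)
    (hι : Function.Injective ι) (ψ : H →* Multiplicative ℤ) :
    ∃ F : OreField S →+* OreField (trivialStructure E (Multiplicative ℤ)),
      ∀ x, F (toOreField S x) = toOreField _ (gradeHom ι ψ x) := by
  -- Denominators have nonzero image in E[t, t⁻¹], hence become units in its Ore field; the
  -- universal property of the localisation then applies.
  have hinj : ∀ x : TwistedGroupRing S, x ≠ 0 → gradeHom ι ψ x ≠ 0 := by
    intro x hx h0
    obtain ⟨h, hh⟩ := Finsupp.support_nonempty_iff.mpr (mt coeff_eq_zero.mp hx)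
    exact (coeff_gradeHom_ne_zero_iff ι ψ hι x _).mpr ⟨h, Finsupp.mem_support_iff.mp hh, rfl⟩
      (by rw [h0]; rfl)
  let f := (toOreField (trivialStructure E (Multiplicative ℤ))).comp (gradeHom ι ψ)
  let fS : (TwistedGroupRing S)⁰ →* (OreField (trivialStructure E (Multiplicative ℤ)))ˣ :=
    Units.liftRight ((f : _ →* _).comp (TwistedGroupRing S)⁰.subtype)
      (fun q => Units.mk0 (f q) (toOreField_ne_zero (hinj _ (nonZeroDivisors.ne_zero q.2))))
      (fun _ => rfl)
  exact ⟨universalHom f fS fun _ => rfl, fun x => universalHom_commutes f fS fun _ => rfl⟩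

end OreField

/-! ### Matrices acting on row vectors from the right -/

section VecMul

variable (E : Type*) [Ring E] {Λ : Type*} [Ring Λ] [Module E Λ] [IsScalarTower E Λ Λ]
  {m n l : Type*} [Fintype m]

/-- `v ↦ v N`, as a linear map over `E`. -/
def vecMulE (N : Matrix m n Λ) : (m → Λ) →ₗ[E] (n → Λ) where
  toFun v := Matrix.vecMul v N
  map_add' v w := Matrix.add_vecMul N v w
  map_smul' u v := by
    ext i
    simp only [Matrix.vecMul, dotProduct, Pi.smul_apply, smul_mul_assoc, RingHom.id_apply,
      Finset.smul_sum]

theorem vecMulE_apply (N : Matrix m n Λ) (v : m → Λ) : vecMulE E N v = Matrix.vecMul v N := rfl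

theorem vecMulE_mul [Fintype n] (M : Matrix m n Λ) (N : Matrix n l Λ) :
    vecMulE E (M * N) = vecMulE E N ∘ₗ vecMulE E M :=
  LinearMap.ext fun v => (Matrix.vecMul_vecMul v M N).symm

theorem vecMulE_bijective_of_isUnit [DecidableEq m] (N : Matrix m m Λ) (hN : IsUnit N) :
    Function.Bijective (vecMulE E N) := by
  obtain ⟨u, rfl⟩ := hN
  refine Function.bijective_iff_has_inverse.mpr ⟨vecMulE E (u⁻¹).val, fun v => ?_, fun v => ?_⟩
  · rw [vecMulE_apply, vecMulE_apply, Matrix.vecMul_vecMul, Units.mul_inv, Matrix.vecMul_one]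
  · rw [vecMulE_apply, vecMulE_apply, Matrix.vecMul_vecMul, Units.inv_mul, Matrix.vecMul_one]

end VecMul

/-! ### Codimension of the row space over the coefficients -/

section RowCodim

variable {E : Type*} [Ring E] {m n l : Type*} [Fintype m]

/-- The codimension of the row space. -/
def rowCodim (N : Matrix m n (LaurentRing E)) : ℕ∞ :=
  Module.length E ((n → LaurentRing E) ⧸ LinearMap.range (vecMulE E N))

/-- A row vector passes through M first, so the row space of M N is the image of the row space of M
under v ↦ v N. Only this last map has to be injective. -/
theorem rowCodim_mul [Fintype n] (M : Matrix m n (LaurentRing E)) (N : Matrix n l (LaurentRing E))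
    (hN : Function.Injective (vecMulE E N)) : rowCodim (M * N) = rowCodim M + rowCodim N := by
  rw [rowCodim, vecMulE_mul E]
  exact length_quotient_range_comp _ _ hN

theorem rowCodim_eq_zero_of_surjective (N : Matrix m n (LaurentRing E))
    (hN : Function.Surjective (vecMulE E N)) : rowCodim N = 0 := by
  rw [rowCodim, Module.length_eq_zero_iff, Submodule.Quotient.subsingleton_iff]
  exact LinearMap.range_eq_top.mpr hN

theorem rowCodim_eq_zero_of_isUnit [Fintype n] [DecidableEq n] (N : Matrix n n (LaurentRing E))
    (hN : IsUnit N) : rowCodim N = 0 :=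
  rowCodim_eq_zero_of_surjective N (vecMulE_bijective_of_isUnit E N hN).2

theorem rowCodim_diagonal [Fintype n] [DecidableEq n] (f : n → LaurentRing E) :
    rowCodim (Matrix.diagonal f) =
      ∑ i, Module.length E (LaurentRing E ⧸ LinearMap.range (LaurentRing.mulRight (f i))) := by
  rw [← Module.length_pi_of_fintype, rowCodim, ← relLength_top]
  refine relLength_eq_of_surjective ⊤ _ ((LinearMap.pi fun i =>
    (LinearMap.range (LaurentRing.mulRight (f i))).mkQ ∘ₗ LinearMap.proj i) ∘ₗ
      (⊤ : Submodule E (n → LaurentRing E)).subtype) ?_ ?_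
  · intro w
    choose v hv using fun i => Submodule.mkQ_surjective _ (w i)
    exact ⟨⟨v, trivial⟩, funext hv⟩
  · rintro ⟨v, hv⟩
    simp only [funext_iff, LinearMap.comp_apply, LinearMap.pi_apply, LinearMap.proj_apply,
      Submodule.mkQ_apply, Pi.zero_apply, Submodule.Quotient.mk_eq_zero, Submodule.subtype_apply]
    constructor
    · intro h
      choose g hg using h
      refine ⟨g, funext fun i => ?_⟩
      rw [vecMulE_apply, Matrix.vecMul_diagonal]
      exact hg i
    · rintro ⟨g, hg⟩ i
      refine ⟨g i, ?_⟩
      rw [← hg, vecMulE_apply, Matrix.vecMul_diagonal]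
      rfl

end RowCodim

/-! ### Degrees of matrix fractions and the Dieudonné determinant -/

section Degree

open TwistedGroupRing LaurentRing Algebra

variable {D H : Type*} [DivisionRing D] [CommGroup H] [UniqueProds H]
  {S : StructureFunctions D H} (ψ : H →* Multiplicative ℤ) {n : ℕ}

variable (S) in
/-- The width of the Newton polytope in direction `ψ`, as a homomorphism on `Ore(DH)^×`. -/
def unitWidth [IsMulTorsionFree H] : (OreField S)ˣ →* Multiplicative ℝ :=
  (AddMonoidHom.toMultiplicative
    (GrothendieckAddGroup.lift (widthHom (realExtension ψ)))).comp (polytopeHom S)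

theorem lift_widthHom_of {H : Type*} [CommGroup H] (ψ : H →* Multiplicative ℤ) (P : integralPolytopes H) :
    GrothendieckAddGroup.lift (widthHom (realExtension ψ)) (GrothendieckAddGroup.of P) =
      widthHom (realExtension ψ) P :=
  DFunLike.congr_fun (GrothendieckAddGroup.lift.symm_apply_apply _) _

theorem unitWidth_of_mul_eq [IsMulTorsionFree H] (x : (OreField S)ˣ) (q p : TwistedGroupRing S) (hq : q ≠ 0)
    (hp : p ≠ 0) (h : toOreField S q * x = toOreField S p) :
    (unitWidth S ψ x).toAdd = widthHom (realExtension ψ) (newtonPolytope p hp) -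
      widthHom (realExtension ψ) (newtonPolytope q hq) := by
  have hx : (x : OreField S) = p /ₒ (⟨q, mem_nonZeroDivisors_of_ne_zero hq⟩ :
      (TwistedGroupRing S)⁰) := by
    apply mul_left_cancel₀ (toOreField_ne_zero hq)
    rw [h]
    change OreLocalization.numeratorHom p = OreLocalization.numeratorHom
      ((⟨q, mem_nonZeroDivisors_of_ne_zero hq⟩ : (TwistedGroupRing S)⁰) : TwistedGroupRing S) * _
    rw [OreLocalization.numeratorHom_apply, OreLocalization.numeratorHom_apply,
      OreLocalization.mul_cancel]
  have h1 : (unitWidth S ψ x).toAdd = GrothendieckAddGroup.lift (widthHom (realExtension ψ))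
    (polytopeHom S x).toAdd := rfl
  rw [h1, polytopeHom_apply x p hp _ hx, toAdd_ofAdd, map_sub, lift_widthHom_of, lift_widthHom_of]

variable (S) in
/-- The ring homomorphism `DH → Ore(DH)[t, t⁻¹]`, `u ∗ h ↦ (u ∗ h) t^{-ψ(h)}`. -/
abbrev oreGrade : TwistedGroupRing S →+* LaurentRing (OreField S) :=
  gradeHom (toOreField S) ψ

/-- The grading extends to Ore(DH) → Ore(E[t, t⁻¹]) with E = Ore(DH), and ring homomorphisms
preserve invertible matrices. Over the larger skew field v is recovered from its product with the
graded matrix, although that matrix need not be invertible over E[t, t⁻¹] itself. -/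
theorem vecMulE_injective_of_isUnit {A : Matrix (Fin n) (Fin n) (TwistedGroupRing S)}
    (hA : IsUnit (A.map (toOreField S))) :
    Function.Injective (vecMulE (OreField S) (A.map (oreGrade S ψ))) := by
  obtain ⟨F, hF⟩ := exists_gradeHom_extension (toOreField S) toOreField_injective ψ
  rw [injective_iff_map_eq_zero]
  intro v hv
  have h1 := hA.map (F.mapMatrix)
  have h2 : F.mapMatrix (A.map (toOreField S)) =
      (A.map (oreGrade S ψ)).map (toOreField (trivialStructure (OreField S) (Multiplicative ℤ))) := by
    ext i j
    exact hF (A i j)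
  rw [h2] at h1
  have h3 : Matrix.vecMul (toOreField _ ∘ v) ((A.map (oreGrade S ψ)).map
      (toOreField (trivialStructure (OreField S) (Multiplicative ℤ)))) = 0 := by
    ext j
    rw [← RingHom.map_vecMul]
    rw [vecMulE_apply] at hv
    rw [hv]
    simp
  obtain ⟨u, hu⟩ := h1
  rw [← hu] at h3
  have h4 := congrArg (Matrix.vecMul · (u⁻¹).val) h3
  simp only [Matrix.vecMul_vecMul, Units.mul_inv, Matrix.vecMul_one, Matrix.zero_vecMul] at h4
  ext1 i
  exact toOreField_injective (by rw [Pi.zero_apply, map_zero]; exact congrFun h4 i)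

/-- `A` is invertible over `Ore(DH)`, and its row space over `Ore(DH)[t, t⁻¹]` has
codimension `k`. -/
def HasCodim (A : Matrix (Fin n) (Fin n) (TwistedGroupRing S)) (k : ℕ) : Prop :=
  IsUnit (A.map (toOreField S)) ∧ rowCodim (A.map (oreGrade S ψ)) = k

variable {ψ}

theorem rowCodim_map_mul (A B : Matrix (Fin n) (Fin n) (TwistedGroupRing S))
    (hB : IsUnit (B.map (toOreField S))) : rowCodim ((A * B).map (oreGrade S ψ)) =
      rowCodim (A.map (oreGrade S ψ)) + rowCodim (B.map (oreGrade S ψ)) := by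
  rw [Matrix.map_mul, rowCodim_mul _ _ (vecMulE_injective_of_isUnit ψ hB)]

theorem HasCodim.mul {A B : Matrix (Fin n) (Fin n) (TwistedGroupRing S)} {k l : ℕ}
    (hA : HasCodim ψ A k) (hB : HasCodim ψ B l) : HasCodim ψ (A * B) (k + l) := by
  refine ⟨?_, ?_⟩
  · rw [Matrix.map_mul]; exact hA.1.mul hB.1
  · rw [rowCodim_map_mul _ _ hB.1, hA.2, hB.2]; norm_cast

/-- Additivity allows cancellation of a factor: invertibility of A over the Ore field follows from
that of B and C, and its codimension is finite because a sum containing it is. -/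
theorem HasCodim.of_mul {A B C : Matrix (Fin n) (Fin n) (TwistedGroupRing S)} {k l : ℕ}
    (hC : HasCodim ψ C l) (hB : HasCodim ψ B k) (h : A * B = C) :
    ∃ a, HasCodim ψ A a ∧ a + k = l := by
  have hA : IsUnit (A.map (toOreField S)) := by
    have h1 := hC.1
    rw [← h, Matrix.map_mul] at h1
    obtain ⟨u, hu⟩ := hB.1
    rw [← hu] at h1
    exact (Units.isUnit_mul_units _ u).mp h1
  have h2 := hC.2
  rw [← h, rowCodim_map_mul _ _ hB.1, hB.2] at h2
  have hne : rowCodim (A.map (oreGrade S ψ)) ≠ ⊤ := by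
    intro htop
    rw [htop, top_add] at h2
    exact ENat.top_ne_natCast _ h2
  obtain ⟨a, ha⟩ := ENat.ne_top_iff_exists.mp hne
  refine ⟨a, ⟨hA, ha.symm⟩, ?_⟩
  rw [← ha] at h2
  exact_mod_cast h2

theorem HasCodim.of_mul' {A B C : Matrix (Fin n) (Fin n) (TwistedGroupRing S)} {k l : ℕ}
    (hC : HasCodim ψ C l) (hB : HasCodim ψ B k) (h : B * A = C) :
    ∃ a, HasCodim ψ A a ∧ a + k = l := by
  have hA : IsUnit (A.map (toOreField S)) := by
    have h1 := hC.1
    rw [← h, Matrix.map_mul] at h1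
    obtain ⟨u, hu⟩ := hB.1
    rw [← hu] at h1
    exact (Units.isUnit_units_mul u _).mp h1
  have h2 := hC.2
  rw [← h, rowCodim_map_mul _ _ hA, hB.2] at h2
  have hne : rowCodim (A.map (oreGrade S ψ)) ≠ ⊤ := by
    intro htop
    rw [htop, add_top] at h2
    exact ENat.top_ne_natCast _ h2
  obtain ⟨a, ha⟩ := ENat.ne_top_iff_exists.mp hne
  refine ⟨a, ⟨hA, ha.symm⟩, ?_⟩
  rw [← ha, add_comm] at h2
  exact_mod_cast h2

theorem HasCodim.of_isUnit {A : Matrix (Fin n) (Fin n) (TwistedGroupRing S)} (hA : IsUnit A) :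
    HasCodim ψ A 0 :=
  ⟨hA.map (toOreField S).mapMatrix, by
    rw [Nat.cast_zero]
    exact rowCodim_eq_zero_of_isUnit _ (hA.map (oreGrade S ψ).mapMatrix)⟩

variable (ψ) in
-- The cokernel splits into the cokernels of the entries, each of which is handled by
-- `exists_length_eq_width`.
theorem HasCodim.diagonal (d : Fin n → TwistedGroupRing S) (hd : ∀ i, d i ≠ 0) :
    ∃ k, HasCodim ψ (Matrix.diagonal d) k ∧
      (k : ℝ) = ∑ i, widthHom (realExtension ψ) (newtonPolytope (d i) (hd i)) := by
  choose k hk hk' using fun i =>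
    exists_length_eq_width (toOreField S) ψ toOreField_injective (d i) (hd i)
  refine ⟨∑ i, k i, ⟨?_, ?_⟩, ?_⟩
  · rw [Matrix.diagonal_map (map_zero _)]
    let u : Fin n → (OreField S)ˣ := fun i => Units.mk0 _ (toOreField_ne_zero (hd i))
    exact ⟨⟨Matrix.diagonal fun i => (u i : OreField S),
      Matrix.diagonal fun i => ((u i)⁻¹ : (OreField S)ˣ), by simp, by simp⟩, rfl⟩
  · rw [Matrix.diagonal_map (map_zero _), rowCodim_diagonal]
    simp only [hk]
    norm_cast
  · push_cast
    exact Finset.sum_congr rfl fun i _ => (hk' i).symm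

theorem exists_common_denominator_matrix (X : Matrix (Fin n) (Fin n) (OreField S)) :
    ∃ (q : TwistedGroupRing S) (P : Matrix (Fin n) (Fin n) (TwistedGroupRing S)), q ≠ 0 ∧
      (Matrix.diagonal fun _ => q).map (toOreField S) * X = P.map (toOreField S) := by
  classical
  obtain ⟨q, hq, h⟩ := exists_common_denominator
    ((Finset.univ : Finset (Fin n × Fin n)).image fun ij => X ij.1 ij.2)
  choose P hP using fun i j => h (X i j) (Finset.mem_image.mpr ⟨(i, j), Finset.mem_univ _, rfl⟩)
  refine ⟨q, Matrix.of P, hq, ?_⟩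
  ext i j
  rw [Matrix.diagonal_map (map_zero _), Matrix.diagonal_mul]
  exact hP i j

variable (ψ) in
/-- The matrix `X` over `Ore(DH)` has degree `k`: it is a fraction `Q⁻¹ A` of matrices over `DH`
whose codimensions differ by `k`. -/
def HasDegree (X : Matrix (Fin n) (Fin n) (OreField S)) (k : ℝ) : Prop :=
  ∃ (Q A : Matrix (Fin n) (Fin n) (TwistedGroupRing S)) (q a : ℕ), HasCodim ψ Q q ∧
    HasCodim ψ A a ∧ Q.map (toOreField S) * X = A.map (toOreField S) ∧ (a : ℝ) - q = k

theorem map_toOreField_injective : Function.Injective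
    fun A : Matrix (Fin n) (Fin n) (TwistedGroupRing S) => A.map (toOreField S) :=
  Matrix.map_injective toOreField_injective

theorem HasDegree.one : HasDegree ψ (1 : Matrix (Fin n) (Fin n) (OreField S)) 0 :=
  ⟨1, 1, 0, 0, .of_isUnit isUnit_one, .of_isUnit isUnit_one, by simp, by simp⟩

/-- To multiply Q⁻¹A by Q'⁻¹B, use the Ore condition for matrices: write A Q'⁻¹ = C⁻¹P with C
scalar, so that the product is (C Q)⁻¹(P B). The relation C A = P Q' determines the codimension of
P, and the contributions of C cancel. -/
theorem HasDegree.mul {X Y : Matrix (Fin n) (Fin n) (OreField S)} {k l : ℝ}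
    (hX : HasDegree ψ X k) (hY : HasDegree ψ Y l) : HasDegree ψ (X * Y) (k + l) := by
  obtain ⟨Q, A, q, a, hQ, hA, hQA, hk⟩ := hX
  obtain ⟨Q', B, q', b, hQ', hB, hQB, hl⟩ := hY
  obtain ⟨u, hu⟩ := hQ'.1
  -- Here u is Q' over the Ore field, so the fraction being cleared is A Q'⁻¹.
  obtain ⟨p, P, hp, hP⟩ := exists_common_denominator_matrix
    (A.map (toOreField S) * ((u⁻¹ : (Matrix _ _ _)ˣ) : Matrix (Fin n) (Fin n) (OreField S)))
  obtain ⟨c, hc, -⟩ := HasCodim.diagonal ψ (fun _ : Fin n => p) fun _ => hp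
  set C : Matrix (Fin n) (Fin n) (TwistedGroupRing S) := Matrix.diagonal fun _ => p
  have hCA : (C * A).map (toOreField S) = (P * Q').map (toOreField S) := by
    rw [Matrix.map_mul, Matrix.map_mul, ← hP, ← hu]
    simp [mul_assoc]
  obtain ⟨s, hs, hsq⟩ := (hc.mul hA).of_mul hQ' (map_toOreField_injective hCA).symm
  refine ⟨C * Q, P * B, _, _, hc.mul hQ, hs.mul hB, ?_, ?_⟩
  · rw [Matrix.map_mul, Matrix.map_mul, ← hQB, mul_assoc, ← mul_assoc (Q.map _), hQA,
      ← mul_assoc, ← Matrix.map_mul, hCA, Matrix.map_mul, mul_assoc]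
  · rw [← hk, ← hl]
    have : (s : ℝ) + q' = c + a := by exact_mod_cast hsq
    push_cast
    linarith

/-- Let q x = p and let Q be diagonal with q at position i and 1 elsewhere. As i ≠ j, the entry of Q
at j is 1, so Q (1 + x e_ij) = (1 + p e_ij) Q. The factor 1 + p e_ij is invertible over DH and has
codimension 0, so both sides of the fraction have the codimension of Q. -/
theorem HasDegree.transvection {i j : Fin n} (hij : i ≠ j) (x : OreField S) :
    HasDegree ψ (1 + Matrix.single i j x) 0 := by
  obtain ⟨q, p, hq, hp⟩ := exists_mul_eq_toOreField x
  obtain ⟨k, hk, -⟩ := HasCodim.diagonal ψ (fun l => if l = i then q else 1) fun l => by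
    split_ifs
    · exact hq
    · exact one_ne_zero
  set Q : Matrix (Fin n) (Fin n) (TwistedGroupRing S) :=
    Matrix.diagonal fun l => if l = i then q else 1
  have hE : IsUnit (1 + Matrix.single i j p) := by
    have hz : Matrix.single i j p * Matrix.single i j p = 0 :=
      Matrix.single_mul_single_of_ne (h := hij.symm) ..
    exact ⟨⟨1 + Matrix.single i j p, 1 - Matrix.single i j p,
      by simp [mul_sub, add_mul, hz], by simp [mul_add, sub_mul, hz]⟩, rfl⟩
  refine ⟨Q, (1 + Matrix.single i j p) * Q, k, 0 + k, hk, (HasCodim.of_isUnit hE).mul hk, ?_,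
    by simp⟩
  ext a b
  have h1 : (Q.map (toOreField S) * (1 + Matrix.single i j x)) a b =
      toOreField S (Q a b) + if a = i ∧ b = j then toOreField S q * x else 0 := by
    rw [mul_add, mul_one, Matrix.add_apply, Matrix.map_apply,
      Matrix.diagonal_map (map_zero _), Matrix.diagonal_mul, Matrix.single_apply]
    rcases eq_or_ne a i with rfl | ha <;> rcases eq_or_ne b j with rfl | hb <;>
      simp [*, Ne.symm]
  have h2 : ((1 + Matrix.single i j p) * Q) a b = Q a b + if a = i ∧ b = j then p else 0 := by
    rw [add_mul, one_mul, Matrix.add_apply, Matrix.mul_diagonal, Matrix.single_apply]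
    rcases eq_or_ne a i with rfl | ha <;> rcases eq_or_ne b j with rfl | hb <;>
      simp [*, Ne.symm]
  rw [h1, Matrix.map_apply, h2, map_add]
  split_ifs
  · rw [hp]
  · rw [map_zero]

theorem HasDegree.of_mem_elementaryMatrices {X : Matrix (Fin n) (Fin n) (OreField S)}
    (hX : X ∈ elementaryMatrices (OreField S) n) : HasDegree ψ X 0 := by
  induction hX using Submonoid.closure_induction with
  | mem X h =>
    obtain ⟨i, j, a, hij, rfl⟩ := h
    exact HasDegree.transvection hij a
  | one => exact HasDegree.one
  | mul X Y _ _ hX hY => simpa using hX.mul hY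

variable (ψ) in
theorem HasDegree.diagonal [IsMulTorsionFree H] (d : Fin n → (OreField S)ˣ) :
    HasDegree ψ (Matrix.diagonal fun i => (d i : OreField S))
      (∑ i, (unitWidth S ψ (d i)).toAdd) := by
  choose q p hq hqp using fun i => exists_mul_eq_toOreField (d i : OreField S)
  have hp : ∀ i, p i ≠ 0 := fun i h0 => by
    have := hqp i
    rw [h0, map_zero] at this
    exact mul_ne_zero (toOreField_ne_zero (hq i)) (d i).ne_zero this
  obtain ⟨k, hk, hk'⟩ := HasCodim.diagonal ψ q hq
  obtain ⟨l, hl, hl'⟩ := HasCodim.diagonal ψ p hp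
  refine ⟨_, _, _, _, hk, hl, ?_, ?_⟩
  · rw [Matrix.diagonal_map (map_zero _), Matrix.diagonal_map (map_zero _),
      Matrix.diagonal_mul_diagonal]
    exact congrArg _ (funext fun i => hqp i)
  · rw [hk', hl', ← Finset.sum_sub_distrib]
    exact Finset.sum_congr rfl fun i _ =>
      (unitWidth_of_mul_eq ψ (d i) (q i) (p i) (hq i) (hp i) (hqp i)).symm

/-- The codimension of the row space is the width of the polytope of the Dieudonné determinant. -/
theorem HasCodim.of_isDieudonneDet [IsMulTorsionFree H]
    (A : Matrix (Fin n) (Fin n) (TwistedGroupRing S))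
    {x : Abelianization (OreField S)ˣ} (hx : IsDieudonneDet (A.map (toOreField S)) x) :
    ∃ k, HasCodim ψ A k ∧ (k : ℝ) = (Abelianization.lift (unitWidth S ψ) x).toAdd := by
  obtain ⟨E, hE, d, hA, rfl⟩ := hx
  have h := (HasDegree.of_mem_elementaryMatrices (ψ := ψ) hE).mul (HasDegree.diagonal ψ d)
  rw [← hA] at h
  obtain ⟨Q, B, q, b, hQ, hB, hQB, hk⟩ := h
  rw [← Matrix.map_mul] at hQB
  -- A itself has entries in DH, so Q A = B is an identity over DH and cancellation gives its
  -- codimension as b - q. Uniqueness of the degree of a fraction is not needed.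
  obtain ⟨a, ha, hab⟩ := hB.of_mul' hQ (map_toOreField_injective hQB)
  refine ⟨a, ha, ?_⟩
  rw [map_prod, toAdd_prod]
  simp only [Abelianization.lift_apply_of]
  have : (a : ℝ) + q = b := by exact_mod_cast hab
  linarith

end Degree

/-! ### Gaussian elimination and existence of the Dieudonné determinant -/

section Elimination

/-- The matrix whose left action adds `v i` times row `k` to row `i`, for all `i`. -/
def addRow {D : Type*} [Ring D] {n : ℕ} (k : Fin n) (v : Fin n → D) : Matrix (Fin n) (Fin n) D :=
  1 + ∑ i, Matrix.single i k (v i)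

theorem addRow_mul_apply {D : Type*} [Ring D] {n : ℕ} (k : Fin n) (v : Fin n → D)
    (B : Matrix (Fin n) (Fin n) D) (i j : Fin n) :
    (addRow k v * B) i j = B i j + v i * B k j := by
  rw [addRow, add_mul, one_mul, Matrix.add_apply, Finset.sum_mul, Matrix.sum_apply,
    Finset.sum_eq_single i]
  · rw [Matrix.single_mul_apply_same]
  · intro l _ hl
    rw [Matrix.single_mul_apply_of_ne _ _ _ _ _ hl.symm]
  · simp

/-- For i ≠ k the products e_ak e_ik vanish, so multiplying transvections with the same column k
merely adds their off-diagonal parts. -/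
theorem addRow_mem_elementaryMatrices {D : Type*} [Ring D] {n : ℕ} (k : Fin n) (v : Fin n → D)
    (hv : v k = 0) : addRow k v ∈ elementaryMatrices D n := by
  have key : ∀ s : Finset (Fin n), k ∉ s →
      1 + ∑ i ∈ s, Matrix.single i k (v i) ∈ elementaryMatrices D n := by
    intro s
    induction s using Finset.induction_on with
    | empty =>
      intro _
      rw [Finset.sum_empty, add_zero]
      exact one_mem _
    | insert a s ha ih =>
      intro hk
      rw [Finset.mem_insert, not_or] at hk
      have h := mul_mem (Submonoid.subset_closure ⟨a, k, v a, Ne.symm hk.1, rfl⟩ :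
        1 + Matrix.single a k (v a) ∈ elementaryMatrices D n) (ih hk.2)
      have hz : Matrix.single a k (v a) * ∑ i ∈ s, Matrix.single i k (v i) = 0 := by
        rw [Finset.mul_sum]
        refine Finset.sum_eq_zero fun i hi => ?_
        exact Matrix.single_mul_single_of_ne (h := by rintro rfl; exact hk.2 hi) ..
      change _ ∈ elementaryMatrices D n at h
      rw [Finset.sum_insert ha, add_comm (Matrix.single a k (v a)), ← add_assoc]
      rwa [add_mul, mul_add (Matrix.single a k (v a)), hz, one_mul, mul_one, add_zero] at h
  have h := key (Finset.univ.erase k) (Finset.notMem_erase k _)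
  rwa [Finset.sum_erase _ (by rw [hv, Matrix.single_zero])] at h

theorem exists_inverse_mem_elementaryMatrices {D : Type*} [Ring D] {n : ℕ}
    {E : Matrix (Fin n) (Fin n) D} (hE : E ∈ elementaryMatrices D n) :
    ∃ F ∈ elementaryMatrices D n, F * E = 1 ∧ E * F = 1 := by
  induction hE using Submonoid.closure_induction with
  | mem X h =>
    obtain ⟨i, j, a, hij, rfl⟩ := h
    have hz : Matrix.single i j a * Matrix.single i j a = 0 :=
      Matrix.single_mul_single_of_ne (h := hij.symm) ..
    have hneg : Matrix.single i j (-a) = -Matrix.single i j a :=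
      map_neg (Matrix.singleAddMonoidHom i j) a
    refine ⟨1 + Matrix.single i j (-a), Submonoid.subset_closure ⟨i, j, -a, hij, rfl⟩, ?_, ?_⟩
    · rw [hneg, ← sub_eq_add_neg]
      simp [mul_add, sub_mul, hz]
    · rw [hneg, ← sub_eq_add_neg]
      simp [mul_sub, add_mul, hz]
  | one => exact ⟨1, one_mem _, mul_one 1, mul_one 1⟩
  | mul X Y _ _ hX hY =>
    obtain ⟨F, hF, h1, h2⟩ := hX
    obtain ⟨F', hF', h1', h2'⟩ := hY
    refine ⟨F' * F, mul_mem hF' hF, ?_, ?_⟩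
    · rw [mul_assoc, ← mul_assoc F, h1, one_mul, h1']
    · rw [mul_assoc, ← mul_assoc Y, h2', one_mul, h2]

variable {D : Type*} [DivisionRing D] {n : ℕ}

/-- Otherwise columns 0, …, k all lie in the span of the first k unit vectors. In terms of the
inverse C, the entries of its row k before position k vanish, and then (C B)_kk = 0. -/
theorem exists_pivot {B : Matrix (Fin n) (Fin n) D} (hB : IsUnit B) (k : Fin n)
    (h : ∀ j < k, ∀ i ≠ j, B i j = 0) : ∃ i, k ≤ i ∧ B i k ≠ 0 := by
  by_contra! hcon
  obtain ⟨u, rfl⟩ := hB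
  have hCB := u.inv_mul
  set C := (u⁻¹).val
  have hcol : ∀ j < k, ∀ l, (C * u.val) l j = C l j * u.val j j := by
    intro j hj l
    rw [Matrix.mul_apply, Finset.sum_eq_single j]
    · intro i _ hi
      rw [h j hj i hi, mul_zero]
    · simp
  have hC : ∀ j < k, C k j = 0 := by
    intro j hj
    have h1 := hcol j hj j
    have h2 := hcol j hj k
    rw [hCB, Matrix.one_apply_eq] at h1
    rw [hCB, Matrix.one_apply_ne hj.ne'] at h2
    refine (mul_eq_zero.mp h2.symm).resolve_right fun h0 => ?_
    rw [h0, mul_zero] at h1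
    exact one_ne_zero h1
  have h3 : (C * u.val) k k = 0 := by
    rw [Matrix.mul_apply]
    refine Finset.sum_eq_zero fun i _ => ?_
    rcases lt_or_ge i k with hi | hi
    · rw [hC i hi, zero_mul]
    · rw [hcon i hi, mul_zero]
  rw [hCB, Matrix.one_apply_eq] at h3
  exact one_ne_zero h3

theorem isUnit_of_mem_elementaryMatrices {E : Matrix (Fin n) (Fin n) D}
    (hE : E ∈ elementaryMatrices D n) : IsUnit E := by
  obtain ⟨F, -, h1, h2⟩ := exists_inverse_mem_elementaryMatrices hE
  exact ⟨⟨E, F, h2, h1⟩, rfl⟩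

/-- Columns are cleared one at a time, above and below the diagonal. A row exchange is not itself a
transvection; a vanishing diagonal entry is repaired by adding a lower row to it. -/
theorem exists_elementary_mul_diagonal_lt {A : Matrix (Fin n) (Fin n) D} (hA : IsUnit A) (k : ℕ) :
    ∃ E ∈ elementaryMatrices D n, ∀ j : Fin n, (j : ℕ) < k → ∀ i ≠ j, (E * A) i j = 0 := by
  induction k with
  | zero => exact ⟨1, one_mem _, fun j hj => absurd hj (Nat.not_lt_zero _)⟩
  | succ k ih =>
    obtain ⟨E, hE, hz⟩ := ih
    by_cases hkn : k < n
    swap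
    · exact ⟨E, hE, fun j _ => hz j (by omega)⟩
    set K : Fin n := ⟨k, hkn⟩
    obtain ⟨i₀, hi₀, hne⟩ := exists_pivot ((isUnit_of_mem_elementaryMatrices hE).mul hA) K
      fun j hj => hz j hj
    obtain ⟨F, hF, hFz, hFK⟩ : ∃ F ∈ elementaryMatrices D n,
        (∀ j < K, ∀ i ≠ j, (F * A) i j = 0) ∧ (F * A) K K ≠ 0 := by
      by_cases hKK : (E * A) K K = 0
      · have hiK : i₀ ≠ K := by rintro rfl; exact hne hKK
        -- Row i₀ is added to row K. Since i₀ ≥ K, row i₀ is zero in every cleared column, so those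
        -- columns are unchanged.
        refine ⟨addRow i₀ (Pi.single K 1) * E, mul_mem (addRow_mem_elementaryMatrices _ _
          (Pi.single_eq_of_ne hiK _)) hE, fun j hj i hij => ?_, ?_⟩
        · rw [mul_assoc, addRow_mul_apply, hz j hj i hij, hz j hj i₀ (hj.trans_le hi₀).ne', mul_zero,
            add_zero]
        · rw [mul_assoc, addRow_mul_apply, hKK, Pi.single_eq_same, one_mul, zero_add]
          exact hne
      · exact ⟨E, hE, fun j hj => hz j hj, hKK⟩
    -- The pivot row is subtracted from every other row; its own zeros in the earlier columns keep
    -- those columns cleared.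
    refine ⟨addRow K (fun i => if i = K then 0 else -(F * A) i K * ((F * A) K K)⁻¹) * F,
      mul_mem (addRow_mem_elementaryMatrices _ _ (if_pos rfl)) hF, fun j hj i hij => ?_⟩
    rw [mul_assoc, addRow_mul_apply]
    rcases (Nat.lt_succ_iff.mp hj).lt_or_eq with hjk | hjk
    · rw [hFz j hjk i hij, hFz j hjk K (ne_of_gt hjk), mul_zero, add_zero]
    · have hjK : j = K := Fin.ext hjk
      subst hjK
      rw [if_neg hij, inv_mul_cancel_right₀ hFK, add_neg_cancel]

/-- Every invertible matrix over a skew field has a Dieudonné determinant. -/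
theorem exists_isDieudonneDet {A : Matrix (Fin n) (Fin n) D} (hA : IsUnit A) :
    ∃ x, IsDieudonneDet A x := by
  obtain ⟨E, hE, hz⟩ := exists_elementary_mul_diagonal_lt hA n
  obtain ⟨F, hF, hFE, -⟩ := exists_inverse_mem_elementaryMatrices hE
  have hne : ∀ i, (E * A) i i ≠ 0 := by
    intro i
    obtain ⟨l, -, hl⟩ := exists_pivot ((isUnit_of_mem_elementaryMatrices hE).mul hA) i
      fun j _ => hz j j.2
    by_cases hli : l = i
    · rwa [hli] at hl
    · exact absurd (hz i i.2 l hli) hl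
  refine ⟨_, F, hF, fun i => Units.mk0 _ (hne i), ?_, rfl⟩
  have hd : Matrix.diagonal (fun i => ((Units.mk0 _ (hne i) : Dˣ) : D)) = E * A := by
    ext i j
    by_cases hij : i = j
    · subst hij
      rw [Matrix.diagonal_apply_eq, Units.val_mk0]
    · rw [Matrix.diagonal_apply_ne _ hij, hz j j.2 i hij]
  rw [hd, ← mul_assoc, hFE, one_mul]

/-- For invertible A the default value of the definition is never taken. Whichever value is chosen,
`HasCodim.of_isDieudonneDet` applies to it. -/
theorem isDieudonneDet_dieudonneDet {A : Matrix (Fin n) (Fin n) D} (hA : IsUnit A) :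
    IsDieudonneDet A (dieudonneDet A) := by
  have h := exists_isDieudonneDet hA
  rw [dieudonneDet, dif_pos h]
  exact h.choose_spec

end Elimination

/-! ### Coordinate projections, inclusions and blocks -/

section Blocks

variable (E : Type*) [Ring E] {Λ : Type*} [Ring Λ] [Module E Λ] [IsScalarTower E Λ Λ]

/-- The projection onto the coordinates in `s`. -/
def coordProj {r : ℕ} (s : Finset (Fin r)) : (Fin r → Λ) →ₗ[E] (Fin s.card → Λ) :=
  vecMulE E ((1 : Matrix (Fin r) (Fin r) Λ).submatrix id (s.orderEmbOfFin rfl))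

/-- The inclusion of the vectors supported in `s`. -/
def coordIncl {r : ℕ} (s : Finset (Fin r)) : (Fin s.card → Λ) →ₗ[E] (Fin r → Λ) :=
  vecMulE E ((1 : Matrix (Fin r) (Fin r) Λ).submatrix (s.orderEmbOfFin rfl) id)

theorem one_submatrix_mul_eq {m n l : Type*} [Fintype m] [DecidableEq m] (e : l → m)
    (M : Matrix m n Λ) : (1 : Matrix m m Λ).submatrix e id * M = M.submatrix e id := by
  ext i j
  simp [Matrix.mul_apply, Matrix.one_apply]

theorem mul_one_submatrix_eq {m n l : Type*} [Fintype n] [DecidableEq n] (e : l → n)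
    (M : Matrix m n Λ) : M * (1 : Matrix n n Λ).submatrix id e = M.submatrix id e := by
  ext i j
  simp [Matrix.mul_apply, Matrix.one_apply]

theorem coordProj_comp_comp_coordIncl {q r : ℕ} (s : Finset (Fin q)) (t : Finset (Fin r))
    (M : Matrix (Fin r) (Fin q) Λ) : coordProj E s ∘ₗ vecMulE E M ∘ₗ coordIncl E t =
      vecMulE E (M.submatrix (t.orderEmbOfFin rfl) (s.orderEmbOfFin rfl)) := by
  rw [coordProj, coordIncl, ← vecMulE_mul, ← vecMulE_mul, one_submatrix_mul_eq,
    mul_one_submatrix_eq]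
  rfl

theorem coordProj_apply {r : ℕ} (s : Finset (Fin r)) (v : Fin r → Λ) (i : Fin s.card) :
    coordProj E s v i = v (s.orderEmbOfFin rfl i) := by
  simp [coordProj, vecMulE_apply, Matrix.vecMul, dotProduct, Matrix.one_apply]

theorem coordIncl_apply {r : ℕ} (s : Finset (Fin r)) (w : Fin s.card → Λ) (i : Fin r) :
    coordIncl E s w i = ∑ k, if s.orderEmbOfFin rfl k = i then w k else 0 := by
  simp [coordIncl, vecMulE_apply, Matrix.vecMul, dotProduct, Matrix.one_apply]

theorem coordProj_surjective {r : ℕ} (s : Finset (Fin r)) :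
    Function.Surjective (coordProj E (Λ := Λ) s) := fun w =>
  ⟨coordIncl E s w, by
    ext i
    rw [coordProj_apply, coordIncl_apply, Finset.sum_eq_single i]
    · simp
    · intro k _ hk
      rw [if_neg fun h => hk ((s.orderEmbOfFin rfl).injective h)]
    · simp⟩

theorem exists_orderEmbOfFin_eq {r : ℕ} {s : Finset (Fin r)} {i : Fin r} (hi : i ∈ s) :
    ∃ k, s.orderEmbOfFin rfl k = i := by
  have : i ∈ Set.range (s.orderEmbOfFin rfl) := by rw [Finset.range_orderEmbOfFin]; exact hi
  exact this

theorem range_coordIncl {r : ℕ} (s : Finset (Fin r)) :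
    LinearMap.range (coordIncl E (Λ := Λ) s) = LinearMap.ker (coordProj E sᶜ) := by
  ext v
  rw [LinearMap.mem_ker]
  constructor
  · rintro ⟨w, rfl⟩
    ext i
    rw [coordProj_apply, coordIncl_apply, Pi.zero_apply]
    refine Finset.sum_eq_zero fun k _ => if_neg fun h => ?_
    have h1 := Finset.mem_compl.mp (sᶜ.orderEmbOfFin_mem rfl i)
    rw [← h] at h1
    exact h1 (s.orderEmbOfFin_mem rfl k)
  · intro hv
    refine ⟨fun k => v (s.orderEmbOfFin rfl k), funext fun i => ?_⟩
    rw [coordIncl_apply]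
    by_cases hi : i ∈ s
    · obtain ⟨k, rfl⟩ := exists_orderEmbOfFin_eq hi
      rw [Finset.sum_eq_single k]
      · simp
      · intro l _ hl
        rw [if_neg fun h => hl ((s.orderEmbOfFin rfl).injective h)]
      · simp
    · obtain ⟨k, rfl⟩ := exists_orderEmbOfFin_eq (Finset.mem_compl.mpr hi)
      have h := congrFun hv k
      rw [coordProj_apply, Pi.zero_apply] at h
      rw [h]
      refine Finset.sum_eq_zero fun l _ => if_neg fun hl => hi ?_
      rw [← hl]
      exact s.orderEmbOfFin_mem rfl l

theorem coordProj_injective {r : ℕ} (s : Finset (Fin r)) (hs : s = Finset.univ) :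
    Function.Injective (coordProj E (Λ := Λ) s) := by
  intro v w h
  ext i
  obtain ⟨k, rfl⟩ := exists_orderEmbOfFin_eq (s := s) (i := i) (by rw [hs]; exact Finset.mem_univ i)
  rw [← coordProj_apply E s v, h, coordProj_apply]

variable {E} in
-- The columns of a block can be enumerated by their own number or by the number of rows. The two
-- are equal but not definitionally so; quantifying P over the size l permits the substitution.
theorem vecMulE_submatrix_cast {q r k c : ℕ} (M : Matrix (Fin r) (Fin q) Λ) (e : Fin c → Fin r)
    (s : Finset (Fin q)) (h : s.card = k)
    (P : ∀ l, ((Fin c → Λ) →ₗ[E] (Fin l → Λ)) → Prop)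
    (hP : P k (vecMulE E (M.submatrix e (s.orderEmbOfFin h)))) :
    P s.card (vecMulE E (M.submatrix e (s.orderEmbOfFin rfl))) := by
  subst h
  exact hP

/-- The lengths of the homology modules of the complex of free modules given by matrices. -/
abbrev matrixHomologyLength {r : ℕ → ℕ} (M : ∀ p, Matrix (Fin (r (p + 1))) (Fin (r p)) Λ) :
    ℕ → ℕ∞ :=
  homologyLength (C := fun p => Fin (r p) → Λ) fun p => vecMulE E (M p)

end Blocks

/-! ### Construction of non-degenerate τ-chains -/

section NondegenerateChain

variable {D : Type*} [DivisionRing D]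

/-- By dimension count, injectivity of v ↦ v A gives surjectivity. Preimages of the unit vectors
form a left inverse B, and A B = 1 follows by cancelling A on the right in A B A = A. -/
theorem isUnit_of_linearIndependent_row {k : ℕ} {A : Matrix (Fin k) (Fin k) D}
    (hA : LinearIndependent D A.row) : IsUnit A := by
  rw [← Matrix.vecMul_injective_iff] at hA
  have hinj : Function.Injective A.vecMulLinear := hA
  have hsurj := LinearMap.injective_iff_surjective.mp hinj
  choose B hB using fun i => hsurj (Pi.single i 1)
  have hBA : Matrix.of B * A = 1 := by
    ext i j
    have := congrFun (hB i) j
    rw [Matrix.vecMulLinear_apply] at this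
    rw [Matrix.one_apply]
    refine Eq.trans this ?_
    rw [Pi.single_apply]
    simp [eq_comm]
  refine ⟨⟨A, Matrix.of B, ?_, hBA⟩, rfl⟩
  refine funext fun i => hA ?_
  change Matrix.vecMul ((A * Matrix.of B).row i) A = Matrix.vecMul ((1 : Matrix _ _ D).row i) A
  have h1 : A * Matrix.of B * A = 1 * A := by rw [mul_assoc, hBA, mul_one, one_mul]
  ext j
  exact congrFun (congrFun h1 i) j

/-- If `v ↦ (v M)|_s` is surjective, some rows of `M` give an invertible block with columns `s`. -/
theorem exists_isUnit_submatrix {q r : ℕ} (M : Matrix (Fin r) (Fin q) D) (s : Finset (Fin q))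
    (h : Function.Surjective (coordProj D s ∘ₗ vecMulE D M)) :
    ∃ (t : Finset (Fin r)) (hc : s.card = t.card),
      IsUnit (M.submatrix (t.orderEmbOfFin rfl) (s.orderEmbOfFin hc)) := by
  classical
  let v : Fin r → (Fin s.card → D) := fun i k => M i (s.orderEmbOfFin rfl k)
  -- The rows restricted to s span, by surjectivity, so a maximal independent family b of them is a
  -- basis and has as many elements as s.
  obtain ⟨b, -, -, hspan, hli⟩ := exists_linearIndepOn_extension (K := D) (v := v)
    (linearIndepOn_empty D v) (Set.empty_subset Set.univ)
  have htop : Submodule.span D (Set.range fun i : b => v i) = ⊤ := by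
    rw [eq_top_iff]
    have h1 : Submodule.span D (v '' Set.univ) ≤ Submodule.span D (v '' b) :=
      Submodule.span_le.mpr hspan
    have h2 : Set.range (fun i : b => v i) = v '' b := by
      rw [Set.image_eq_range]
    rw [h2]
    refine le_trans ?_ h1
    rintro w -
    obtain ⟨x, rfl⟩ := h w
    have h3 : (coordProj D s ∘ₗ vecMulE D M) x = ∑ i, x i • v i := by
      ext k
      rw [LinearMap.comp_apply, coordProj_apply, vecMulE_apply, Matrix.vecMul_eq_sum,
        Finset.sum_apply, Finset.sum_apply]
      rfl
    rw [h3]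
    exact Submodule.sum_mem _ fun i _ =>
      Submodule.smul_mem _ _ (Submodule.subset_span ⟨i, trivial, rfl⟩)
  let B : Module.Basis b D (Fin s.card → D) := Module.Basis.mk hli htop.ge
  have hcard : s.card = b.toFinset.card := by
    have h1 := Module.finrank_eq_card_basis B
    rw [Module.finrank_fin_fun] at h1
    rw [h1, Set.toFinset_card]
  refine ⟨b.toFinset, hcard, isUnit_of_linearIndependent_row ?_⟩
  have hli' : LinearIndependent D fun k : Fin b.toFinset.card =>
      v (b.toFinset.orderEmbOfFin rfl k) := by
    refine hli.comp (fun k => ⟨b.toFinset.orderEmbOfFin rfl k,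
      Set.mem_toFinset.mp (b.toFinset.orderEmbOfFin_mem rfl k)⟩) fun k l hkl => ?_
    have h1 := congrArg Subtype.val hkl
    exact (b.toFinset.orderEmbOfFin rfl).injective h1
  generalize b.toFinset = t at hcard hli'
  have key : ∀ (k : ℕ) (hk : s.card = k), LinearIndependent D
      (M.submatrix (t.orderEmbOfFin rfl) (s.orderEmbOfFin hk)).row := by
    rintro _ rfl
    exact hli'
  exact key _ hcard

variable {r : ℕ → ℕ} {M : ∀ p, Matrix (Fin (r (p + 1))) (Fin (r p)) D}

open Classical in
/-- The row sets of successively chosen invertible blocks. -/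
def blockRows (M : ∀ p, Matrix (Fin (r (p + 1))) (Fin (r p)) D) : ∀ p, Finset (Fin (r p))
  | 0 => ∅
  | p + 1 =>
    if h : ∃ (t : Finset (Fin (r (p + 1)))) (hc : (blockRows M p)ᶜ.card = t.card),
        IsUnit ((M p).submatrix (t.orderEmbOfFin rfl) ((blockRows M p)ᶜ.orderEmbOfFin hc))
    then h.choose else ∅

theorem blockRows_succ {p : ℕ}
    (h : Function.Surjective (coordProj D (blockRows M p)ᶜ ∘ₗ vecMulE D (M p))) :
    ∃ hc : (blockRows M p)ᶜ.card = (blockRows M (p + 1)).card,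
      IsUnit ((M p).submatrix ((blockRows M (p + 1)).orderEmbOfFin rfl)
        ((blockRows M p)ᶜ.orderEmbOfFin hc)) := by
  have h1 := exists_isUnit_submatrix (M p) _ h
  rw [blockRows, dif_pos h1]
  exact h1.choose_spec

/-- Stated for arbitrary row sets because it has two uses: the choice of the next block in
`blockRows`, and the proof that a given non-degenerate τ-chain exhausts the top degree. -/
theorem coordProj_comp_surjective (hM : ∀ p, M (p + 1) * M p = 0)
    (hex : ∀ p, matrixHomologyLength D M p = 0)
    {γ : ∀ p, Finset (Fin (r p))} (h0 : γ 0 = ∅) (p : ℕ)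
    (hu : ∀ q < p, ∃ hc : (γ q)ᶜ.card = (γ (q + 1)).card,
      IsUnit ((M q).submatrix ((γ (q + 1)).orderEmbOfFin rfl) ((γ q)ᶜ.orderEmbOfFin hc))) :
    Function.Surjective (coordProj D (γ p)ᶜ ∘ₗ vecMulE D (M p)) := by
  refine proj_comp_surjective (C := fun p => Fin (r p) → D) (d := fun p => vecMulE D (M p))
    (π := fun p => coordProj D (γ p)ᶜ) (j := fun p => coordIncl D (γ p)) (fun p => ?_)
    (fun p => coordProj_surjective D _) (coordProj_injective D _ (by simp [h0]))
    (fun p => range_coordIncl D (γ p)) hex p fun q hq => ?_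
  · rw [← vecMulE_mul, hM]
    exact LinearMap.ext fun v => Matrix.vecMul_zero v
  · obtain ⟨hc, h⟩ := hu q hq
    rw [coordProj_comp_comp_coordIncl]
    exact vecMulE_submatrix_cast _ _ _ hc (fun _ f => Function.Bijective f)
      (vecMulE_bijective_of_isUnit D _ h)

theorem exists_blockRows (hM : ∀ p, M (p + 1) * M p = 0)
    (hex : ∀ p, matrixHomologyLength D M p = 0) (p : ℕ) :
    ∃ hc : (blockRows M p)ᶜ.card = (blockRows M (p + 1)).card,
      IsUnit ((M p).submatrix ((blockRows M (p + 1)).orderEmbOfFin rfl)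
        ((blockRows M p)ᶜ.orderEmbOfFin hc)) := by
  induction p using Nat.strong_induction_on with
  | _ p ih => exact blockRows_succ (coordProj_comp_surjective hM hex rfl p ih)

end NondegenerateChain

/-! ### Homology of module complexes as lengths of subquotients -/

section Homology

open CategoryTheory

universe v w

variable {D : Type v} [DivisionRing D]

theorem length_homology_shortComplex (T : ShortComplex (ModuleCat.{w} D)) :
    Module.length D T.homology =
      relLength (LinearMap.ker T.g.hom) (LinearMap.range T.f.hom) := by
  rw [T.moduleCatHomologyIso.toLinearEquiv.length_eq]
  have h : LinearMap.range T.moduleCatToCycles =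
      (LinearMap.range T.f.hom).submoduleOf (LinearMap.ker T.g.hom) := by
    ext z
    constructor
    · rintro ⟨x, rfl⟩
      exact ⟨x, rfl⟩
    · rintro ⟨x, hx⟩
      exact ⟨x, Subtype.ext hx⟩
  rw [relLength, ← h]
  rfl

/-- This replaces a complex by coordinates in each degree. It serves both the untwisted base change
and the twisted one. -/
theorem length_homology (K : ChainComplex (ModuleCat.{w} D) ℕ) {C : ℕ → Type*}
    [∀ n, AddCommGroup (C n)] [∀ n, Module D (C n)] (e : ∀ n, K.X n ≃ₗ[D] C n)
    (d : ∀ n, C (n + 1) →ₗ[D] C n)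
    (hd : ∀ n x, e n ((K.d (n + 1) n).hom x) = d n (e (n + 1) x)) (n : ℕ) :
    Module.length D (K.homology n) = homologyLength d n := by
  have hiso : ∀ j, (ComplexShape.down ℕ).next n = j →
      Module.length D (K.homology n) =
        relLength (LinearMap.ker (K.d n j).hom) (LinearMap.range (K.d (n + 1) n).hom) := by
    intro j hj
    refine (ShortComplex.homologyMapIso
      (K.isoSc' (n + 1) n j (by simp) hj)).toLinearEquiv.length_eq.trans ?_
    exact length_homology_shortComplex (K.sc' (n + 1) n j)
  have hrange : (LinearMap.range (K.d (n + 1) n).hom).map (e n).toLinearMap =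
      LinearMap.range (d n) := by
    rw [← LinearMap.range_comp]
    have h1 : (e n).toLinearMap ∘ₗ (K.d (n + 1) n).hom = d n ∘ₗ (e (n + 1)).toLinearMap :=
      LinearMap.ext (hd n)
    rw [h1, LinearMap.range_comp, LinearEquiv.range, Submodule.map_top]
  cases n with
  | zero =>
    -- In the descending shape on ℕ the successor of degree 0 is again 0, and the differential there
    -- is zero, so all chains are cycles.
    rw [hiso 0 (by simp), K.shape 0 0 (by simp), ModuleCat.hom_zero, LinearMap.ker_zero,
      homologyLength, ← relLength_map (e 0).toLinearMap ⊤ _ le_top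
        (fun z _ hz => (e 0).map_eq_zero_iff.mp hz), hrange, Submodule.map_top, LinearEquiv.range]
  | succ n =>
    have hker : (LinearMap.ker (K.d (n + 1) n).hom).map (e (n + 1)).toLinearMap =
        LinearMap.ker (d n) := by
      ext y
      constructor
      · rintro ⟨x, hx, rfl⟩
        have hx' : (K.d (n + 1) n).hom x = 0 := hx
        change d n (e (n + 1) x) = 0
        rw [← hd, hx', map_zero]
      · intro hy
        refine ⟨(e (n + 1)).symm y, ?_, (e (n + 1)).apply_symm_apply y⟩
        apply (e n).injective
        rw [hd, LinearEquiv.apply_symm_apply, map_zero]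
        exact hy
    rw [hiso n (by simp), homologyLength, ← relLength_map (e (n + 1)).toLinearMap _ _ ?_
      (fun z _ hz => (e (n + 1)).map_eq_zero_iff.mp hz), hrange, hker]
    rintro _ ⟨x, rfl⟩
    have h1 : K.d (n + 1 + 1) (n + 1) ≫ K.d (n + 1) n = 0 := K.d_comp_d _ _ _
    exact LinearMap.congr_fun (congrArg ModuleCat.Hom.hom h1) x

end Homology

/-! ### Base change of based modules -/

section BasedModule

universe u v w

variable {R : Type u} [Ring R] {D : Type v} [DivisionRing D] (α : R →+* D)

/-- The element `d ⊗ m` of `D ⊗_R M`. -/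
def BaseChange.tmul {M : Type w} [AddCommGroup M] [Module R M] (d : D) (m : M) : BaseChange α M :=
  Submodule.Quotient.mk (d ⊗ₜ[ℤ] m)

section

variable {M N : Type w} [AddCommGroup M] [Module R M] [AddCommGroup N] [Module R N]

theorem BaseChange.tmul_add (d : D) (m m' : M) :
    BaseChange.tmul α d (m + m') = BaseChange.tmul α d m + BaseChange.tmul α d m' := by
  rw [tmul, TensorProduct.tmul_add]; rfl

theorem BaseChange.tmul_zero (d : D) : BaseChange.tmul α d (0 : M) = 0 := by
  rw [tmul, TensorProduct.tmul_zero]; rfl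

theorem BaseChange.smul_tmul (c d : D) (m : M) :
    c • BaseChange.tmul α d m = BaseChange.tmul α (c * d) m := rfl

theorem BaseChange.tmul_smul (d : D) (r : R) (m : M) :
    BaseChange.tmul α d (r • m) = BaseChange.tmul α (d * α r) m := by
  symm
  refine (Submodule.Quotient.eq _).mpr ?_
  exact Submodule.subset_span ⟨d, r, m, rfl⟩

theorem BaseChange.map_tmul (f : M →ₗ[R] N) (d : D) (m : M) :
    BaseChange.map α f (BaseChange.tmul α d m) = BaseChange.tmul α d (f m) := rfl

theorem BaseChange.eq_top_of_tmul_mem {P : Submodule D (BaseChange α M)}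
    (h : ∀ m, BaseChange.tmul α 1 m ∈ P) : P = ⊤ := by
  rw [eq_top_iff]
  rintro x -
  obtain ⟨x, rfl⟩ := Submodule.Quotient.mk_surjective _ x
  induction x using TensorProduct.induction_on with
  | zero => exact P.zero_mem
  | tmul d m =>
    have := P.smul_mem d (h m)
    rw [BaseChange.smul_tmul, mul_one] at this
    exact this
  | add x y hx hy => exact P.add_mem hx hy

variable {α} {W : Type*} [AddCommGroup W] [Module D W]

theorem BaseChange.hom_ext {f g : BaseChange α M →ₗ[D] W}
    (h : ∀ m, f (BaseChange.tmul α 1 m) = g (BaseChange.tmul α 1 m)) : f = g := by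
  have := BaseChange.eq_top_of_tmul_mem α (P := LinearMap.eqLocus f g) h
  refine LinearMap.ext fun x => ?_
  have hx : x ∈ LinearMap.eqLocus f g := by rw [this]; trivial
  exact hx

/-- The map out of `D ⊗_R M` given by an additive map compatible with the scalars. -/
def BaseChange.lift (f : M →ₗ[ℤ] W) (hf : ∀ (r : R) (m : M), f (r • m) = α r • f m) :
    BaseChange α M →ₗ[D] W :=
  (balancedRelations α M).liftQ
    (TensorProduct.AlgebraTensorModule.lift (LinearMap.toSpanSingleton D (M →ₗ[ℤ] W) f)) (by
      rw [balancedRelations, Submodule.span_le]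
      rintro _ ⟨d, r, m, rfl⟩
      simp [hf, mul_smul])

end

section Basis

variable {r s : ℕ} {M N : Type w} [AddCommGroup M] [Module R M] [AddCommGroup N] [Module R N]
  (b : Module.Basis (Fin r) R M) (b' : Module.Basis (Fin s) R N)

/-- The matrix of a linear map, acting on row vectors from the right. -/
def rowMatrix (f : M →ₗ[R] N) : Matrix (Fin r) (Fin s) R :=
  Matrix.of fun j k => b'.repr (f (b j)) k

theorem repr_map_eq_vecMul (f : M →ₗ[R] N) (m : M) (k : Fin s) :
    b'.repr (f m) k = ∑ j, b.repr m j * rowMatrix b b' f j k := by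
  refine (congrArg (fun x => b'.repr (f x) k) (b.sum_repr m).symm).trans ?_
  simp only [map_sum, map_smul, Finsupp.finsetSum_apply, Finsupp.smul_apply, smul_eq_mul]
  rfl

/-- The coordinates `D ⊗_R M → D^r` given by a basis of `M`. -/
def BaseChange.coords : BaseChange α M →ₗ[D] (Fin r → D) :=
  BaseChange.lift
    { toFun := fun m i => α (b.repr m i)
      map_add' := fun m m' => by ext i; simp
      map_smul' := fun k m => by ext i; simp } fun c m => by ext i; simp

theorem BaseChange.coords_tmul (d : D) (m : M) (i : Fin r) :
    BaseChange.coords α b (BaseChange.tmul α d m) i = d * α (b.repr m i) := rfl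

/-- The inverse sends v to the sum of the v_i ⊗ b_i. -/
theorem BaseChange.coords_bijective : Function.Bijective (BaseChange.coords α b) := by
  let inv : (Fin r → D) →ₗ[D] BaseChange α M :=
    ∑ i, (LinearMap.toSpanSingleton D _ (BaseChange.tmul α 1 (b i))) ∘ₗ LinearMap.proj i
  have hinv : ∀ v, inv v = ∑ i, v i • BaseChange.tmul α 1 (b i) := fun v => by
    simp [inv, LinearMap.sum_apply]
  have h1 : inv ∘ₗ BaseChange.coords α b = LinearMap.id := by
    refine BaseChange.hom_ext fun m => ?_
    rw [LinearMap.comp_apply, hinv, LinearMap.id_apply]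
    conv_rhs => rw [← b.sum_repr m]
    have hs : ∀ t : Finset (Fin r), BaseChange.tmul α 1 (∑ i ∈ t, b.repr m i • b i) =
        ∑ i ∈ t, BaseChange.tmul α 1 (b.repr m i • b i) := fun t =>
      map_sum (⟨⟨BaseChange.tmul α 1, BaseChange.tmul_zero α 1⟩, BaseChange.tmul_add α 1⟩ :
        M →+ BaseChange α M) _ _
    rw [hs]
    refine Finset.sum_congr rfl fun i _ => ?_
    rw [BaseChange.coords_tmul, one_mul, BaseChange.smul_tmul, mul_one, BaseChange.tmul_smul,
      one_mul]
  have h2 : ∀ v, BaseChange.coords α b (inv v) = v := by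
    intro v
    ext i
    rw [hinv, map_sum, Finset.sum_apply, Finset.sum_eq_single i]
    · rw [map_smul, Pi.smul_apply, BaseChange.coords_tmul]
      simp
    · intro j _ hj
      rw [map_smul, Pi.smul_apply, BaseChange.coords_tmul]
      simp [hj]
    · simp
  exact ⟨Function.LeftInverse.injective (LinearMap.congr_fun h1),
    Function.RightInverse.surjective h2⟩

theorem BaseChange.coords_map (f : M →ₗ[R] N) (x : BaseChange α M) :
    BaseChange.coords α b' (BaseChange.map α f x) =
      vecMulE D ((rowMatrix b b' f).map α) (BaseChange.coords α b x) := by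
  have h : BaseChange.coords α b' ∘ₗ BaseChange.map α f =
      vecMulE D ((rowMatrix b b' f).map α) ∘ₗ BaseChange.coords α b := by
    refine BaseChange.hom_ext fun m => ?_
    ext k
    rw [LinearMap.comp_apply, LinearMap.comp_apply, BaseChange.map_tmul, BaseChange.coords_tmul,
      repr_map_eq_vecMul b b', vecMulE_apply, Matrix.vecMul, dotProduct, map_sum, one_mul]
    refine Finset.sum_congr rfl fun j _ => ?_
    rw [BaseChange.coords_tmul, one_mul, map_mul, Matrix.map_apply]
  exact LinearMap.congr_fun h x

end Basis

end BasedModule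

/-! ### Untwisting the diagonal action -/

section Twisted

open LaurentRing LaurentPolynomial

universe u v w

variable {D : Type v} [DivisionRing D]

variable (D) in
/-- The ring homomorphism `ℤ[t, t⁻¹] → D[t, t⁻¹]`. -/
def intLaurentHom : ℤ[T;T⁻¹] →+* LaurentRing D :=
  (AddMonoidAlgebra.lift ℤ (LaurentRing D) ℤ
    { toFun := fun k => mono k 1
      map_one' := one_eq_mono.symm
      map_mul' := fun k l => by rw [mono_mul_mono, one_mul] } : _ →ₐ[ℤ] _).toRingHom

theorem intLaurentHom_T (k : ℤ) : intLaurentHom D (T k) = mono (Multiplicative.ofAdd k) 1 := by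
  refine (AddMonoidAlgebra.lift_single _ _ _).trans ?_
  rw [one_smul]
  rfl

theorem induction_T {P : ℤ[T;T⁻¹] → Prop} (x : ℤ[T;T⁻¹]) (hT : ∀ k, P (T k)) (h0 : P 0)
    (hadd : ∀ x y, P x → P y → P (x + y)) (hneg : ∀ x, P x → P (-x)) : P x := by
  have hn : ∀ (n : ℕ) (k : ℤ), P (n • T k) := by
    intro n k
    induction n with
    | zero => rw [zero_smul]; exact h0
    | succ n ih => rw [succ_nsmul]; exact hadd _ _ ih (hT k)
  induction x using LaurentPolynomial.induction_on' with
  | add p q hp hq => exact hadd p q hp hq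
  | C_mul_T n a =>
    have h1 : C a * T n = a • (T n : ℤ[T;T⁻¹]) := by
      rw [LaurentPolynomial.smul_eq_C_mul]
    rw [h1]
    obtain ⟨m, rfl | rfl⟩ := a.eq_nat_or_neg
    · rw [natCast_zsmul]; exact hn m n
    · rw [neg_smul, natCast_zsmul]; exact hneg _ (hn m n)

/-- The variable t is central and integers are central, so the whole image of ℤ[t, t⁻¹] is. -/
theorem intLaurentHom_comm (x : ℤ[T;T⁻¹]) (y : LaurentRing D) :
    intLaurentHom D x * y = y * intLaurentHom D x := by
  induction x using induction_T with
  | hT k => rw [intLaurentHom_T, mono_mul_comm]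
  | h0 => rw [map_zero, zero_mul, mul_zero]
  | hadd x x' hx hx' => rw [map_add, add_mul, mul_add, hx, hx']
  | hneg x hx => rw [map_neg, neg_mul, mul_neg, hx]

variable {G : Type u} [Group G] {α : MonoidAlgebra ℤ G →+* D} {φ : G →* Multiplicative ℤ}
  {β : MonoidAlgebra ℤ G →+* LaurentRing D}

/-- The element `m ⊗ x` of `M ⊗ φ^* ℤ[t, t⁻¹]`. -/
def TwistedModule.tmul (φ : G →* Multiplicative ℤ) {M : Type w} [AddCommGroup M]
    [Module (MonoidAlgebra ℤ G) M] (m : M) (x : ℤ[T;T⁻¹]) : TwistedModule φ M :=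
  ((moduleRep M).tprod (laurentRep φ)).asModuleEquiv.symm (m ⊗ₜ[ℤ] x)

section Module

variable {M N : Type w} [AddCommGroup M] [Module (MonoidAlgebra ℤ G) M] [AddCommGroup N]
  [Module (MonoidAlgebra ℤ G) N]

theorem TwistedModule.single_smul_tmul (g : G) (m : M) (x : ℤ[T;T⁻¹]) :
    MonoidAlgebra.single g (1 : ℤ) • TwistedModule.tmul φ m x =
      TwistedModule.tmul φ (MonoidAlgebra.single g (1 : ℤ) • m) (T (φ g).toAdd * x) := by
  have h := Representation.single_smul ((moduleRep M).tprod (laurentRep φ)) (1 : ℤ) g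
    (TwistedModule.tmul φ m x)
  rw [one_smul] at h
  exact h

theorem TwistedModule.map_tmul (f : M →ₗ[MonoidAlgebra ℤ G] N) (m : M) (x : ℤ[T;T⁻¹]) :
    TwistedModule.map φ f (TwistedModule.tmul φ m x) = TwistedModule.tmul φ (f m) x := rfl

theorem TwistedModule.induction {P : TwistedModule φ M → Prop} (y : TwistedModule φ M)
    (h0 : P 0) (hadd : ∀ x y, P x → P y → P (x + y)) (ht : ∀ m x, P (TwistedModule.tmul φ m x)) :
    P y :=
  TensorProduct.induction_on (motive := P) y h0 ht hadd

variable {r s : ℕ} (b : Module.Basis (Fin r) (MonoidAlgebra ℤ G) M)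
  (b' : Module.Basis (Fin s) (MonoidAlgebra ℤ G) N)

variable (β) in
/-- The additive map `m ⊗ x ↦ (β(mᵢ) x)ᵢ`. -/
def TwistedModule.coordsInt (φ : G →* Multiplicative ℤ) :
    TwistedModule φ M →ₗ[ℤ] (Fin r → LaurentRing D) :=
  TensorProduct.lift (R := ℤ) (M := M) (N := ℤ[T;T⁻¹])
    (LinearMap.mk₂ ℤ (fun m x i => β (b.repr m i) * intLaurentHom D x)
      (fun m m' x => by ext1 i; simp [add_mul])
      (fun c m x => by
        ext1 i
        rw [map_zsmul, Finsupp.smul_apply, map_zsmul, smul_mul_assoc, Pi.smul_apply])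
      (fun m x x' => by ext1 i; simp [mul_add])
      (fun c m x => by ext1 i; rw [map_zsmul, mul_smul_comm, Pi.smul_apply]))

theorem TwistedModule.coordsInt_tmul (m : M) (x : ℤ[T;T⁻¹]) (i : Fin r) :
    TwistedModule.coordsInt β b φ (TwistedModule.tmul φ m x) i =
      β (b.repr m i) * intLaurentHom D x := rfl

/-- The diagonal action contributes t^{φ(g)} through the second factor, while β(g) = α(g) t^{-φ(g)}
appears through the first. The two powers of t cancel and leave α(g); this is why the grading
carries an inverse. -/
theorem TwistedModule.coordsInt_smul
    (hβ : ∀ g, β (MonoidAlgebra.single g 1) = mono (φ g)⁻¹ (α (MonoidAlgebra.single g 1)))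
    (c : MonoidAlgebra ℤ G) (y : TwistedModule φ M) :
    TwistedModule.coordsInt β b φ (c • y) = α c • TwistedModule.coordsInt β b φ y := by
  have hg : ∀ g : G, TwistedModule.coordsInt β b φ (MonoidAlgebra.single g (1 : ℤ) • y) =
      α (MonoidAlgebra.single g 1) • TwistedModule.coordsInt β b φ y := by
    intro g
    induction y using TwistedModule.induction with
    | h0 => rw [smul_zero, map_zero, smul_zero]
    | hadd x y hx hy => rw [smul_add, map_add, map_add, smul_add, hx, hy]
    | ht m x =>
      ext1 i
      rw [TwistedModule.single_smul_tmul, TwistedModule.coordsInt_tmul, Pi.smul_apply,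
        TwistedModule.coordsInt_tmul, map_smul, Finsupp.smul_apply, smul_eq_mul, map_mul, hβ,
        map_mul, intLaurentHom_T, ofAdd_toAdd]
      have h1 : mono (φ g)⁻¹ (α (MonoidAlgebra.single g 1)) * mono (φ g) 1 =
          α (MonoidAlgebra.single g 1) • 1 := by
        rw [mono_mul_mono, inv_mul_cancel, mul_one, one_eq_mono, smul_mono, mul_one]
      rw [← one_mul (β (b.repr m i) * intLaurentHom D x), ← smul_mul_assoc, ← h1]
      simp only [mul_assoc]
      -- The power t^{φ(g)} is moved past the coordinate β(m_i) by centrality.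
      rw [← mul_assoc (β _), ← mono_mul_comm, mul_assoc]
  induction c using MonoidAlgebra.induction_linear with
  | zero => rw [zero_smul, map_zero, map_zero, zero_smul]
  | add c c' hc hc' => rw [add_smul, map_add, map_add, add_smul, hc, hc']
  | single g n =>
    have h1 : (MonoidAlgebra.single g n : MonoidAlgebra ℤ G) = n • MonoidAlgebra.single g 1 := by
      rw [MonoidAlgebra.smul_single, smul_eq_mul, mul_one]
    rw [h1, smul_assoc, map_zsmul, hg, map_zsmul, smul_assoc]

/-- The coordinates `D ⊗_{ℤG} (M ⊗ φ^* ℤ[t, t⁻¹]) → D[t, t⁻¹]^r` given by a basis of `M`. -/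
def TwistedModule.coords
    (hβ : ∀ g, β (MonoidAlgebra.single g 1) = mono (φ g)⁻¹ (α (MonoidAlgebra.single g 1))) :
    BaseChange α (TwistedModule φ M) →ₗ[D] (Fin r → LaurentRing D) :=
  BaseChange.lift (TwistedModule.coordsInt β b φ) (TwistedModule.coordsInt_smul b hβ)

variable (hβ : ∀ g, β (MonoidAlgebra.single g 1) =
  mono (φ g)⁻¹ (α (MonoidAlgebra.single g 1)))

theorem TwistedModule.coords_tmul (d : D) (m : M) (x : ℤ[T;T⁻¹]) (i : Fin r) :
    TwistedModule.coords b hβ (BaseChange.tmul α d (TwistedModule.tmul φ m x)) i =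
      d • (β (b.repr m i) * intLaurentHom D x) := rfl

/-- The inverse sends the monomial u t^k in coordinate i to u ⊗ (b_i ⊗ t^k). The group ring
coefficients of an element of M are absorbed into D by moving g across the tensor product. -/
theorem TwistedModule.coords_bijective : Function.Bijective (TwistedModule.coords b hβ) := by
  let e : Fin r → ℤ → BaseChange α (TwistedModule φ M) := fun i k =>
    BaseChange.tmul α 1 (TwistedModule.tmul φ (b i) (T k))
  let inv : (Fin r → LaurentRing D) →ₗ[D] BaseChange α (TwistedModule φ M) :=
    ∑ i, (Finsupp.linearCombination D fun k : Multiplicative ℤ => e i k.toAdd) ∘ₗ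
      (TwistedGroupRing.coeffEquiv _).toLinearMap ∘ₗ LinearMap.proj i
  have hinv : ∀ i (k : Multiplicative ℤ) (u : D), inv (Pi.single i (mono k u)) = u • e i k.toAdd := by
    intro i k u
    have h1 : inv (Pi.single i (mono k u)) =
        ∑ j, Finsupp.linearCombination D (fun k : Multiplicative ℤ => e j k.toAdd)
          (TwistedGroupRing.coeffEquiv _ ((Pi.single i (mono k u) : Fin r → LaurentRing D) j)) := by
      simp [inv, LinearMap.sum_apply]
    rw [h1, Finset.sum_eq_single i]
    · rw [Pi.single_eq_same]
      exact Finsupp.linearCombination_single D u k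
    · intro j _ hj
      rw [Pi.single_eq_of_ne hj, map_zero, map_zero]
    · simp
  have h1 : ∀ v, TwistedModule.coords b hβ (inv v) = v := by
    intro v
    rw [← Finset.univ_sum_single v, map_sum, map_sum]
    refine Finset.sum_congr rfl fun i _ => ?_
    induction v i using TwistedGroupRing.induction with
    | h0 => rw [Pi.single_zero, map_zero, map_zero]
    | ha x y hx hy => rw [Pi.single_add, map_add, map_add, hx, hy]
    | hs k u =>
      change TwistedModule.coords b hβ (inv (Pi.single i (mono k u))) = Pi.single i (mono k u)
      rw [hinv, map_smul]
      ext1 j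
      rw [Pi.smul_apply, TwistedModule.coords_tmul, one_smul, b.repr_self, intLaurentHom_T,
        ofAdd_toAdd]
      by_cases hj : j = i
      · subst hj
        rw [Finsupp.single_eq_same, Pi.single_eq_same, map_one, one_mul, smul_mono, mul_one]
      · rw [Finsupp.single_eq_of_ne hj, Pi.single_eq_of_ne hj, map_zero, zero_mul, smul_zero]
  -- Since coords ∘ inv is the identity, surjectivity of inv is what makes coords injective.
  have h2 : LinearMap.range inv = ⊤ := by
    refine BaseChange.eq_top_of_tmul_mem α fun y => ?_
    have hadd : ∀ y z, BaseChange.tmul α 1 y ∈ LinearMap.range inv →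
        BaseChange.tmul α 1 z ∈ LinearMap.range inv →
        BaseChange.tmul α 1 (y + z) ∈ LinearMap.range inv := fun y z hy hz => by
      rw [BaseChange.tmul_add]; exact add_mem hy hz
    have h0 : BaseChange.tmul α 1 (0 : TwistedModule φ M) ∈ LinearMap.range inv := by
      rw [BaseChange.tmul_zero]; exact zero_mem _
    have hneg : ∀ y, BaseChange.tmul α 1 y ∈ LinearMap.range inv →
        BaseChange.tmul α 1 (-y) ∈ LinearMap.range inv := fun y hy => by
      have h3 := BaseChange.tmul_add α 1 y (-y)
      rw [add_neg_cancel, BaseChange.tmul_zero] at h3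
      rw [← neg_eq_of_add_eq_zero_right h3.symm]
      exact neg_mem hy
    have hgen : ∀ (g : G) (i : Fin r) (k : ℤ), BaseChange.tmul α 1 (TwistedModule.tmul φ
        (MonoidAlgebra.single g (1 : ℤ) • b i) (T k)) ∈ LinearMap.range inv := by
      intro g i k
      -- For the diagonal action g b_i ⊗ t^k equals g · (b_i ⊗ t^{k - φ(g)}), so g can be moved
      -- across to D.
      have h3 : TwistedModule.tmul φ (MonoidAlgebra.single g (1 : ℤ) • b i) (T k) =
          MonoidAlgebra.single g (1 : ℤ) •
            TwistedModule.tmul φ (b i) (T (-(φ g).toAdd + k)) := by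
        rw [TwistedModule.single_smul_tmul, ← T_add, add_neg_cancel_left]
      rw [h3, BaseChange.tmul_smul, one_mul, ← mul_one (α _), ← BaseChange.smul_tmul]
      exact ⟨_, hinv i (Multiplicative.ofAdd (-(φ g).toAdd + k)) _⟩
    induction y using TwistedModule.induction with
    | h0 => exact h0
    | hadd x y hx hy => exact hadd x y hx hy
    | ht m x =>
      have ta : ∀ (m m' : M) x, TwistedModule.tmul φ (m + m') x =
        TwistedModule.tmul φ m x + TwistedModule.tmul φ m' x := fun m m' x =>
          TensorProduct.add_tmul m m' x
      have tz : ∀ x, TwistedModule.tmul φ (0 : M) x = 0 := fun x => TensorProduct.zero_tmul M x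
      have tn : ∀ (m : M) x, TwistedModule.tmul φ (-m) x = -TwistedModule.tmul φ m x :=
        fun m x => TensorProduct.neg_tmul m x
      induction x using induction_T with
      | h0 =>
        have h3 : TwistedModule.tmul φ m 0 = 0 := TensorProduct.tmul_zero _ m
        rw [h3]
        exact h0
      | hadd x x' hx hx' =>
        have h3 : TwistedModule.tmul φ m (x + x') =
          TwistedModule.tmul φ m x + TwistedModule.tmul φ m x' := TensorProduct.tmul_add m x x'
        rw [h3]
        exact hadd _ _ hx hx'
      | hneg x hx =>
        have h3 : TwistedModule.tmul φ m (-x) = -TwistedModule.tmul φ m x :=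
          TensorProduct.tmul_neg m x
        rw [h3]
        exact hneg _ hx
      | hT k =>
        rw [← b.sum_repr m]
        refine Finset.sum_induction _ (fun m => BaseChange.tmul α 1 (TwistedModule.tmul φ m (T k)) ∈
          LinearMap.range inv) (fun m m' hm hm' => by rw [ta]; exact hadd _ _ hm hm')
          (by rw [tz]; exact h0) fun i _ => ?_
        induction b.repr m i using MonoidAlgebra.induction_linear with
        | zero => rw [zero_smul, tz]; exact h0
        | add c c' hc hc' => rw [add_smul, ta]; exact hadd _ _ hc hc'
        | single g n =>
          have h1 : (MonoidAlgebra.single g n : MonoidAlgebra ℤ G) =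
              n • MonoidAlgebra.single g 1 := by
            rw [MonoidAlgebra.smul_single, smul_eq_mul, mul_one]
          rw [h1, smul_assoc]
          have hn : ∀ n : ℕ, BaseChange.tmul α 1 (TwistedModule.tmul φ
              (n • MonoidAlgebra.single g (1 : ℤ) • b i) (T k)) ∈ LinearMap.range inv := by
            intro n
            induction n with
            | zero => rw [zero_smul, tz]; exact h0
            | succ n ih => rw [succ_nsmul, ta]; exact hadd _ _ ih (hgen g i k)
          obtain ⟨l, rfl | rfl⟩ := n.eq_nat_or_neg
          · rw [natCast_zsmul]; exact hn l
          · rw [neg_smul, natCast_zsmul, tn]; exact hneg _ (hn l)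
  have h3 : Function.Surjective inv := LinearMap.range_eq_top.mp h2
  refine ⟨fun x y hxy => ?_, Function.RightInverse.surjective h1⟩
  obtain ⟨v, rfl⟩ := h3 x
  obtain ⟨w, rfl⟩ := h3 y
  rw [h1, h1] at hxy
  rw [hxy]

theorem TwistedModule.coords_map (f : M →ₗ[MonoidAlgebra ℤ G] N)
    (y : BaseChange α (TwistedModule φ M)) :
    TwistedModule.coords b' hβ (BaseChange.map α (TwistedModule.map φ f) y) =
      vecMulE D ((rowMatrix b b' f).map β) (TwistedModule.coords b hβ y) := by
  have h : TwistedModule.coords b' hβ ∘ₗ BaseChange.map α (TwistedModule.map φ f) =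
      vecMulE D ((rowMatrix b b' f).map β) ∘ₗ TwistedModule.coords b hβ := by
    refine BaseChange.hom_ext fun y => ?_
    induction y using TwistedModule.induction with
    | h0 => rw [BaseChange.tmul_zero, map_zero, map_zero]
    | hadd x y hx hy => rw [BaseChange.tmul_add, map_add, map_add, hx, hy]
    | ht m x =>
      ext1 k
      rw [LinearMap.comp_apply, LinearMap.comp_apply, BaseChange.map_tmul, TwistedModule.map_tmul,
        TwistedModule.coords_tmul, repr_map_eq_vecMul b b', vecMulE_apply, Matrix.vecMul,
        dotProduct, map_sum, one_smul, Finset.sum_mul]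
      refine Finset.sum_congr rfl fun j _ => ?_
      -- The factor x from ℤ[t, t⁻¹] has to pass the matrix entry, which its centrality permits.
      rw [TwistedModule.coords_tmul, one_smul, map_mul, Matrix.map_apply, mul_assoc, mul_assoc,
        intLaurentHom_comm]
  exact LinearMap.congr_fun h y

end Module

end Twisted

theorem rowCodim_submatrix_cast {E : Type*} [Ring E] {q r k c : ℕ}
    (M : Matrix (Fin r) (Fin q) (LaurentRing E)) (e : Fin c → Fin r) (s : Finset (Fin q))
    (h : s.card = k) : rowCodim (M.submatrix e (s.orderEmbOfFin rfl)) =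
      rowCodim (M.submatrix e (s.orderEmbOfFin h)) := by
  subst h
  rfl

/-! ### Betti numbers and τ-chains of based complexes -/

section BasedComplex

open CategoryTheory LaurentRing

universe u v w

namespace FiniteBasing

section Ring

variable {R : Type u} [Ring R] {D : Type v} [DivisionRing D] {C : ChainComplex (ModuleCat.{w} R) ℕ}
  (b : FiniteBasing C)

theorem matrix_mul_matrix (p : ℕ) : b.matrix (p + 1) * b.matrix p = 0 := by
  ext i k
  rw [Matrix.mul_apply]
  refine (repr_map_eq_vecMul (b.basis (p + 1)) (b.basis p) (C.d (p + 1) p).hom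
    ((C.d (p + 2) (p + 1)).hom (b.basis (p + 2) i)) k).symm.trans ?_
  have h1 : C.d (p + 2) (p + 1) ≫ C.d (p + 1) p = 0 := C.d_comp_d _ _ _
  have h2 := LinearMap.congr_fun (congrArg ModuleCat.Hom.hom h1) (b.basis (p + 2) i)
  rw [ModuleCat.hom_comp, LinearMap.comp_apply] at h2
  rw [h2]
  simp

theorem agrarianBetti_eq (α : R →+* D) (n : ℕ) :
    agrarianBetti α C n = matrixHomologyLength D (fun p => (b.matrix p).map α) n := by
  rw [agrarianBetti, ← Module.length_eq_rank]
  refine length_homology _ (C := fun p => Fin (b.rank p) → D)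
    (fun p => LinearEquiv.ofBijective _ (BaseChange.coords_bijective (α := α) (b.basis p))) _
    (fun p x => ?_) n
  exact BaseChange.coords_map α (b.basis (p + 1)) (b.basis p) (C.d (p + 1) p).hom x

end Ring

variable {G : Type u} [Group G] {D : Type v} [DivisionRing D]
  {C : ChainComplex (ModuleCat.{w} (MonoidAlgebra ℤ G)) ℕ} (b : FiniteBasing C)

/-- In the coordinates of `TwistedModule.coords` the twisted complex has the same matrices A_p, now
read through β instead of α. -/
theorem twistedBetti_eq {α : MonoidAlgebra ℤ G →+* D} {φ : G →* Multiplicative ℤ}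
    {β : MonoidAlgebra ℤ G →+* LaurentRing D}
    (hβ : ∀ g, β (MonoidAlgebra.single g 1) = mono (φ g)⁻¹ (α (MonoidAlgebra.single g 1))) (n : ℕ) :
    twistedBetti α φ C n = matrixHomologyLength D (fun p => (b.matrix p).map β) n := by
  rw [twistedBetti, agrarianBetti, ← Module.length_eq_rank]
  refine length_homology _ (C := fun p => Fin (b.rank p) → LaurentRing D)
    (fun p => LinearEquiv.ofBijective _ (TwistedModule.coords_bijective (b.basis p) hβ)) _
    (fun p x => ?_) n
  exact TwistedModule.coords_map (b.basis (p + 1)) (b.basis p) hβ (C.d (p + 1) p).hom x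

end FiniteBasing

namespace FiniteBasing

variable {R : Type u} [Ring R] {D : Type v} [DivisionRing D] {C : ChainComplex (ModuleCat.{w} R) ℕ}
  {b : FiniteBasing C} {α : R →+* D}

theorem map_matrix_mul_map_matrix {Λ : Type*} [Ring Λ] (β : R →+* Λ) (p : ℕ) :
    (b.matrix (p + 1)).map β * (b.matrix p).map β = 0 := by
  rw [← Matrix.map_mul, b.matrix_mul_matrix]
  exact Matrix.map_zero _ (map_zero β)

/-- Exactness makes each successive projected differential surjective, so a further invertible block
can always be chosen. Hence the torsion is that of an actual τ-chain and not the default value. -/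
theorem exists_isNondegenerate (hC : IsAcyclicOver α C) :
    ∃ t : b.TauChain, t.IsNondegenerate α := by
  have hex : ∀ p, matrixHomologyLength D (fun p => (b.matrix p).map α) p = 0 := fun p => by
    rw [← b.agrarianBetti_eq]; exact hC p
  have h := exists_blockRows (M := fun p => (b.matrix p).map α)
    (fun p => map_matrix_mul_map_matrix α p) hex
  exact ⟨⟨blockRows fun p => (b.matrix p).map α, rfl, fun p _ => (h p).1⟩, fun p => (h p).2⟩

/-- The projected differential out of degree dim + 1 is onto the coordinates outside γ in degree
dim, but its source is zero. -/
theorem TauChain.card_compl_eq_zero {t : b.TauChain} (ht : t.IsNondegenerate α)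
    (hC : IsAcyclicOver α C) : (t.γ b.dim)ᶜ.card = 0 := by
  have hex : ∀ p, matrixHomologyLength D (fun p => (b.matrix p).map α) p = 0 := fun p => by
    rw [← b.agrarianBetti_eq]; exact hC p
  have h := coordProj_comp_surjective (M := fun p => (b.matrix p).map α)
    (fun p => map_matrix_mul_map_matrix α p) hex t.γ_zero b.dim
    fun q hq => ⟨t.card_eq q hq, ht ⟨q, hq⟩⟩
  have : IsEmpty (Fin (b.rank (b.dim + 1))) := by
    rw [b.rank_eq_zero _ (Nat.lt_succ_self _)]; infer_instance
  have hs : Subsingleton (Fin (t.γ b.dim)ᶜ.card → D) := h.subsingleton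
  by_contra hne
  have : Nonempty (Fin (t.γ b.dim)ᶜ.card) := ⟨⟨0, Nat.pos_of_ne_zero hne⟩⟩
  exact not_subsingleton _ hs

end FiniteBasing

end BasedComplex

/-! ### Width on the reduced abelianisation -/

section Thickness

open Algebra TwistedGroupRing

variable {H : Type*} [CommGroup H] [IsMulTorsionFree H] [UniqueProds H] {D : Type*}
  [DivisionRing D] (S : StructureFunctions D H) (ψ : H →* Multiplicative ℤ)

/-- The width of the polytope, as a homomorphism on `Ore(DH)^×_ab / {±1}`. -/
def reducedWidth : ReducedAbelianization (OreField S) →* Multiplicative ℝ :=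
  (AddMonoidHom.toMultiplicative
    (GrothendieckAddGroup.lift (widthHom (realExtension ψ)))).comp (reducedPolytopeHom S)

theorem reducedWidth_coe (x : Abelianization (OreField S)ˣ) :
    reducedWidth S ψ (x : ReducedAbelianization (OreField S)) =
      Abelianization.lift (unitWidth S ψ) x := by
  obtain ⟨u, rfl⟩ := QuotientGroup.mk'_surjective _ x
  rfl

end Thickness

/-! ### Conclusion -/

section Main

open CategoryTheory LaurentRing TwistedGroupRing

universe w

variable {G D : Type*} [Group G] [Group.FG G] [DivisionRing D] (α : MonoidAlgebra ℤ G →+* D)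
  (s : FreeAb G → G) (φ : G →* Multiplicative ℤ)

/-- The ring homomorphism `ℤG → D_r[t, t⁻¹]`, `g ↦ α_r(g) t^{-φ(g)}`. -/
def gradedRationalisation : MonoidAlgebra ℤ G →+* LaurentRing (RationalField α s) :=
  (oreGrade (sectionStructure α s) (FreeAb.lift φ)).comp (toTwistedGroupRing α (FreeAb.mk G) s)

theorem gradedRationalisation_single (g : G) :
    gradedRationalisation α s φ (MonoidAlgebra.single g 1) =
      mono (φ g)⁻¹ (rationalisation α s (MonoidAlgebra.single g 1)) := by
  have h : toTwistedGroupRing α (FreeAb.mk G) s (MonoidAlgebra.single g 1) =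
      TwistedGroupRing.single (sectionStructure α s) (FreeAb.mk G g)
        (groupUnit α (g * (s (FreeAb.mk G g))⁻¹) : D) :=
    (MonoidAlgebra.lift_single _ _ _).trans (one_smul _ _)
  rw [gradedRationalisation, rationalisation, RingHom.comp_apply, RingHom.comp_apply, h,
    gradeHom_single]
  rfl

/-- The minus sign comes from the inverse of the torsion in P(-ρ). The quotient by translations
plays no role, as thickness is defined there by descent. -/
theorem thickness_agrarianPolytope {C : ChainComplex (ModuleCat.{w} (MonoidAlgebra ℤ G)) ℕ}
    (b : FiniteBasing C) : thickness φ (agrarianPolytope α s b) =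
      -(reducedWidth (sectionStructure α s) (FreeAb.lift φ)
        (b.torsion (rationalisation α s))).toAdd := by
  rw [← toAdd_inv, ← map_inv]
  rfl

variable {α s φ} in
-- The rationalisation factors through DH, so the block already has entries in DH and becomes
-- invertible over Ore(DH). One integer k is then both the codimension of its graded row space and
-- the width of its determinant.
theorem exists_blockCodim {C : ChainComplex (ModuleCat.{w} (MonoidAlgebra ℤ G)) ℕ}
    {b : FiniteBasing C} {t : b.TauChain} (ht : t.IsNondegenerate (rationalisation α s))
    (p : Fin b.dim) :
    ∃ k : ℕ, Function.Injective (vecMulE (RationalField α s)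
        ((t.S p).map (gradedRationalisation α s φ))) ∧
      rowCodim ((t.S p).map (gradedRationalisation α s φ)) = k ∧
      (reducedWidth (sectionStructure α s) (FreeAb.lift φ)
        (dieudonneDet ((t.S p).map (rationalisation α s)) :
          Abelianization (RationalField α s)ˣ)).toAdd = k := by
  have hu : IsUnit (((t.S p).map (toTwistedGroupRing α (FreeAb.mk G) s)).map
    (toOreField (sectionStructure α s))) := ht p
  obtain ⟨k, hk, hk'⟩ := HasCodim.of_isDieudonneDet (ψ := FreeAb.lift φ) _
    (isDieudonneDet_dieudonneDet hu)
  refine ⟨k, vecMulE_injective_of_isUnit (FreeAb.lift φ) hu, hk.2, ?_⟩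
  rw [reducedWidth_coe]
  exact hk'.symm

theorem thickness_eq_neg_twistedEulerChar
    {C : ChainComplex (ModuleCat.{w} (MonoidAlgebra ℤ G)) ℕ} (b : FiniteBasing C)
    (hC : IsAcyclicOver (rationalisation α s) C) :
    totalTwistedBetti (rationalisation α s) φ C < ⊤ ∧
      thickness φ (agrarianPolytope α s b) =
        -((twistedEulerChar (rationalisation α s) φ C : ℤ) : ℝ) := by
  have hex := b.exists_isNondegenerate hC
  -- This fixes the very τ-chain that the definition of the torsion selects.
  obtain ⟨t, ht, htor⟩ : ∃ t : b.TauChain, t.IsNondegenerate (rationalisation α s) ∧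
      b.torsion (rationalisation α s) = t.torsion (rationalisation α s) :=
    ⟨hex.choose, hex.choose_spec, by rw [FiniteBasing.torsion, dif_pos hex]⟩
  choose k hinj hk hwidth using fun p => exists_blockCodim (φ := φ) ht p
  have hempty : IsEmpty (Fin (t.γ b.dim)ᶜ.card) := by
    rw [t.card_compl_eq_zero ht hC]; infer_instance
  obtain ⟨h, hh, hh0, hsum⟩ := euler_characteristic_of_blocks (E := RationalField α s)
    (C := fun p => Fin (b.rank p) → LaurentRing (RationalField α s))
    (d := fun p => vecMulE (RationalField α s) ((b.matrix p).map (gradedRationalisation α s φ)))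
    (π := fun p => coordProj (RationalField α s) (t.γ p)ᶜ)
    (j := fun p => coordIncl (RationalField α s) (t.γ p))
    (fun p => by
      rw [← vecMulE_mul, FiniteBasing.map_matrix_mul_map_matrix]
      exact LinearMap.ext fun v => Matrix.vecMul_zero v)
    (fun p => coordProj_surjective _ _) (coordProj_injective _ _ (by simp [t.γ_zero]))
    (fun p => range_coordIncl _ _) b.dim
    (fun p hp => by
      rw [coordProj_comp_comp_coordIncl]
      exact vecMulE_submatrix_cast _ _ _ (t.card_eq p hp) (fun _ f => Function.Injective f)
        (hinj ⟨p, hp⟩))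
    -- Blocks exist only below degree dim; the value 0 beyond it is never used.
    (fun p => if hp : p < b.dim then k ⟨p, hp⟩ else 0)
    (fun p hp => by
      rw [coordProj_comp_comp_coordIncl, dif_pos hp]
      exact (rowCodim_submatrix_cast _ _ _ (t.card_eq p hp)).trans (hk ⟨p, hp⟩))
    inferInstance
    (fun p hp => by
      have : IsEmpty (Fin (b.rank p)) := by rw [b.rank_eq_zero p hp]; infer_instance
      infer_instance)
  have hbetti : ∀ p, twistedBetti (rationalisation α s) φ C p = h p := fun p => by
    rw [b.twistedBetti_eq (gradedRationalisation_single α s φ), ← hh p]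
  constructor
  · have hle : totalTwistedBetti (rationalisation α s) φ C ≤
        ((∑ p ∈ Finset.range (b.dim + 1), h p : ℕ) : ℕ∞) := by
      -- The twisted Betti numbers vanish above degree dim, so every partial sum is bounded by the
      -- sum up to dim.
      refine iSup_le fun N => ?_
      simp only [hbetti]
      rw [← Nat.cast_sum, Nat.cast_le]
      refine Finset.sum_le_sum_of_ne_zero fun p _ hp => ?_
      rw [Finset.mem_range]
      by_contra hlt
      exact hp (hh0 p (by omega))
    exact hle.trans_lt (ENat.natCast_lt_top _)
  · have hchi : twistedEulerChar (rationalisation α s) φ C =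
        ∑ p : Fin b.dim, (-1 : ℤ) ^ (p : ℕ) * k p := by
      rw [twistedEulerChar, finsum_eq_sum_of_support_subset (s := Finset.range (b.dim + 1))]
      · simp only [hbetti, ENat.toNat_natCast]
        rw [hsum, Finset.sum_range]
        exact Finset.sum_congr rfl fun p _ => by rw [dif_pos p.2]
      · intro p hp
        rw [Finset.mem_coe, Finset.mem_range]
        by_contra hlt
        refine hp ?_
        simp [hbetti, hh0 p (by omega)]
    -- The exponents (-1)^p of the multiplicative torsion become the signs of the widths, matching
    -- the Euler characteristic term by term.
    rw [thickness_agrarianPolytope, htor, hchi, FiniteBasing.TauChain.torsion, map_prod, toAdd_prod]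
    push_cast
    congr 1
    refine Finset.sum_congr rfl fun p _ => ?_
    rw [map_zpow, toAdd_zpow, hwidth, zsmul_eq_mul]
    push_cast
    rfl

end Main

end

theorem theorem3p2 {G : Type*} [Group G] [Nontrivial G] [Group.FG G]
    {D : Type*} [DivisionRing D] (α : MonoidAlgebra ℤ G →+* D) (hα : Function.Injective α)
    (s : FreeAb G → G) (hs : ∀ h : FreeAb G, FreeAb.mk G (s h) = h)
    {X : Type*} [TopologicalSpace X] [T2Space X] [Topology.CWComplex (Set.univ : Set X)]
    [MulAction G X] [ContinuousConstSMul G X] (hX : IsFiniteFreeGCW G X)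
    (hacyclic : IsAcyclicOver (rationalisation α s) (cellularComplex G X))
    (b : FiniteBasing (cellularComplex G X)) (hb : IsCellularBasing b)
    (φ : G →* Multiplicative ℤ) :
    totalTwistedBetti (rationalisation α s) φ (cellularComplex G X) < ⊤ ∧
      thickness φ (agrarianPolytope α s b) =
        -((twistedEulerChar (rationalisation α s) φ (cellularComplex G X) : ℤ) : ℝ) :=
  thickness_eq_neg_twistedEulerChar α s φ b hacyclic
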